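/- Let $p$ be an odd prime, $F$ a finite extension of $\mathbb{Q}_p$ with a fixed $p$-adic absolute value $|\cdot|_F$, and $E/F$ a cyclic extension of degree $d$ with $p\nmid d$; let $\theta$ be a generator of $\mathrm{Gal}(E/F)$, acting on $GL_n(E)$ and $M_n(E)$ entrywise. Let $\mathcal{O}_E$ be the ring of integers of $E$, $\varpi_E$ a uniformizer, $m\ge 1$ an integer, $K_E(m)=I_n+\varpi_E^mM_n(\mathcal{O}_E)$ and $K_E(m)_\theta=K_E(m)\cap GL_n(F)$ its $\theta$-fixed part. Fix Haar measures $dh$ on $GL_n(F)$ and $dg$ on $GL_n(E)$, and put $$f^H=\mathrm{vol}(K_E(m)_\theta)^{-1}\mathbf{1}_{K_E(m)_\theta},\qquad f^G=\mathrm{vol}(K_E(m))^{-1}\mathbf{1}_{K_E(m)},\qquad \tilde f^G(g\rtimes\theta)=f^G(g).$$ For $\gamma\in GL_n(F)$ semisimple with centralizer $H_\gamma(F)$ in $GL_n(F)$, put $$I_\gamma(f^H,dh,dh_\gamma)=\bigl|\det(\mathrm{Ad}(\gamma)-1\mid \mathfrak{h}/\mathfrak{h}_\gamma)\bigr|_F^{1/2}\int_{H_\gamma(F)\backslash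 GL_n(F)}f^H(h^{-1}\gamma h)\,\frac{dh}{dh_\gamma},$$ where $\mathfrak{h}=M_n(F)$ and $\mathfrak{h}_\gamma=\ker(\mathrm{Ad}(\gamma)-1)$. For $\delta\in GL_n(E)$ put $G_{\delta\rtimes\theta}(F)=\{g\in GL_n(E): g^{-1}\delta\theta(g)=\delta\}$ and $$I_{\delta\rtimes\theta}(\tilde f^G,dg,dg_{\delta\rtimes\theta})=\bigl|\det\nolimits_F(\mathrm{Ad}(\delta)\circ\theta-1\mid \mathfrak{g}/\mathfrak{g}_{\delta\rtimes\theta})\bigr|_F^{1/2}\int_{G_{\delta\rtimes\theta}(F)\backslash GL_n(E)}f^G(g^{-1}\delta\theta(g))\,\frac{dg}{dg_{\delta\rtimes\theta}},$$ where $\mathfrak{g}=M_n(E)$ is regarded as an $F$-vector space and $\mathfrak{g}_{\delta\rtimes\theta}=\ker(\mathrm{Ad}(\delta)\circ\theta-1)$. Here $dh_\gamma$ and $dg_{\delta\rtimes\theta}$ are Haar measures on $H_\gamma(F)$ and $G_{\delta\rtimes\theta}(F)$. Say that the semisimple element $\gamma$ is a norm of $\delta$ if, over an algebraic closure $\bar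 F$ of $F$, $\delta$ is $\theta$-conjugate in $GL_n(E\otimes_F\bar F)$ to some diagonal matrix $\mathrm{diag}(t_1,\dots,t_n)$ (so $\delta$ is $\theta$-semisimple) such that $\gamma$ is conjugate in $GL_n(\bar F)$ to $\mathrm{diag}(N(t_1),\dots,N(t_n))$, where $N:E\otimes_F\bar F\to\bar F$ is the norm. In that case $\delta\theta(\delta)\cdots\theta^{d-1}(\delta)=x\gamma x^{-1}$ for some $x\in GL_n(E)$, and $X\mapsto x^{-1}Xx$ induces an inner twist between $G_{\delta\rtimes\theta}$ and $H_\gamma$; the measures $dh_\gamma$ and $dg_{\delta\rtimes\theta}$ are called compatible if they come, up to one common constant, from invariant volume forms that correspond under this inner twist. Then, for every semisimple $\gamma\in GL_n(F)$, the integral $I_\gamma(f^H,dh,dh_\gamma)$ converges absolutely, and: 1. if $\gamma$ is a norm of $\delta\in GL_n(E)$ and $dh_\gamma$, $dg_{\delta\rtimes\theta}$ are compatible, then $I_{\delta\rtimes\theta}(\tilde f^G,dg,dg_{\delta\rtimes\theta})$ converges absolutely and $$I_\gamma(f^H,dh,dh_\gamma)=I_{\delta\rtimes\theta}(\tilde f^G,dg,dg_{\delta\rtimes\theta});$$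 2. if $\gamma$ is not a norm of any $\delta\in GL_n(E)$, then $I_\gamma(f^H,dh,dh_\gamma)=0$. -/

import Mathlib

open MeasureTheory Topology Filter
open scoped MatrixGroups TensorProduct ENNReal

namespace TwistedOrbital

section General

variable {G : Type*} [Group G]

/-- The `τ`-twisted centralizer `G_{δ ⋊ τ} = {g ∈ G | g⁻¹ δ τ(g) = δ}` of `δ`
(for `τ = id` this is the usual centralizer of `δ`). -/
def twistedCentralizer (τ : G →* G) (δ : G) : Subgroup G where
  carrier := {g | g⁻¹ * δ * τ g = δ}
  mul_mem' := by
    intro a b ha hb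
    simp only [Set.mem_ofPred_eq] at ha hb ⊢
    calc (a * b)⁻¹ * δ * τ (a * b) = b⁻¹ * (a⁻¹ * δ * τ a) * τ b := by
          rw [map_mul]; group
      _ = δ := by rw [ha, hb]
  one_mem' := by simp
  inv_mem' := by
    intro a ha
    simp only [Set.mem_ofPred_eq, inv_inv, map_inv] at ha ⊢
    rw [mul_inv_eq_iff_eq_mul]
    nth_rewrite 1 [← ha]
    group

/-- The function `g ↦ f (g⁻¹ δ τ(g))` on the space of right cosets `G_{δ ⋊ τ} \ G`. -/
def orbitFunction (τ : G →* G) (δ : G) (f : G → ℝ) :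
    Quotient (QuotientGroup.rightRel (twistedCentralizer τ δ)) → ℝ :=
  Quotient.lift (fun g => f (g⁻¹ * δ * τ g)) (by
    intro a b hab
    have h : b * a⁻¹ ∈ twistedCentralizer τ δ := QuotientGroup.rightRel_apply.mp hab
    have h' : (b * a⁻¹)⁻¹ * δ * τ (b * a⁻¹) = δ := h
    have key : a⁻¹ * δ * τ a = b⁻¹ * δ * τ b := by
      nth_rewrite 1 [← h']
      rw [map_mul, map_inv]
      group
    exact congrArg f key)

/-- `ν` is the quotient measure `dg/ds` on `S \ G`, for a (unimodular) subgroup `S` with Haar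
measure `ds`: it satisfies Weil's formula `∫_G f(g) dg = ∫_{S\G} (∫_S f(sg) ds) dν` for all
measurable `f ≥ 0`.  The inner integral only depends on the coset `Sg`; `φ` is the function
on `S \ G` which it defines. -/
def IsQuotientMeasure [MeasurableSpace G] (S : Subgroup G) (dg : Measure G) (ds : Measure S)
    (ν : Measure (Quotient (QuotientGroup.rightRel S))) : Prop :=
  ∀ (f : G → ℝ≥0∞) (φ : Quotient (QuotientGroup.rightRel S) → ℝ≥0∞), Measurable f →
    (∀ g : G, φ (Quotient.mk _ g) = ∫⁻ s : S, f (s * g) ∂ds) →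
      ∫⁻ g, f g ∂dg = ∫⁻ q, φ q ∂ν

/-- `vol(K)⁻¹ 1_K`. -/
noncomputable def normalizedIndicator [MeasurableSpace G] (μ : Measure G) (K : Set G) : G → ℝ :=
  K.indicator (fun _ => (μ.real K)⁻¹)

end General

section Matrices

variable {n : ℕ} {F L : Type*} [NormedField F] [NormedField L] [NormedAlgebra F L]

/-- The action of `σ ∈ Gal(L/F)` on `GL_n(L)`, entry by entry. -/
noncomputable def galGL (σ : L ≃ₐ[F] L) : GL (Fin n) L →* GL (Fin n) L :=
  Matrix.GeneralLinearGroup.map (σ : L →+* L)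

/-- `Ad(x ⋊ σ) = Ad(x) ∘ dσ`, that is `X ↦ x σ(X) x⁻¹`, as an `F`-linear endomorphism of the
Lie algebra `M_n(L)` of `Res_{L/F} GL_n`. -/
noncomputable def twistedAd (σ : L ≃ₐ[F] L) (x : GL (Fin n) L) :
    Matrix (Fin n) (Fin n) L →ₗ[F] Matrix (Fin n) (Fin n) L :=
  LinearMap.mulLeft F (x : Matrix (Fin n) (Fin n) L) ∘ₗ
    LinearMap.mulRight F ((x⁻¹ : GL (Fin n) L) : Matrix (Fin n) (Fin n) L) ∘ₗ
      (σ.mapMatrix : Matrix (Fin n) (Fin n) L ≃ₐ[F] Matrix (Fin n) (Fin n) L).toLinearMap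

/-- The Lie algebra of the twisted centralizer of `x`: the fixed space of `Ad(x ⋊ σ)`
in `M_n(L)`.  It is an `F`-algebra and the twisted centralizer is its group of units. -/
noncomputable def lieCentralizer (σ : L ≃ₐ[F] L) (x : GL (Fin n) L) :
    Submodule F (Matrix (Fin n) (Fin n) L) :=
  LinearMap.ker (twistedAd σ x - 1)

/-- The normalizing factor `D(x ⋊ σ) = |det_F (Ad(x ⋊ σ) - 1 | 𝔤 / 𝔤_{x ⋊ σ})|_F`. -/
noncomputable def normalizingFactor (σ : L ≃ₐ[F] L) (x : GL (Fin n) L) : ℝ :=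
  ‖LinearMap.det ((lieCentralizer σ x).mapQ (lieCentralizer σ x) (twistedAd σ x - 1)
    (fun X hX => by
      have h : (twistedAd σ x - 1) X = 0 := hX
      rw [Submodule.mem_comap, h]
      exact Submodule.zero_mem _))‖

/-- The normalized `σ`-twisted orbital integral
`I_{x ⋊ σ}(f) = D(x ⋊ σ)^{1/2} ∫_{G_{x ⋊ σ} \ G} f(g⁻¹ x σ(g)) dν(g)`, `G = GL_n(L)`, with respect
to a measure `ν` on `G_{x ⋊ σ} \ G`.  For `L = F` and `σ = id` it is the ordinary normalized
orbital integral of `f` on `GL_n(F)` at `x`. -/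
noncomputable def normalizedOrbitalIntegral [MeasurableSpace (GL (Fin n) L)]
    (σ : L ≃ₐ[F] L) (x : GL (Fin n) L) (f : GL (Fin n) L → ℝ)
    (ν : Measure (Quotient (QuotientGroup.rightRel (twistedCentralizer (galGL σ) x)))) : ℝ :=
  Real.sqrt (normalizingFactor σ x) * ∫ q, orbitFunction (galGL σ) x f q ∂ν

/-- For linearly independent `b_1, …, b_r` in `M_n(L)`: the elements of the group `S` of the
form `1 + ∑ u_i b_i` with `u_i ∈ F`, `|u_i| ≤ ε`. -/
def unitBox (F : Type*) [NormedField F] [NormedAlgebra F L] (S : Subgroup (GL (Fin n) L)) {r : ℕ}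
    (b : Fin r → Matrix (Fin n) (Fin n) L) (ε : ℝ) : Set S :=
  {s | ∃ u : Fin r → F, (∀ i, ‖u i‖ ≤ ε) ∧
    ((s : GL (Fin n) L) : Matrix (Fin n) (Fin n) L) = 1 + ∑ i, u i • b i}

/-- `ϖ` generates the maximal ideal `{|x| < 1}` of the ring of integers `{|x| ≤ 1}`. -/
def IsUniformizer (ϖ : L) : Prop :=
  ϖ ≠ 0 ∧ ‖ϖ‖ < 1 ∧ ∀ x : L, ‖x‖ < 1 → ‖x‖ ≤ ‖ϖ‖

/-- `K_L(m) = 1 + ϖ^m M_n(O_L)`, a subset of `GL_n(L)`. -/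
def principalCongruence (n : ℕ) (ϖ : L) (m : ℕ) : Set (GL (Fin n) L) :=
  {g | ∃ A : Matrix (Fin n) (Fin n) L, (∀ i j, ‖A i j‖ ≤ 1) ∧
    (g : Matrix (Fin n) (Fin n) L) = 1 + ϖ ^ m • A}

end Matrices

section Norm

variable {n : ℕ} {F E : Type*} [NormedField F] [NormedField E] [NormedAlgebra F E]

/-- The inclusion `GL_n(F) ⊆ GL_n(E)`. -/
noncomputable def inclGL (F E : Type*) [NormedField F] [NormedField E] [NormedAlgebra F E]
    {n : ℕ} : GL (Fin n) F →* GL (Fin n) E :=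
  Matrix.GeneralLinearGroup.map (algebraMap F E)

/-- `K_E(m)_θ`, the `θ`-fixed part `K_E(m) ∩ GL_n(F)` of `K_E(m)`, as a subset of `GL_n(F)`. -/
def principalCongruenceFixed (n : ℕ) (F : Type*) {E : Type*} [NormedField F] [NormedField E]
    [NormedAlgebra F E] (ϖ : E) (m : ℕ) : Set (GL (Fin n) F) :=
  inclGL F E ⁻¹' principalCongruence n ϖ m

/-- The action of `θ` on the points `GL_n(F̄ ⊗_F E)` of `Res_{E/F} GL_n` over the algebraic
closure `F̄`, through the second factor. -/
noncomputable def galGLBar (θ : E ≃ₐ[F] E) :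
    GL (Fin n) (AlgebraicClosure F ⊗[F] E) →* GL (Fin n) (AlgebraicClosure F ⊗[F] E) :=
  Matrix.GeneralLinearGroup.map
    (Algebra.TensorProduct.map (AlgHom.id (AlgebraicClosure F) (AlgebraicClosure F))
      (θ : E →ₐ[F] E) : AlgebraicClosure F ⊗[F] E →+* AlgebraicClosure F ⊗[F] E)

/-- `γ` is a norm of `δ`: over the algebraic closure `F̄`, `δ` is `θ`-conjugate in
`GL_n(E ⊗_F F̄)` to a diagonal `t = diag(t_1, …, t_n)` (so that `δ` is `θ`-semisimple), and `γ` is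
conjugate in `GL_n(F̄)` to the image of `t` under the norm `T(F̄) → T_H(F̄)` of diagonal tori.
(Under `E ⊗_F F̄ ≅ F̄^d` the norm to `F̄` is the product of the `d` components.) -/
def IsNormOf (θ : E ≃ₐ[F] E) (γ : GL (Fin n) F) (δ : GL (Fin n) E) : Prop :=
  ∃ t : Fin n → AlgebraicClosure F ⊗[F] E,
    (∃ g : GL (Fin n) (AlgebraicClosure F ⊗[F] E),
      ((g⁻¹ * Matrix.GeneralLinearGroup.map
          ((Algebra.TensorProduct.includeRight : E →ₐ[F] AlgebraicClosure F ⊗[F] E) :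
            E →+* AlgebraicClosure F ⊗[F] E) δ * galGLBar θ g :
          GL (Fin n) (AlgebraicClosure F ⊗[F] E)) : Matrix (Fin n) (Fin n) _) =
        Matrix.diagonal t) ∧
    ∃ h : GL (Fin n) (AlgebraicClosure F),
      ((h⁻¹ * Matrix.GeneralLinearGroup.map (algebraMap F (AlgebraicClosure F)) γ * h :
          GL (Fin n) (AlgebraicClosure F)) : Matrix (Fin n) (Fin n) _) =
        Matrix.diagonal (fun i => Algebra.norm (AlgebraicClosure F) (t i))

/-- `N(δ) = δ θ(δ) ⋯ θ^{d-1}(δ)`, `d = [E : F]`. -/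
noncomputable def normElement (θ : E ≃ₐ[F] E) (δ : GL (Fin n) E) : GL (Fin n) E :=
  ((List.range (Module.finrank F E)).map (fun i => galGL (θ ^ i) δ)).prod

/-- Compatibility of Haar measures on `H_γ(F)` and `G_{δ ⋊ θ}(F)`, when `γ` is a norm of `δ`.
The group `G_{δ ⋊ θ}` is an inner form of `H_γ`: if `x ∈ GL_n(E)` satisfies `x⁻¹ N(δ) x = γ`,
then `ψ : X ↦ x⁻¹ X x` extends `E`-linearly to an isomorphism of `𝔤_{δ ⋊ θ} ⊗_F E` onto
`𝔥_γ ⊗_F E`, and it induces an inner twist of the unit groups of these algebras.  The measures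
are compatible if they are given by invariant volume forms (up to one common constant) that
correspond to each other under `ψ`.

Concretely: `F`-bases `a` of `𝔤_{δ ⋊ θ}` and `c` of `𝔥_γ` define volume forms which correspond
under `ψ` if and only if `ψ` has determinant `1` in these bases, and then the neighbourhoods of
`1` which are given by the same small box of coordinates must have the same volume.  This does
not depend on the choice of `x`, `a`, `c` and `ε`. -/
def CompatibleMeasures (θ : E ≃ₐ[F] E) (γ : GL (Fin n) F) (δ : GL (Fin n) E)
    [MeasurableSpace (GL (Fin n) F)] [MeasurableSpace (GL (Fin n) E)]
    (dhγ : Measure (twistedCentralizer (galGL (AlgEquiv.refl : F ≃ₐ[F] F)) γ))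
    (dgδ : Measure (twistedCentralizer (galGL θ) δ)) : Prop :=
  ∀ x : GL (Fin n) E, x⁻¹ * normElement θ δ * x = inclGL F E γ →
    ∀ (r : ℕ) (c : Module.Basis (Fin r) F (lieCentralizer (AlgEquiv.refl : F ≃ₐ[F] F) γ))
      (a : Module.Basis (Fin r) F (lieCentralizer θ δ)) (P : Matrix (Fin r) (Fin r) E),
      (∀ j, ((x⁻¹ : GL (Fin n) E) : Matrix (Fin n) (Fin n) E) *
          (a j : Matrix (Fin n) (Fin n) E) * (x : Matrix (Fin n) (Fin n) E) =
        ∑ i, P i j • (c i : Matrix (Fin n) (Fin n) F).map (algebraMap F E)) →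
      P.det = 1 →
      ∀ᶠ ε in 𝓝[>] (0 : ℝ),
        dhγ (unitBox F _ (fun i => (c i : Matrix (Fin n) (Fin n) F)) ε) =
          dgδ (unitBox F _ (fun i => (a i : Matrix (Fin n) (Fin n) E)) ε)

end Norm

end TwistedOrbital

open TwistedOrbital

/-!
The proof compares both orbital integrals with finite sums of volumes, without using the fundamental
lemma or the theory of transfer.  Write `d = [E : F]`, `K_E = K_E(m)`, `K_F = K_E(m)_θ`, and let
`X_γ` be the set of `h` in `GL_n(F)` with `h⁻¹ γ h ∈ K_F`, `X_δ` the set of `g` in `GL_n(E)` with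
`g⁻¹ δ θ(g) ∈ K_E`.  Both integrals are integrals over `S_γ \ X_γ` and `S_δ \ X_δ`, where `S_γ` and
`S_δ` are the (twisted) centralizers.

*Descent of the elements.*  The elements of `K_E` are topologically unipotent: `k ^ p ^ i → 1`.
Since `p ∤ d`, such elements have `d`-th roots in `K_E` and commute with the same matrices as their
`d`-th powers.  If `z` is the `d`-th root of the norm of `k`, then `z⁻¹ k ⋊ θ` has order `d`, and
averaging over its powers shows that every `k ∈ K_E` is `θ`-conjugate under `K_E` to an element
of `K_F` (`exists_conj_fixed`).  Moreover a matrix `Y` over `E` with `a θ(Y) = Y b` for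
topologically unipotent `a`, `b` over `F` has entries in `F` (`map_eq_of_intertwines`).

If `X_γ` is not empty, then `γ = c ^ d` with `c` topologically unipotent.  When `γ` is a norm of `δ`,
an argument as in Hilbert's Theorem 90 (`exists_twisted_conj`) gives an `x` in `GL_n(E)` that
conjugates `δ ⋊ θ` to `c ⋊ θ`, and it follows that `S_δ = x S_γ x⁻¹` and `X_δ = x X_γ K_E`
(`IsTwistedRoot`).  If `X_γ` is empty and `γ` is a norm of `δ`, then `X_δ` is empty too, and both
integrals vanish.  Since `γ = c ^ d` is in particular a norm of `c`, the set `X_γ` is empty if `γ`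
is not a norm at all.

*The integrals.*  For semisimple `γ`, nearby elements similar to `γ` are conjugate under elements
near `1`, so that `X_γ` is a finite union of double cosets `S_γ h K_F` (`finite_doubleCosets`), and
`S_γ` is unimodular, because it preserves the trace form on its Lie algebra
(`measure_preimage_mul_right`).  Weil's formula then makes the integral the sum of the numbers
`vol(S_γ ∩ h K_F h⁻¹)⁻¹`.  The double cosets of `X_γ` and `X_δ` correspond to each other, and the
volumes agree because compatible measures correspond under conjugation by `x`
(`IsTwistedRoot.measure_eq_of_compatible`).

*The normalizing factors.*  After conjugation, `γ = u ^ d` and `δ = u` with `u ∈ K_F`.  On the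
complement of `M_n(F)` in `M_n(E)` of the matrices with entries of trace zero, `Ad(u ⋊ θ) - 1` is an
isometry, and so is `1 + Ad(u) + ⋯ + Ad(u) ^ (d - 1)` on `M_n(F)`.  Isometries have determinants of
absolute value one, so that the factors of `γ` and `δ` both equal that of `u`
(`normalizingFactor_inclGL`, `normalizingFactor_pow`).
-/

namespace TwistedOrbital

/-! ### Congruence subgroups -/

section Ultrametric

open scoped Matrix.Norms.Elementwise

variable {n : ℕ} {L : Type*} [NormedField L]

theorem norm_entry_le (A : Matrix (Fin n) (Fin n) L) (i j : Fin n) : ‖A i j‖ ≤ ‖A‖ :=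
  Matrix.norm_entry_le_entrywise_sup_norm A

theorem matrix_norm_one_le : ‖(1 : Matrix (Fin n) (Fin n) L)‖ ≤ 1 := by
  refine (Matrix.norm_le_iff zero_le_one).2 fun i j => ?_
  rw [Matrix.one_apply]
  split_ifs <;> simp

variable [IsUltrametricDist L]

theorem matrix_norm_add_le_max (A B : Matrix (Fin n) (Fin n) L) : ‖A + B‖ ≤ max ‖A‖ ‖B‖ := by
  refine (Matrix.norm_le_iff (le_max_of_le_left (norm_nonneg _))).2 fun i j => ?_
  refine (IsUltrametricDist.norm_add_le_max (A i j) (B i j)).trans ?_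
  exact max_le_max (norm_entry_le A i j) (norm_entry_le B i j)

theorem matrix_norm_sub_le_max (A B : Matrix (Fin n) (Fin n) L) : ‖A - B‖ ≤ max ‖A‖ ‖B‖ := by
  simpa [sub_eq_add_neg] using matrix_norm_add_le_max A (-B)

theorem matrix_norm_mul_le (A B : Matrix (Fin n) (Fin n) L) : ‖A * B‖ ≤ ‖A‖ * ‖B‖ := by
  have h0 : 0 ≤ ‖A‖ * ‖B‖ := by positivity
  refine (Matrix.norm_le_iff h0).2 fun i j => ?_
  rw [Matrix.mul_apply]
  refine IsUltrametricDist.norm_sum_le_of_forall_le_of_nonneg h0 fun k _ => ?_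
  rw [norm_mul]
  exact mul_le_mul (norm_entry_le A i k) (norm_entry_le B k j) (norm_nonneg _) (norm_nonneg _)

theorem matrix_norm_sum_le {ι : Type*} (s : Finset ι) (f : ι → Matrix (Fin n) (Fin n) L) {C : ℝ}
    (hC : 0 ≤ C) (h : ∀ i ∈ s, ‖f i‖ ≤ C) : ‖∑ i ∈ s, f i‖ ≤ C := by
  classical
  induction s using Finset.induction_on with
  | empty => simpa using hC
  | insert a s ha ih =>
    rw [Finset.sum_insert ha]
    exact (matrix_norm_add_le_max _ _).trans
      (max_le (h a (by simp)) (ih fun i hi => h i (by simp [hi])))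

/-- A matrix at distance less than `1` from the identity is invertible. -/
theorem isUnit_of_norm_sub_one_lt {A : Matrix (Fin n) (Fin n) L} (h : ‖A - 1‖ < 1) : IsUnit A := by
  rw [← Matrix.mulVec_injective_iff_isUnit]
  refine (injective_iff_map_eq_zero (Matrix.mulVecLin A)).2 fun v hv => ?_
  have hv' : A.mulVec v = 0 := hv
  have h1 : (A - 1).mulVec v = -v := by rw [Matrix.sub_mulVec, hv', Matrix.one_mulVec, zero_sub]
  have h2 : ‖v‖ ≤ ‖A - 1‖ * ‖v‖ := by
    have h0 : 0 ≤ ‖A - 1‖ * ‖v‖ := by positivity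
    have h3 : ‖(A - 1).mulVec v‖ ≤ ‖A - 1‖ * ‖v‖ := by
      refine (pi_norm_le_iff_of_nonneg h0).2 fun i => ?_
      change ‖∑ k, (A - 1) i k * v k‖ ≤ _
      refine IsUltrametricDist.norm_sum_le_of_forall_le_of_nonneg h0 fun k _ => ?_
      rw [norm_mul]
      exact mul_le_mul (norm_entry_le _ i k) (norm_le_pi_norm v k) (norm_nonneg _) (norm_nonneg _)
    rwa [h1, norm_neg] at h3
  by_contra hne
  have : 0 < ‖v‖ := norm_pos_iff.2 hne
  nlinarith

theorem norm_le_one_of_norm_sub_one_le {A : Matrix (Fin n) (Fin n) L} {r : ℝ} (hr : r ≤ 1)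
    (h : ‖A - 1‖ ≤ r) : ‖A‖ ≤ 1 := by
  have := matrix_norm_add_le_max (A - 1) 1
  rw [sub_add_cancel] at this
  exact this.trans (max_le (h.trans hr) matrix_norm_one_le)

theorem norm_mul_sub_one_le {A B : Matrix (Fin n) (Fin n) L} {r : ℝ} (hr : r ≤ 1)
    (hA : ‖A - 1‖ ≤ r) (hB : ‖B - 1‖ ≤ r) : ‖A * B - 1‖ ≤ r := by
  have e : A * B - 1 = (A - 1) * B + (B - 1) := by noncomm_ring
  rw [e]
  refine (matrix_norm_add_le_max _ _).trans (max_le ?_ hB)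
  refine (matrix_norm_mul_le _ _).trans ?_
  have := norm_le_one_of_norm_sub_one_le hr hB
  nlinarith [norm_nonneg (A - 1), norm_nonneg B]

theorem norm_inv_sub_one_le {g : GL (Fin n) L} {r : ℝ} (hr : r < 1)
    (h : ‖(g : Matrix (Fin n) (Fin n) L) - 1‖ ≤ r) :
    ‖((g⁻¹ : GL (Fin n) L) : Matrix (Fin n) (Fin n) L) - 1‖ ≤ r := by
  set A : Matrix (Fin n) (Fin n) L := (g : Matrix (Fin n) (Fin n) L)
  set B : Matrix (Fin n) (Fin n) L := ((g⁻¹ : GL (Fin n) L) : Matrix (Fin n) (Fin n) L)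
  have hBA : B * A = 1 := Units.inv_mul g
  have e : B - 1 = -(B * (A - 1)) := by rw [mul_sub, hBA, mul_one]; abel
  have h1 : ‖B - 1‖ ≤ ‖B‖ * r := by
    rw [e, norm_neg]
    exact (matrix_norm_mul_le _ _).trans (by gcongr)
  have h2 : ‖B‖ ≤ 1 := by
    have h3 := matrix_norm_add_le_max (B - 1) 1
    rw [sub_add_cancel] at h3
    rcases le_max_iff.1 h3 with h3 | h3
    · nlinarith [norm_nonneg B]
    · exact h3.trans matrix_norm_one_le
  have hr0 : 0 ≤ r := (norm_nonneg _).trans h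
  nlinarith

/-- The open compact subgroup of all `g` in `GL_n(L)` with `|g - 1| ≤ r` for the maximum norm,
for a radius `0 < r < 1`. -/
def congruenceSubgroup (n : ℕ) (L : Type*) [NormedField L] [IsUltrametricDist L] {r : ℝ}
    (hr : r ∈ Set.Ioo (0 : ℝ) 1) : Subgroup (GL (Fin n) L) where
  carrier := {g | ‖(g : Matrix (Fin n) (Fin n) L) - 1‖ ≤ r}
  mul_mem' := fun {a b} ha hb => norm_mul_sub_one_le hr.2.le ha hb
  one_mem' := by simpa using hr.1.le
  inv_mem' := fun {a} ha => norm_inv_sub_one_le hr.2 ha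

variable {r : ℝ} (hr : r ∈ Set.Ioo (0 : ℝ) 1)

theorem mem_congruenceSubgroup {g : GL (Fin n) L} :
    g ∈ congruenceSubgroup n L hr ↔ ‖(g : Matrix (Fin n) (Fin n) L) - 1‖ ≤ r := Iff.rfl

theorem isOpen_congruenceSubgroup : IsOpen (congruenceSubgroup n L hr : Set (GL (Fin n) L)) := by
  refine Subgroup.isOpen_of_mem_nhds _ (g := 1) ?_
  have hc : Continuous fun g : GL (Fin n) L => ‖(g : Matrix (Fin n) (Fin n) L) - 1‖ :=
    (Units.continuous_val.sub continuous_const).norm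
  have : {g : GL (Fin n) L | ‖(g : Matrix (Fin n) (Fin n) L) - 1‖ < r} ∈ 𝓝 (1 : GL (Fin n) L) :=
    (isOpen_lt hc continuous_const).mem_nhds (by simpa using hr.1)
  exact Filter.mem_of_superset this fun g (hg : _ < r) => (mem_congruenceSubgroup hr).2 hg.le

theorem isCompact_congruenceSubgroup [ProperSpace L] :
    IsCompact (congruenceSubgroup n L hr : Set (GL (Fin n) L)) := by
  have : ProperSpace (Matrix (Fin n) (Fin n) L) :=
    inferInstanceAs (ProperSpace (Fin n → Fin n → L))
  have hK : IsCompact (Metric.closedBall (1 : Matrix (Fin n) (Fin n) L) r) :=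
    isCompact_closedBall _ _
  have hKop := hK.image (MulOpposite.continuous_op (M := Matrix (Fin n) (Fin n) L))
  have := (Units.isClosedEmbedding_embedProduct
    (α := Matrix (Fin n) (Fin n) L)).isCompact_preimage (hK.prod hKop)
  refine this.of_isClosed_subset (Subgroup.isClosed_of_isOpen _ (isOpen_congruenceSubgroup hr)) ?_
  intro g hg
  refine ⟨?_, ?_⟩
  · simpa [dist_eq_norm] using (mem_congruenceSubgroup hr).1 hg
  · refine ⟨((g⁻¹ : GL (Fin n) L) : Matrix (Fin n) (Fin n) L), ?_, rfl⟩
    simpa [dist_eq_norm] using norm_inv_sub_one_le hr.2 hg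

/-- Raising to the `p`-th power contracts the distance to `1` by a fixed factor. -/
theorem norm_pow_prime_sub_one_le {g : GL (Fin n) L} (hg : g ∈ congruenceSubgroup n L hr) (p : ℕ) :
    ‖((g ^ p : GL (Fin n) L) : Matrix (Fin n) (Fin n) L) - 1‖ ≤
      max ‖(p : L)‖ r * ‖(g : Matrix (Fin n) (Fin n) L) - 1‖ := by
  rw [Units.val_pow_eq_pow_val, ← mul_geom_sum, mul_comm (max _ _)]
  refine (matrix_norm_mul_le _ _).trans (mul_le_mul_of_nonneg_left ?_ (norm_nonneg _))
  have e : ∑ i ∈ Finset.range p, (g : Matrix (Fin n) (Fin n) L) ^ i =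
      ∑ i ∈ Finset.range p, ((g : Matrix (Fin n) (Fin n) L) ^ i - 1) +
        (p : L) • (1 : Matrix (Fin n) (Fin n) L) := by
    rw [Finset.sum_sub_distrib]
    simp [Nat.cast_smul_eq_nsmul]
  rw [e]
  refine (matrix_norm_add_le_max _ _).trans (max_le ?_ ?_)
  · refine le_max_of_le_right (matrix_norm_sum_le _ _ hr.1.le fun i _ => ?_)
    rw [← Units.val_pow_eq_pow_val]
    exact Subgroup.pow_mem _ hg i
  · refine le_max_of_le_left ?_
    rw [norm_smul]
    exact mul_le_of_le_one_right (norm_nonneg _) matrix_norm_one_le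

/-- Matrices congruent to `1` are topologically `p`-unipotent. -/
theorem tendsto_pow_prime_pow {p : ℕ} (hp : ‖(p : L)‖ < 1) {g : GL (Fin n) L}
    (hg : g ∈ congruenceSubgroup n L hr) :
    Tendsto (fun k : ℕ => g ^ p ^ k) atTop (𝓝 1) := by
  set ρ := max ‖(p : L)‖ r
  have hρ0 : 0 ≤ ρ := le_max_of_le_left (norm_nonneg _)
  have hρ1 : ρ < 1 := max_lt hp hr.2
  have key : ∀ k : ℕ, ‖((g ^ p ^ k : GL (Fin n) L) : Matrix (Fin n) (Fin n) L) - 1‖ ≤ ρ ^ k := by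
    intro k
    induction k with
    | zero => simpa using (show _ ≤ r from hg).trans hr.2.le
    | succ k ih =>
      rw [pow_succ, pow_mul, pow_succ, mul_comm]
      exact (norm_pow_prime_sub_one_le hr (Subgroup.pow_mem _ hg _) p).trans (by gcongr)
  have hlim := tendsto_pow_atTop_nhds_zero_of_lt_one hρ0 hρ1
  have key2 : ∀ k : ℕ,
      ‖(((g ^ p ^ k)⁻¹ : GL (Fin n) L) : Matrix (Fin n) (Fin n) L) - 1‖ ≤ ρ ^ k := by
    intro k
    have h1 : ((g ^ p ^ k)⁻¹ : GL (Fin n) L) = g⁻¹ ^ p ^ k := by rw [inv_pow]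
    have e : (((g ^ p ^ k)⁻¹ : GL (Fin n) L) : Matrix (Fin n) (Fin n) L) - 1 =
        -((((g ^ p ^ k)⁻¹ : GL (Fin n) L) : Matrix (Fin n) (Fin n) L) *
          (((g ^ p ^ k : GL (Fin n) L) : Matrix (Fin n) (Fin n) L) - 1)) := by
      rw [mul_sub, Units.inv_mul, mul_one]; abel
    rw [e, norm_neg]
    refine (matrix_norm_mul_le _ _).trans ?_
    have h2 : ‖(((g ^ p ^ k)⁻¹ : GL (Fin n) L) : Matrix (Fin n) (Fin n) L)‖ ≤ 1 :=
      norm_le_one_of_norm_sub_one_le hr.2.le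
        (Subgroup.inv_mem _ (Subgroup.pow_mem (congruenceSubgroup n L hr) hg (p ^ k)))
    calc _ ≤ 1 * ρ ^ k := mul_le_mul h2 (key k) (norm_nonneg _) zero_le_one
      _ = _ := one_mul _
  rw [Units.isEmbedding_embedProduct.tendsto_nhds_iff]
  refine Tendsto.prodMk_nhds ?_ ((MulOpposite.continuous_op.tendsto _).comp ?_)
  · refine tendsto_iff_norm_sub_tendsto_zero.2
      (squeeze_zero (fun _ => norm_nonneg _) (fun k => ?_) hlim)
    simpa using key k
  · refine tendsto_iff_norm_sub_tendsto_zero.2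
      (squeeze_zero (fun _ => norm_nonneg _) (fun k => ?_) hlim)
    simpa using key2 k

end Ultrametric

/-! ### Topologically unipotent elements and semilinear maps -/

section TopologicallyUnipotent

variable {G : Type*} [Group G] [TopologicalSpace G]

/-- `g` is topologically `p`-unipotent if `g ^ p ^ k` tends to `1`. -/
def IsTopologicallyUnipotent (p : ℕ) (g : G) : Prop :=
  Tendsto (fun k : ℕ => g ^ p ^ k) atTop (𝓝 1)

variable {p d : ℕ}

theorem IsTopologicallyUnipotent.conj [IsTopologicalGroup G] {g : G}
    (hg : IsTopologicallyUnipotent p g) (h : G) : IsTopologicallyUnipotent p (h * g * h⁻¹) := by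
  have h1 : Tendsto (fun k : ℕ => h * g ^ p ^ k * h⁻¹) atTop (𝓝 (h * 1 * h⁻¹)) :=
    (hg.const_mul h).mul_const h⁻¹
  simpa [IsTopologicallyUnipotent, conj_pow] using h1

/-- Some powers of `p`, with exponents going to infinity, are congruent to `1` modulo `d`. -/
theorem exists_prime_pow_eq_mul_add_one (hp0 : 0 < p) (hpd : p.Coprime d) (hd : 0 < d) :
    ∃ q a : ℕ → ℕ, Tendsto q atTop atTop ∧ ∀ k, p ^ q k = d * a k + 1 := by
  refine ⟨fun k => d.totient * k, fun k => (p ^ (d.totient * k) - 1) / d, ?_, fun k => ?_⟩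
  · exact tendsto_id.const_mul_atTop' (Nat.totient_pos.2 hd)
  · have hp : 0 < p ^ (d.totient * k) := by positivity
    have h1 : p ^ (d.totient * k) ≡ 1 [MOD d] := by
      rw [pow_mul]
      simpa using (Nat.ModEq.pow_totient hpd).pow k
    have h2 : d ∣ p ^ (d.totient * k) - 1 := (Nat.modEq_iff_dvd' hp).1 h1.symm
    simp only
    rw [Nat.mul_div_cancel' h2]
    omega

/-- If `g` is topologically `p`-unipotent and `p ∤ d`, then `g⁻¹` is a limit of powers
of `g ^ d`. -/
theorem IsTopologicallyUnipotent.inv_mem_of_isClosed [IsTopologicalGroup G] {g : G}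
    (hg : IsTopologicallyUnipotent p g) (hp0 : 0 < p) (hpd : p.Coprime d) (hd : 0 < d) {C : Set G}
    (hC : IsClosed C) (h : ∀ a : ℕ, (g ^ d) ^ a ∈ C) : g⁻¹ ∈ C := by
  obtain ⟨q, a, hq, ha⟩ := exists_prime_pow_eq_mul_add_one hp0 hpd hd
  have h1 : Tendsto (fun k => g ^ p ^ q k * g⁻¹) atTop (𝓝 (1 * g⁻¹)) :=
    (hg.comp hq).mul_const g⁻¹
  rw [one_mul] at h1
  refine hC.mem_of_tendsto h1 (Eventually.of_forall fun k => ?_)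
  rw [ha, pow_succ, mul_inv_cancel_right, pow_mul]
  exact h _

/-- In a compact subgroup, topologically `p`-unipotent elements have `d`-th roots if `p ∤ d`. -/
theorem IsTopologicallyUnipotent.exists_pow_eq [IsTopologicalGroup G] [T2Space G] {g : G}
    (hg : IsTopologicallyUnipotent p g) (hp0 : 0 < p) (hpd : p.Coprime d) (hd : 0 < d)
    {K : Subgroup G}
    (hK : IsCompact (K : Set G)) (hgK : g ∈ K) : ∃ u ∈ K, u ^ d = g := by
  obtain ⟨q, a, hq, ha⟩ := exists_prime_pow_eq_mul_add_one hp0 hpd hd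
  -- a limit `w` of the powers `g ^ a k` satisfies `w ^ d * g = 1`
  let U : Ultrafilter ℕ := Ultrafilter.of atTop
  obtain ⟨w, hwK, hw⟩ := hK.ultrafilter_le_nhds (U.map fun k => g ^ a k)
    (le_principal_iff.2 (Eventually.of_forall (f := (U : Filter ℕ))
      fun k => Subgroup.pow_mem K hgK (a k)))
  have hw' : Tendsto (fun k => g ^ a k) U (𝓝 w) := hw
  have h1 : Tendsto (fun k => (g ^ a k) ^ d * g) U (𝓝 (w ^ d * g)) := (hw'.pow d).mul_const g
  have h2 : Tendsto (fun k => g ^ p ^ q k) U (𝓝 1) :=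
    (hg.comp hq).mono_left (Ultrafilter.of_le atTop)
  have h3 : (fun k => (g ^ a k) ^ d * g) = fun k => g ^ p ^ q k := by
    funext k
    rw [ha, pow_succ, ← pow_mul, mul_comm (a k)]
  rw [h3] at h1
  have h4 : w ^ d * g = 1 := tendsto_nhds_unique h1 h2
  exact ⟨w⁻¹, K.inv_mem hwK, by rw [inv_pow]; exact inv_eq_of_mul_eq_one_right h4⟩

end TopologicallyUnipotent

section Semilinear

open scoped Matrix.Norms.Elementwise

variable {n : ℕ} {F E : Type*} [NormedField F] [NormedField E] [NormedAlgebra F E]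

theorem coe_galGL (θ : E ≃ₐ[F] E) (g : GL (Fin n) E) :
    ((galGL θ g : GL (Fin n) E) : Matrix (Fin n) (Fin n) E) =
      (g : Matrix (Fin n) (Fin n) E).map θ := rfl

theorem map_mul_aut (θ : E ≃ₐ[F] E) (A B : Matrix (Fin n) (Fin n) E) :
    (A * B).map θ = A.map θ * B.map θ := map_mul (θ.mapMatrix (m := Fin n)) A B

theorem galGL_inclGL (θ : E ≃ₐ[F] E) (g : GL (Fin n) F) :
    galGL θ (inclGL F E g) = inclGL F E g := by
  ext i j
  exact θ.commutes _

theorem galGL_pow_succ_apply (θ : E ≃ₐ[F] E) (i : ℕ) (g : GL (Fin n) E) :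
    galGL (θ ^ (i + 1)) g = galGL θ (galGL (θ ^ i) g) := by
  ext a b
  simp only [pow_succ']
  rfl

/-- `g θ(g) ⋯ θ^{i-1}(g)`. -/
noncomputable def partialNorm (θ : E ≃ₐ[F] E) (g : GL (Fin n) E) (i : ℕ) : GL (Fin n) E :=
  ((List.range i).map (fun j => galGL (θ ^ j) g)).prod

theorem partialNorm_succ' (θ : E ≃ₐ[F] E) (g : GL (Fin n) E) (i : ℕ) :
    partialNorm θ g (i + 1) = g * galGL θ (partialNorm θ g i) := by
  have h0 : galGL (θ ^ 0) g = g := by ext a b; rfl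
  simp only [partialNorm, List.range_succ_eq_map, List.map_cons, List.prod_cons, List.map_map,
    map_list_prod, h0]
  congr 3
  funext j
  exact galGL_pow_succ_apply θ j g

theorem partialNorm_succ (θ : E ≃ₐ[F] E) (g : GL (Fin n) E) (i : ℕ) :
    partialNorm θ g (i + 1) = partialNorm θ g i * galGL (θ ^ i) g := by
  simp [partialNorm, List.range_succ]

theorem partialNorm_inclGL (θ : E ≃ₐ[F] E) (g : GL (Fin n) F) (i : ℕ) :
    partialNorm θ (inclGL F E g) i = inclGL F E g ^ i := by
  induction i with
  | zero => simp [partialNorm]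
  | succ i ih => rw [partialNorm_succ, ih, galGL_inclGL, pow_succ]

theorem partialNorm_conj (θ : E ≃ₐ[F] E) (g x : GL (Fin n) E) (i : ℕ) :
    partialNorm θ (x⁻¹ * g * galGL θ x) i = x⁻¹ * partialNorm θ g i * galGL (θ ^ i) x := by
  induction i with
  | zero => simp [partialNorm, show galGL (1 : E ≃ₐ[F] E) x = x from by ext a b; rfl]
  | succ i ih =>
    rw [partialNorm_succ', ih, partialNorm_succ', galGL_pow_succ_apply]
    simp only [map_mul, map_inv]
    group

theorem normElement_eq (θ : E ≃ₐ[F] E) (g : GL (Fin n) E) :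
    normElement θ g = partialNorm θ g (Module.finrank F E) := rfl

theorem normElement_inclGL (θ : E ≃ₐ[F] E) (g : GL (Fin n) F) :
    normElement θ (inclGL F E g) = inclGL F E (g ^ Module.finrank F E) := by
  rw [normElement_eq, partialNorm_inclGL, map_pow]

theorem normElement_conj {θ : E ≃ₐ[F] E} (hθ : θ ^ Module.finrank F E = 1) (g x : GL (Fin n) E) :
    normElement θ (x⁻¹ * g * galGL θ x) = x⁻¹ * normElement θ g * x := by
  rw [normElement_eq, partialNorm_conj, hθ]
  rfl

theorem isometry_map {θ : E ≃ₐ[F] E} (hiso : ∀ x, ‖θ x‖ = ‖x‖) (A : Matrix (Fin n) (Fin n) E) :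
    ‖A.map θ‖ = ‖A‖ := Matrix.norm_map_eq A θ hiso

theorem continuous_galGL {θ : E ≃ₐ[F] E} (hc : Continuous θ) :
    Continuous (galGL θ : GL (Fin n) E →* GL (Fin n) E) := by
  refine Continuous.units_map (M := Matrix (Fin n) (Fin n) E) (N := Matrix (Fin n) (Fin n) E)
    ((θ : E →+* E).mapMatrix : Matrix (Fin n) (Fin n) E →+* Matrix (Fin n) (Fin n) E).toMonoidHom ?_
  exact continuous_id.matrix_map hc

theorem continuous_inclGL : Continuous (inclGL F E : GL (Fin n) F →* GL (Fin n) E) := by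
  refine Continuous.units_map (M := Matrix (Fin n) (Fin n) F) (N := Matrix (Fin n) (Fin n) E)
    ((algebraMap F E).mapMatrix :
      Matrix (Fin n) (Fin n) F →+* Matrix (Fin n) (Fin n) E).toMonoidHom ?_
  exact continuous_id.matrix_map (continuous_algebraMap F E)

theorem inclGL_injective : Function.Injective (inclGL F E : GL (Fin n) F →* GL (Fin n) E) := by
  intro a b hab
  ext i j
  have h : (inclGL F E a : Matrix (Fin n) (Fin n) E) i j = (inclGL F E b) i j := by rw [hab]
  exact (algebraMap F E).injective h

/-- A matrix that intertwines two topologically unipotent elements `a ⋊ θ`, `b ⋊ θ` with `a`, `b`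
fixed by `θ`, is itself fixed by `θ`: the powers `(a ⋊ θ) ^ i` with `i ≡ 1 mod d` accumulate
at `1 ⋊ θ`. -/
theorem map_eq_of_intertwines [IsUltrametricDist E] {p : ℕ} {θ : E ≃ₐ[F] E} {d : ℕ}
    (hθ : θ ^ d = 1)
    (hp0 : 0 < p) (hpd : p.Coprime d) (hd : 0 < d) {a b : GL (Fin n) E}
    (ha : IsTopologicallyUnipotent p a)
    (hb : IsTopologicallyUnipotent p b) (hfa : galGL θ a = a) (hfb : galGL θ b = b)
    {Y : Matrix (Fin n) (Fin n) E}
    (h : (a : Matrix (Fin n) (Fin n) E) * Y.map θ = Y * (b : Matrix (Fin n) (Fin n) E)) :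
    Y.map θ = Y := by
  have key : ∀ i : ℕ, (a : Matrix (Fin n) (Fin n) E) ^ i * Y.map (θ ^ i : E ≃ₐ[F] E) =
      Y * (b : Matrix (Fin n) (Fin n) E) ^ i := by
    intro i
    induction i with
    | zero =>
      simp only [pow_zero, one_mul, mul_one]
      rfl
    | succ i ih =>
      have h1 := congrArg (fun Z : Matrix (Fin n) (Fin n) E => Z.map θ) ih
      simp only [map_mul_aut] at h1
      have h2 : ((a : Matrix (Fin n) (Fin n) E) ^ i).map θ =
          (a : Matrix (Fin n) (Fin n) E) ^ i := by
        rw [← Units.val_pow_eq_pow_val, ← coe_galGL, map_pow, hfa]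
      have h3 : ((b : Matrix (Fin n) (Fin n) E) ^ i).map θ =
          (b : Matrix (Fin n) (Fin n) E) ^ i := by
        rw [← Units.val_pow_eq_pow_val, ← coe_galGL, map_pow, hfb]
      rw [h2, h3] at h1
      have h4 : (Y.map (θ ^ i : E ≃ₐ[F] E)).map θ = Y.map (θ ^ (i + 1) : E ≃ₐ[F] E) := by
        ext s t
        simp only [Matrix.map_apply, pow_succ']
        rfl
      rw [h4] at h1
      rw [pow_succ', mul_assoc, h1, ← mul_assoc, h, mul_assoc, ← pow_succ']
  obtain ⟨q, c, hq, hc⟩ := exists_prime_pow_eq_mul_add_one hp0 hpd hd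
  have e : ∀ k, θ ^ p ^ q k = θ := fun k => by rw [hc, pow_succ, pow_mul, hθ, one_pow, one_mul]
  have lim : ∀ {g : GL (Fin n) E}, IsTopologicallyUnipotent p g →
      Tendsto (fun k => (g : Matrix (Fin n) (Fin n) E) ^ p ^ q k) atTop (𝓝 1) := by
    intro g hg
    have := (Units.continuous_val.tendsto _).comp (hg.comp hq)
    simpa [Function.comp_def] using this
  have l1 := (lim ha).mul_const (Y.map θ)
  have l2 := (lim hb).const_mul Y
  rw [one_mul] at l1
  rw [mul_one] at l2
  refine tendsto_nhds_unique l1 (l2.congr fun k => ?_)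
  rw [← key, e]

theorem exists_map_algebraMap_eq {θ : E ≃ₐ[F] E}
    (hfix : ∀ x : E, θ x = x → x ∈ Set.range (algebraMap F E)) {Y : Matrix (Fin n) (Fin n) E}
    (hY : Y.map θ = Y) : ∃ Y0 : Matrix (Fin n) (Fin n) F, Y0.map (algebraMap F E) = Y := by
  choose f hf using fun i j => hfix (Y i j) (congrFun (congrFun hY i) j)
  exact ⟨Matrix.of f, by ext i j; exact hf i j⟩

theorem exists_inclGL_eq {θ : E ≃ₐ[F] E}
    (hfix : ∀ x : E, θ x = x → x ∈ Set.range (algebraMap F E)) {g : GL (Fin n) E}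
    (hg : galGL θ g = g) : ∃ g0 : GL (Fin n) F, inclGL F E g0 = g := by
  obtain ⟨A, hA⟩ := exists_map_algebraMap_eq hfix (Y := (g : Matrix (Fin n) (Fin n) E))
    (congrArg Units.val hg)
  obtain ⟨B, hB⟩ := exists_map_algebraMap_eq hfix
    (Y := ((g⁻¹ : GL (Fin n) E) : Matrix (Fin n) (Fin n) E))
    (congrArg Units.val (show galGL θ g⁻¹ = g⁻¹ by rw [map_inv, hg]))
  have inj : Function.Injective fun M : Matrix (Fin n) (Fin n) F => M.map (algebraMap F E) :=
    Matrix.map_injective (algebraMap F E).injective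
  refine ⟨⟨A, B, inj ?_, inj ?_⟩, Units.ext hA⟩
  · simp only [Matrix.map_mul, hA, hB]
    simp
  · simp only [Matrix.map_mul, hA, hB]
    simp

/-- Every element of the coset `K ⋊ θ` of a principal congruence subgroup `K` of `GL_n(E)` is
`K`-conjugate to an element `u ⋊ θ` with `u` fixed by `θ`.  With `z` the `d`-th root of `N(g)` in
`K`, the element `z⁻¹ g ⋊ θ` has order `d`, and averaging its powers gives the conjugating
element. -/
theorem exists_conj_fixed [IsUltrametricDist E] [ProperSpace E] {p : ℕ} (hp : ‖(p : E)‖ < 1)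
    {θ : E ≃ₐ[F] E} (hiso : ∀ x, ‖θ x‖ = ‖x‖) {d : ℕ} (hθ : θ ^ d = 1)
    (hp0 : 0 < p) (hpd : p.Coprime d)
    (hd : 0 < d) (hdE : ‖(d : E)‖ = 1) {r : ℝ} (hr : r ∈ Set.Ioo (0 : ℝ) 1) {g : GL (Fin n) E}
    (hg : g ∈ congruenceSubgroup n E hr) :
    ∃ k ∈ congruenceSubgroup n E hr, k⁻¹ * g * galGL θ k ∈ congruenceSubgroup n E hr ∧
      galGL θ (k⁻¹ * g * galGL θ k) = k⁻¹ * g * galGL θ k := by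
  have hcont : Continuous θ := (AddMonoidHomClass.isometry_of_norm θ hiso).continuous
  have stab : ∀ x ∈ congruenceSubgroup n E hr, ∀ τ : E ≃ₐ[F] E, (∀ y, ‖τ y‖ = ‖y‖) →
      galGL τ x ∈ congruenceSubgroup n E hr := by
    intro x hx τ hτ
    rw [mem_congruenceSubgroup] at hx ⊢
    rw [← isometry_map hτ] at hx
    convert hx using 2
    ext i j
    by_cases hij : i = j <;> simp [coe_galGL, hij]
  have hpow : ∀ i : ℕ, ∀ y, ‖(θ ^ i) y‖ = ‖y‖ := by
    intro i
    induction i with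
    | zero => intro y; rfl
    | succ i ih => intro y; rw [pow_succ]; exact (ih _).trans (hiso y)
  have hN : ∀ i, partialNorm θ g i ∈ congruenceSubgroup n E hr := by
    intro i
    induction i with
    | zero => exact Subgroup.one_mem _
    | succ i ih =>
      rw [partialNorm_succ]
      exact Subgroup.mul_mem _ ih (stab _ hg _ (hpow i))
  obtain ⟨z, hz, hzd⟩ := IsTopologicallyUnipotent.exists_pow_eq
    (tendsto_pow_prime_pow hr hp (hN d)) hp0 hpd hd (isCompact_congruenceSubgroup hr) (hN d)
  -- `z` commutes with `g ⋊ θ`, since `N(g)` does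
  have hzc : g * galGL θ z * g⁻¹ = z := by
    have hC : IsClosed {y : GL (Fin n) E | g * galGL θ y * g⁻¹ = y} :=
      isClosed_eq ((continuous_const.mul (continuous_galGL hcont)).mul continuous_const)
        continuous_id
    have hzu : IsTopologicallyUnipotent p z := tendsto_pow_prime_pow hr hp hz
    have := hzu.inv_mem_of_isClosed hp0 hpd hd hC ?_
    · have h1 := congrArg (·⁻¹) (show g * galGL θ z⁻¹ * g⁻¹ = z⁻¹ from this)
      simpa [mul_assoc] using h1
    · intro a
      have h1 : g * galGL θ (partialNorm θ g d) * g⁻¹ = partialNorm θ g d := by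
        rw [← partialNorm_succ', partialNorm_succ, hθ]
        exact mul_inv_cancel_right _ _
      rw [hzd]
      change g * galGL θ (partialNorm θ g d ^ a) * g⁻¹ = _
      rw [map_pow, ← conj_pow, h1]
  -- the powers of `z⁻¹ g ⋊ θ` applied to the identity matrix
  let B : ℕ → GL (Fin n) E := fun i => z⁻¹ ^ i * partialNorm θ g i
  have hB : ∀ i, z⁻¹ * g * galGL θ (B i) = B (i + 1) := by
    intro i
    have h1 : g * galGL θ (z⁻¹ ^ i) = z⁻¹ ^ i * g := by
      rw [← mul_inv_eq_iff_eq_mul, map_pow, ← conj_pow, map_inv,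
        show g * (galGL θ z)⁻¹ * g⁻¹ = (g * galGL θ z * g⁻¹)⁻¹ by group, hzc]
    simp only [B]
    rw [map_mul, partialNorm_succ', mul_assoc, ← mul_assoc g, h1, pow_succ']
    group
  have hBd : B d = B 0 := by
    simp only [B, inv_pow, hzd]
    simp [partialNorm]
  have hBK : ∀ i, B i ∈ congruenceSubgroup n E hr := fun i =>
    Subgroup.mul_mem _ (Subgroup.pow_mem _ (Subgroup.inv_mem _ hz) i) (hN i)
  have hd0 : (d : E) ≠ 0 := norm_ne_zero_iff.1 (by rw [hdE]; exact one_ne_zero)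
  let k0 : Matrix (Fin n) (Fin n) E :=
    (d : E)⁻¹ • ∑ i ∈ Finset.range d, (B i : Matrix (Fin n) (Fin n) E)
  have hk0 : ‖k0 - 1‖ ≤ r := by
    have e : k0 - 1 =
        (d : E)⁻¹ • ∑ i ∈ Finset.range d, ((B i : Matrix (Fin n) (Fin n) E) - 1) := by
      rw [Finset.sum_sub_distrib, smul_sub]
      congr 1
      simp only [Finset.sum_const, Finset.card_range]
      rw [← Nat.cast_smul_eq_nsmul E, inv_smul_smul₀ hd0]
    rw [e, norm_smul, norm_inv, hdE, inv_one, one_mul]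
    exact matrix_norm_sum_le _ _ hr.1.le fun i _ => hBK i
  obtain ⟨k, hk⟩ := isUnit_of_norm_sub_one_lt (hk0.trans_lt hr.2)
  have hkK : k ∈ congruenceSubgroup n E hr := by
    rw [mem_congruenceSubgroup, hk]; exact hk0
  have hfixk : z⁻¹ * g * galGL θ k = k := by
    apply Units.ext
    rw [Units.val_mul, coe_galGL, hk]
    have e1 : k0.map θ = (d : E)⁻¹ •
        ∑ i ∈ Finset.range d, ((galGL θ (B i) : GL (Fin n) E) : Matrix (Fin n) (Fin n) E) := by
      ext s t
      simp [k0, Matrix.sum_apply, coe_galGL]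
    rw [e1, Matrix.mul_smul, Finset.mul_sum]
    have e2 : ∀ i ∈ Finset.range d, ((z⁻¹ * g : GL (Fin n) E) : Matrix (Fin n) (Fin n) E) *
        ((galGL θ (B i) : GL (Fin n) E) : Matrix (Fin n) (Fin n) E) =
        (B (i + 1) : Matrix (Fin n) (Fin n) E) := fun i _ => by
      rw [← Units.val_mul, hB]
    rw [Finset.sum_congr rfl e2]
    have e3 := Finset.sum_range_succ (fun i => (B i : Matrix (Fin n) (Fin n) E)) d
    rw [Finset.sum_range_succ'] at e3
    rw [hBd] at e3
    rw [add_right_cancel e3]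
  have h1 : g * galGL θ k = z * k := by
    rw [mul_assoc] at hfixk
    exact inv_mul_eq_iff_eq_mul.1 hfixk
  have h2 : k⁻¹ * g * galGL θ k = k⁻¹ * z * k := by rw [mul_assoc, h1, mul_assoc]
  refine ⟨k, hkK, ?_, ?_⟩
  · rw [h2]
    exact Subgroup.mul_mem _ (Subgroup.mul_mem _ (Subgroup.inv_mem _ hkK) hz) hkK
  · have h3 : galGL θ k = g⁻¹ * z * k := by rw [mul_assoc, ← h1]; group
    have h4 : galGL θ z = g⁻¹ * z * g := by
      rw [eq_comm, mul_assoc, inv_mul_eq_iff_eq_mul, ← mul_inv_eq_iff_eq_mul.1 hzc]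
    rw [h2, map_mul, map_mul, map_inv, h3, h4]
    group

end Semilinear

/-! ### Similarity and twisted conjugacy over an extension -/

section Descent

open Matrix

/-- If some linear combination of the matrices `B i` with coefficients in an extension field is
invertible, then so is one with coefficients in a given infinite subfield: the determinant of the
generic linear combination is a nonzero polynomial. -/
theorem exists_det_sum_smul_ne_zero {K L Ω ι : Type*} [Field K] [Infinite K] [Field L] [Field Ω]
    [Algebra K L] [Algebra L Ω] [Fintype ι] {n : ℕ} (B : ι → Matrix (Fin n) (Fin n) L)
    (y : ι → Ω) (hy : (∑ i, y i • (B i).map (algebraMap L Ω)).det ≠ 0) :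
    ∃ c : ι → K, (∑ i, algebraMap K L (c i) • B i).det ≠ 0 := by
  classical
  let M : Matrix (Fin n) (Fin n) (MvPolynomial ι L) :=
    ∑ i, (MvPolynomial.X i : MvPolynomial ι L) • (B i).map MvPolynomial.C
  have h1 : MvPolynomial.aeval y M.det = (∑ i, y i • (B i).map (algebraMap L Ω)).det := by
    rw [AlgHom.map_det]
    congr 1
    ext s t
    simp [M, Matrix.sum_apply]
  have h2 : ∀ c : ι → L, MvPolynomial.eval c M.det = (∑ i, c i • B i).det := by
    intro c
    rw [RingHom.map_det]
    congr 1
    ext s t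
    simp [M, Matrix.sum_apply, mul_comm]
  by_contra! hcon
  have h3 : M.det = 0 := by
    refine MvPolynomial.funext_set (fun _ : ι => Set.range (algebraMap K L))
      (fun _ => Set.infinite_range_of_injective (algebraMap K L).injective) fun x hx => ?_
    choose c hc using fun i => hx i (Set.mem_univ i)
    rw [h2, map_zero, ← hcon c]
    simp only [hc]
  rw [← h1, h3, map_zero] at hy
  exact hy rfl

/-- Matrices over an infinite field that become similar over an extension are similar. -/
theorem exists_similar_of_similar_extension {K Ω : Type*} [Field K] [Infinite K] [Field Ω]
    [Algebra K Ω] {n : ℕ} {A B : Matrix (Fin n) (Fin n) K} (X : GL (Fin n) Ω)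
    (hX : A.map (algebraMap K Ω) * (X : Matrix (Fin n) (Fin n) Ω) =
      (X : Matrix (Fin n) (Fin n) Ω) * B.map (algebraMap K Ω)) :
    ∃ Y : GL (Fin n) K,
      A * (Y : Matrix (Fin n) (Fin n) K) = (Y : Matrix (Fin n) (Fin n) K) * B := by
  classical
  -- expand the entries of `X` in a basis of `Ω` over `K`
  let b := Module.Basis.ofVectorSpace K Ω
  let S : Finset (Module.Basis.ofVectorSpaceIndex K Ω) :=
    Finset.univ.biUnion fun st : Fin n × Fin n => (b.repr (X.val st.1 st.2)).support
  let C : Module.Basis.ofVectorSpaceIndex K Ω → Matrix (Fin n) (Fin n) K :=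
    fun k => Matrix.of fun s t => b.repr (X.val s t) k
  have hXC : (X : Matrix (Fin n) (Fin n) Ω) = ∑ k : S, b k • (C k).map (algebraMap K Ω) := by
    ext s t
    conv_lhs => rw [← b.linearCombination_repr (X.val s t)]
    rw [Finsupp.linearCombination_apply, Finsupp.sum_of_support_subset _ (s := S) _ _ (by simp),
      Matrix.sum_apply, ← Finset.sum_coe_sort S]
    · refine Finset.sum_congr rfl fun k _ => ?_
      simp [C, Algebra.smul_def, mul_comm]
    · intro k hk
      exact Finset.mem_biUnion.2 ⟨(s, t), Finset.mem_univ _, hk⟩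
  have hC : ∀ k, A * C k = C k * B := by
    intro k
    ext s t
    have h1 := congrFun (congrFun hX s) t
    simp only [Matrix.mul_apply, Matrix.map_apply] at h1
    have h2 := congrArg (fun z => b.repr z k) h1
    simp only [map_sum, Finsupp.coe_finsetSum, Finset.sum_apply] at h2
    have h3 : ∀ (a : K) (z : Ω), b.repr (algebraMap K Ω a * z) k = a * b.repr z k := by
      intro a z
      rw [← Algebra.smul_def, map_smul, Finsupp.smul_apply, smul_eq_mul]
    have h4 : ∀ (a : K) (z : Ω), b.repr (z * algebraMap K Ω a) k = b.repr z k * a := by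
      intro a z
      rw [mul_comm, h3, mul_comm]
    simp only [h3, h4] at h2
    simpa [Matrix.mul_apply, C] using h2
  have hdet : (∑ k : S, b k • (C k).map (algebraMap K Ω)).det ≠ 0 := by
    rw [← hXC]
    exact ((Matrix.isUnit_iff_isUnit_det _).1 X.isUnit).ne_zero
  obtain ⟨c, hc⟩ := exists_det_sum_smul_ne_zero (K := K) (fun k : S => C k) (fun k : S => b k) hdet
  obtain ⟨Y, hY⟩ := (Matrix.isUnit_iff_isUnit_det _).2 (isUnit_iff_ne_zero.2 hc)
  refine ⟨Y, ?_⟩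
  rw [hY, Finset.mul_sum, Finset.sum_mul]
  exact Finset.sum_congr rfl fun k _ => by rw [Matrix.mul_smul, Matrix.smul_mul, hC]

/-- The powers `θ ^ i`, `i < d`, of an automorphism of order `d = [E : F]`, evaluated at an
`F`-basis of `E`, form an invertible matrix (Dedekind). -/
theorem isUnit_matrix_pow_apply_basis {F E : Type*} [Field F] [Field E] [Algebra F E]
    (θ : E ≃ₐ[F] E) {d : ℕ} (hord : orderOf θ = d) (b : Module.Basis (Fin d) F E) :
    IsUnit (Matrix.of fun i j : Fin d => (θ ^ (i : ℕ)) (b j)) := by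
  rw [← Matrix.vecMul_injective_iff_isUnit]
  refine (injective_iff_map_eq_zero (Matrix.vecMulLinear _)).2 fun v hv => ?_
  have hinj : Function.Injective fun i : Fin d => (((θ ^ (i : ℕ) : E ≃ₐ[F] E) : E →* E)) := by
    intro i j hij
    have h1 : θ ^ (i : ℕ) = θ ^ (j : ℕ) := by
      ext x
      exact DFunLike.congr_fun hij x
    exact Fin.ext (pow_injOn_Iio_orderOf (by simp [hord]) (by simp [hord]) h1)
  have hli := (linearIndependent_monoidHom E E).comp _ hinj
  rw [Fintype.linearIndependent_iff] at hli
  funext i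
  refine hli v ?_ i
  have hlin : ∑ i, v i • ((θ ^ (i : ℕ) : E ≃ₐ[F] E) : E →ₗ[F] E) = 0 := by
    refine b.ext fun j => ?_
    have := congrFun hv j
    simpa [Matrix.vecMul, dotProduct] using this
  funext x
  have := LinearMap.congr_fun hlin x
  simpa using this

end Descent

section TwistedConjugacy

variable {n : ℕ} {F E : Type*} [NormedField F] [NormedField E] [NormedAlgebra F E]

/-- An element `g` of `GL_n(E)` whose norm `g θ(g) ⋯ θ^{d-1}(g)` is conjugate to `c ^ d` with `c`
in `GL_n(F)` is `θ`-conjugate to `c`.  If `x₀` conjugates the norms, then the elements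
`∑ i < d, (g ⋊ θ)^i (t x₀) c⁻ⁱ`, for `t` in `E`, intertwine `g ⋊ θ` and `c ⋊ θ`, and one of them is
invertible. -/
theorem exists_twisted_conj [FiniteDimensional F E] [Infinite F] {θ : E ≃ₐ[F] E}
    (hord : orderOf θ = Module.finrank F E) {g x₀ : GL (Fin n) E} {c : GL (Fin n) F}
    (h : x₀⁻¹ * normElement θ g * x₀ = inclGL F E (c ^ Module.finrank F E)) :
    ∃ x : GL (Fin n) E, x⁻¹ * g * galGL θ x = inclGL F E c := by
  classical
  set d := Module.finrank F E with hd
  have hd0 : 0 < d := Module.finrank_pos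
  let b : Module.Basis (Fin d) F E := Module.finBasis F E
  let B : ℕ → GL (Fin n) E := fun i =>
    partialNorm θ g i * galGL (θ ^ i) x₀ * (inclGL F E c)⁻¹ ^ i
  have hBsucc : ∀ i, g * galGL θ (B i) * (inclGL F E c)⁻¹ = B (i + 1) := by
    intro i
    simp only [B]
    rw [map_mul, map_mul, ← galGL_pow_succ_apply, partialNorm_succ', map_pow, map_inv,
      galGL_inclGL, pow_succ]
    group
  have hθd : θ ^ d = 1 := by rw [← hord]; exact pow_orderOf_eq_one θ
  have hg1 : ∀ x : GL (Fin n) E, galGL (1 : E ≃ₐ[F] E) x = x := fun x => by ext a b; rfl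
  have hB0 : B 0 = x₀ := by simp [B, partialNorm, hg1]
  have hBd : B d = B 0 := by
    rw [hB0]
    simp only [B, hθd, hg1]
    rw [← normElement_eq, inv_pow, ← map_pow, ← h]
    group
  let D : Fin d → Matrix (Fin n) (Fin n) E := fun j =>
    ∑ i : Fin d, (θ ^ (i : ℕ)) (b j) • (B i : Matrix (Fin n) (Fin n) E)
  obtain ⟨W, hW⟩ := isUnit_matrix_pow_apply_basis θ hord b
  let y : Fin d → E := (((W⁻¹ : (Matrix (Fin d) (Fin d) E)ˣ) : Matrix (Fin d) (Fin d) E)).mulVec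
    (Pi.single ⟨0, hd0⟩ 1)
  have hy : ∀ i : Fin d, ∑ j, y j * (θ ^ (i : ℕ)) (b j) = if i = ⟨0, hd0⟩ then 1 else 0 := by
    intro i
    have h1 : (W : Matrix (Fin d) (Fin d) E).mulVec y = Pi.single ⟨0, hd0⟩ 1 := by
      simp only [y, Matrix.mulVec_mulVec, Units.mul_inv, Matrix.one_mulVec]
    have h2 := congrFun h1 i
    rw [hW] at h2
    simpa [Matrix.mulVec, dotProduct, mul_comm, Pi.single_apply] using h2
  have hyD : ∑ j, y j • (D j).map (algebraMap E E) = (x₀ : Matrix (Fin n) (Fin n) E) := by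
    have h1 : ∑ j, y j • (D j).map (algebraMap E E) =
        ∑ i : Fin d, (∑ j, y j * (θ ^ (i : ℕ)) (b j)) • (B i : Matrix (Fin n) (Fin n) E) := by
      have h2 : ∀ j, (D j).map (algebraMap E E) = D j := fun j => by ext s t; rfl
      simp only [h2, D, Finset.smul_sum, Finset.sum_smul, smul_smul]
      exact Finset.sum_comm
    rw [h1]
    simp only [hy]
    simp [hB0]
  obtain ⟨a, ha⟩ := exists_det_sum_smul_ne_zero (K := F) (Ω := E) D y
    (by rw [hyD]; exact ((Matrix.isUnit_iff_isUnit_det _).1 x₀.isUnit).ne_zero)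
  obtain ⟨x, hx⟩ := (Matrix.isUnit_iff_isUnit_det _).2 (isUnit_iff_ne_zero.2 ha)
  let t : E := ∑ j, algebraMap F E (a j) * b j
  have hxt : (x : Matrix (Fin n) (Fin n) E) =
      ∑ i ∈ Finset.range d, (θ ^ i) t • (B i : Matrix (Fin n) (Fin n) E) := by
    rw [hx, ← Fin.sum_univ_eq_sum_range
      (fun i => (θ ^ i) t • (B i : Matrix (Fin n) (Fin n) E)) d]
    simp only [D, Finset.smul_sum]
    rw [Finset.sum_comm]
    refine Finset.sum_congr rfl fun i _ => ?_
    simp only [t, map_sum, map_mul, AlgEquiv.commutes, Finset.sum_smul, smul_smul]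
  refine ⟨x, ?_⟩
  have key : g * galGL θ x * (inclGL F E c)⁻¹ = x := by
    apply Units.ext
    rw [Units.val_mul, Units.val_mul, coe_galGL, hxt]
    have e1 : (∑ i ∈ Finset.range d, (θ ^ i) t • (B i : Matrix (Fin n) (Fin n) E)).map θ =
        ∑ i ∈ Finset.range d, (θ ^ (i + 1)) t •
          ((galGL θ (B i) : GL (Fin n) E) : Matrix (Fin n) (Fin n) E) := by
      ext s u
      simp [Matrix.sum_apply, coe_galGL, pow_succ']
    rw [e1, Finset.mul_sum, Finset.sum_mul]
    have e2 : ∀ i ∈ Finset.range d, (g : Matrix (Fin n) (Fin n) E) * ((θ ^ (i + 1)) t •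
          ((galGL θ (B i) : GL (Fin n) E) : Matrix (Fin n) (Fin n) E)) *
          (((inclGL F E c)⁻¹ : GL (Fin n) E) : Matrix (Fin n) (Fin n) E) =
        (θ ^ (i + 1)) t • (B (i + 1) : Matrix (Fin n) (Fin n) E) := fun i _ => by
      rw [Matrix.mul_smul, Matrix.smul_mul, ← Units.val_mul, ← Units.val_mul, hBsucc]
    rw [Finset.sum_congr rfl e2]
    have e3 := Finset.sum_range_succ (fun i => (θ ^ i) t • (B i : Matrix (Fin n) (Fin n) E)) d
    rw [Finset.sum_range_succ', hBd, hθd, pow_zero] at e3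
    exact add_right_cancel e3
  rw [mul_inv_eq_iff_eq_mul] at key
  rw [mul_assoc, key, inv_mul_cancel_left]

end TwistedConjugacy

/-! ### Norms of twisted conjugacy classes -/

section Diagonalization

/-- A matrix over a perfect field which is semisimple as an endomorphism is diagonalizable over
the algebraic closure. -/
theorem exists_diagonalization {K : Type*} [Field K] [PerfectField K] {n : ℕ}
    {A : Matrix (Fin n) (Fin n) K} (hA : Module.End.IsSemisimple (Matrix.toLin' A)) :
    ∃ (h : GL (Fin n) (AlgebraicClosure K)) (s : Fin n → AlgebraicClosure K),
      A.map (algebraMap K (AlgebraicClosure K)) *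
        (h : Matrix (Fin n) (Fin n) (AlgebraicClosure K)) =
      (h : Matrix (Fin n) (Fin n) (AlgebraicClosure K)) * Matrix.diagonal s := by
  classical
  set Ω := AlgebraicClosure K
  set A' : Matrix (Fin n) (Fin n) Ω := A.map (algebraMap K Ω)
  set B : Module.End Ω (Fin n → Ω) := Matrix.toLin' A'
  set P := minpoly K (Matrix.toLin' A)
  have hP : (P.map (algebraMap K Ω)).Separable :=
    (PerfectField.separable_iff_squarefree.2 hA.minpoly_squarefree).map
  have h0 : Polynomial.aeval A P = 0 := by
    have h1 : Polynomial.aeval (Matrix.toLin' A) P = 0 := minpoly.aeval _ _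
    have h2 : Polynomial.aeval (Matrix.toLinAlgEquiv' A) P =
        Matrix.toLinAlgEquiv' (Polynomial.aeval A P) :=
      Polynomial.aeval_algHom_apply (Matrix.toLinAlgEquiv' : Matrix (Fin n) (Fin n) K ≃ₐ[K] _) A P
    have h3 : Matrix.toLinAlgEquiv' (Polynomial.aeval A P) = 0 := by rw [← h2]; exact h1
    simpa using h3
  have hB0 : Polynomial.aeval B (P.map (algebraMap K Ω)) = 0 := by
    have h1 : Polynomial.aeval A' (P.map (algebraMap K Ω)) = 0 := by
      rw [Polynomial.aeval_map_algebraMap]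
      have h2 := Polynomial.aeval_algHom_apply
        ((Algebra.ofId K Ω).mapMatrix : Matrix (Fin n) (Fin n) K →ₐ[K] _) A P
      rw [h0, map_zero] at h2
      exact h2
    have h2 := Polynomial.aeval_algHom_apply
      (Matrix.toLinAlgEquiv' : Matrix (Fin n) (Fin n) Ω ≃ₐ[Ω] _) A' (P.map (algebraMap K Ω))
    rw [h1, map_zero] at h2
    exact h2
  have hBs : B.IsSemisimple := Module.End.isSemisimple_of_squarefree_aeval_eq_zero hP.squarefree hB0
  have htop : ⨆ μ : Ω, B.eigenspace μ = ⊤ := by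
    rw [← Module.End.iSup_maxGenEigenspace_eq_top B]
    exact iSup_congr fun μ =>
      (hBs.isFinitelySemisimple.maxGenEigenspace_eq_eigenspace μ).symm
  have hspan : Submodule.span Ω {v | ∃ μ : Ω, B v = μ • v} = ⊤ := by
    rw [eq_top_iff, ← htop]
    refine iSup_le fun μ v hv => Submodule.subset_span ⟨μ, ?_⟩
    exact Module.End.mem_eigenspace_iff.1 hv
  obtain ⟨b, hbs, hbspan, hbli⟩ := exists_linearIndependent Ω {v | ∃ μ : Ω, B v = μ • v}
  let bas : Module.Basis b Ω (Fin n → Ω) := Module.Basis.mk hbli (by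
    rw [Subtype.range_coe_subtype]
    exact (hbspan.trans hspan).ge)
  have e : b ≃ Fin n := bas.indexEquiv (Pi.basisFun Ω (Fin n))
  let v : Fin n → Fin n → Ω := fun j => (e.symm j : Fin n → Ω)
  have hv : LinearIndependent Ω v := hbli.comp _ e.symm.injective
  choose s hs using fun j => hbs (e.symm j).2
  have hunit : IsUnit (Matrix.of v).transpose :=
    Matrix.linearIndependent_cols_iff_isUnit.1 hv
  obtain ⟨h, hh⟩ := hunit
  refine ⟨h, s, ?_⟩
  rw [hh]
  ext i j
  rw [Matrix.mul_diagonal]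
  have := congrFun (hs j) i
  simpa [B, A', v, Matrix.mulVec, dotProduct, Matrix.mul_apply, mul_comm] using this

end Diagonalization

section NormTensor

variable {F E : Type*} [NormedField F] [NormedField E] [NormedAlgebra F E]

/-- The automorphism `id ⊗ τ` of `F̄ ⊗ E`. -/
noncomputable def barAut (τ : E ≃ₐ[F] E) :
    AlgebraicClosure F ⊗[F] E →ₐ[AlgebraicClosure F] AlgebraicClosure F ⊗[F] E :=
  Algebra.TensorProduct.map (AlgHom.id (AlgebraicClosure F) (AlgebraicClosure F)) (τ : E →ₐ[F] E)

/-- The `F̄`-algebra homomorphism `F̄ ⊗ E → F̄` that extends an embedding of `E`. -/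
noncomputable def barEval (e : E →ₐ[F] AlgebraicClosure F) :
    AlgebraicClosure F ⊗[F] E →ₐ[AlgebraicClosure F] AlgebraicClosure F :=
  Algebra.TensorProduct.lift (AlgHom.id (AlgebraicClosure F) (AlgebraicClosure F)) e
    fun _ _ => Commute.all _ _

theorem barEval_includeRight (e : E →ₐ[F] AlgebraicClosure F) (x : E) :
    barEval e (Algebra.TensorProduct.includeRight x) = e x := by
  simp [barEval]

/-- The norm of `F̄ ⊗ E ≅ F̄ ^ d` is the product of the `d` components.  The matrices of the
multiplication by elements of `F̄ ⊗ E` are simultaneously diagonalized by the matrix of the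
conjugates of a basis. -/
theorem norm_eq_prod_barEval [FiniteDimensional F E] {θ : E ≃ₐ[F] E} {d : ℕ}
    (hd : d = Module.finrank F E) (hord : orderOf θ = d) (e : E →ₐ[F] AlgebraicClosure F)
    (c : AlgebraicClosure F ⊗[F] E) :
    Algebra.norm (AlgebraicClosure F) c =
      ∏ i ∈ Finset.range d, barEval e (barAut (θ ^ i) c) := by
  subst hd
  set d := Module.finrank F E
  let b : Module.Basis (Fin d) F E := Module.finBasis F E
  let β := Algebra.TensorProduct.basis (AlgebraicClosure F) b
  let W : Matrix (Fin d) (Fin d) (AlgebraicClosure F) :=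
    (Matrix.of fun i j : Fin d => (θ ^ (i : ℕ)) (b j)).map e
  have hW : IsUnit W.det := by
    rw [← Matrix.isUnit_iff_isUnit_det]
    exact (isUnit_matrix_pow_apply_basis θ hord b).map
      ((e : E →+* AlgebraicClosure F).mapMatrix (m := Fin d))
  have hWβ : ∀ i j, W i j = barEval e (barAut (θ ^ (i : ℕ)) (β j)) := by
    intro i j
    simp [W, β, barEval, barAut]
  have key : W * Algebra.leftMulMatrix β c =
      Matrix.diagonal (fun i : Fin d => barEval e (barAut (θ ^ (i : ℕ)) c)) * W := by
    ext i j
    rw [Matrix.mul_apply, Matrix.diagonal_mul]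
    simp only [hWβ]
    rw [← map_mul, ← map_mul]
    conv_rhs => rw [← β.sum_repr (c * β j)]
    simp only [map_sum, map_smul, smul_eq_mul]
    refine Finset.sum_congr rfl fun k _ => ?_
    rw [Algebra.leftMulMatrix_eq_repr_mul, mul_comm]
  have hdet := congrArg Matrix.det key
  rw [Matrix.det_mul, Matrix.det_mul, Matrix.det_diagonal, mul_comm] at hdet
  rw [Algebra.norm_eq_matrix_det β, hW.mul_right_cancel hdet]
  exact Fin.prod_univ_eq_prod_range (fun i => barEval e (barAut (θ ^ i) c)) d

variable {n : ℕ}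

/-- If `γ` is a norm of `δ`, then `γ` is conjugate in `GL_n(E)` to `δ θ(δ) ⋯ θ^{d-1}(δ)`. -/
theorem IsNormOf.exists_conj_normElement [FiniteDimensional F E] [Infinite E] {θ : E ≃ₐ[F] E}
    (hord : orderOf θ = Module.finrank F E) {γ : GL (Fin n) F} {δ : GL (Fin n) E}
    (h : IsNormOf θ γ δ) :
    ∃ x₀ : GL (Fin n) E, x₀⁻¹ * normElement θ δ * x₀ = inclGL F E γ := by
  obtain ⟨t, ⟨g, hg⟩, k, hk⟩ := h
  have hθd : θ ^ Module.finrank F E = 1 := by rw [← hord]; exact pow_orderOf_eq_one θ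
  let e : E →ₐ[F] AlgebraicClosure F := IsAlgClosed.lift
  let R : E →+* AlgebraicClosure F ⊗[F] E :=
    ((Algebra.TensorProduct.includeRight : E →ₐ[F] AlgebraicClosure F ⊗[F] E) :
      E →+* AlgebraicClosure F ⊗[F] E)
  have hg1 : (δ : Matrix (Fin n) (Fin n) E).map R *
      (g : Matrix (Fin n) (Fin n) (AlgebraicClosure F ⊗[F] E)).map (barAut θ) =
      (g : Matrix (Fin n) (Fin n) (AlgebraicClosure F ⊗[F] E)) * Matrix.diagonal t := by
    rw [← hg, ← Units.val_mul, mul_assoc, mul_inv_cancel_left]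
    rfl
  have hmapmul : ∀ (τ : E ≃ₐ[F] E) (A B : Matrix (Fin n) (Fin n) (AlgebraicClosure F ⊗[F] E)),
      (A * B).map (barAut τ) = A.map (barAut τ) * B.map (barAut τ) := fun τ A B => Matrix.map_mul
  have hRθ : ∀ A : Matrix (Fin n) (Fin n) E, (A.map R).map (barAut θ) = (A.map θ).map R := by
    intro A
    ext i j
    simp [R, barAut]
  have hcomp : ∀ (i : ℕ) (c : AlgebraicClosure F ⊗[F] E),
      barAut θ (barAut (θ ^ i) c) = barAut (θ ^ (i + 1)) c := by
    intro i c
    induction c using TensorProduct.induction_on with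
    | zero => simp
    | tmul x y => simp [barAut, pow_succ']
    | add x y hx hy => simp only [map_add, hx, hy]
  have hone : ∀ c : AlgebraicClosure F ⊗[F] E, barAut (1 : E ≃ₐ[F] E) c = c := by
    intro c
    induction c using TensorProduct.induction_on with
    | zero => simp
    | tmul x y => simp [barAut]
    | add x y hx hy => simp only [map_add, hx, hy]
  -- the `i`-th power of the relation `(δ ⋊ θ) g = g (t ⋊ θ)`
  have key : ∀ i : ℕ, ((partialNorm θ δ i : GL (Fin n) E) : Matrix (Fin n) (Fin n) E).map R *
      (g : Matrix (Fin n) (Fin n) (AlgebraicClosure F ⊗[F] E)).map (barAut (θ ^ i)) =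
      (g : Matrix (Fin n) (Fin n) (AlgebraicClosure F ⊗[F] E)) *
        Matrix.diagonal fun a => ∏ j ∈ Finset.range i, barAut (θ ^ j) (t a) := by
    intro i
    induction i with
    | zero =>
      have h1 : (g : Matrix (Fin n) (Fin n) (AlgebraicClosure F ⊗[F] E)).map
          (barAut (1 : E ≃ₐ[F] E)) = g := by
        ext a b
        exact hone _
      simp [partialNorm, h1]
    | succ i ih =>
      have h1 := congrArg (fun Z : Matrix (Fin n) (Fin n) (AlgebraicClosure F ⊗[F] E) =>
        (δ : Matrix (Fin n) (Fin n) E).map R * Z.map (barAut θ)) ih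
      simp only [hmapmul, hRθ] at h1
      rw [← mul_assoc, ← mul_assoc, hg1, ← Matrix.map_mul] at h1
      have h2 : ((g : Matrix (Fin n) (Fin n) (AlgebraicClosure F ⊗[F] E)).map
          (barAut (θ ^ i))).map (barAut θ) =
          (g : Matrix (Fin n) (Fin n) (AlgebraicClosure F ⊗[F] E)).map (barAut (θ ^ (i + 1))) := by
        ext a b
        exact hcomp i _
      rw [h2, mul_assoc (g : Matrix (Fin n) (Fin n) (AlgebraicClosure F ⊗[F] E)),
        Matrix.diagonal_map (map_zero _), Matrix.diagonal_mul_diagonal] at h1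
      rw [partialNorm_succ', Units.val_mul, coe_galGL, h1]
      congr 2
      funext a
      rw [Finset.prod_range_succ']
      simp only [map_prod, hcomp, pow_zero, hone]
      ring
  have hN := key (Module.finrank F E)
  rw [hθd, ← normElement_eq] at hN
  -- specialize along `F̄ ⊗ E → F̄`
  let G : GL (Fin n) (AlgebraicClosure F) :=
    Matrix.GeneralLinearGroup.map (barEval e : AlgebraicClosure F ⊗[F] E →+* AlgebraicClosure F) g
  have hG : (normElement θ δ : Matrix (Fin n) (Fin n) E).map e *
      (G : Matrix (Fin n) (Fin n) (AlgebraicClosure F)) =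
      (G : Matrix (Fin n) (Fin n) (AlgebraicClosure F)) *
        Matrix.diagonal fun i => Algebra.norm (AlgebraicClosure F) (t i) := by
    have h1 := congrArg (fun Z : Matrix (Fin n) (Fin n) (AlgebraicClosure F ⊗[F] E) =>
      Z.map (barEval e)) hN
    simp only [Matrix.map_mul] at h1
    rw [Matrix.diagonal_map (map_zero _)] at h1
    have h2 : ((normElement θ δ : Matrix (Fin n) (Fin n) E).map R).map (barEval e) =
        (normElement θ δ : Matrix (Fin n) (Fin n) E).map e := by
      ext i j
      exact barEval_includeRight e _
    have h3 : ((g : Matrix (Fin n) (Fin n) (AlgebraicClosure F ⊗[F] E)).map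
        (barAut (1 : E ≃ₐ[F] E))).map (barEval e) = G := by
      ext i j
      exact congrArg (barEval e) (hone _)
    have h4 : (g : Matrix (Fin n) (Fin n) (AlgebraicClosure F ⊗[F] E)).map (barEval e) = G := rfl
    rw [h2, h3, h4] at h1
    rw [h1]
    congr 2
    funext i
    simp only [map_prod]
    exact (norm_eq_prod_barEval rfl hord e (t i)).symm
  have hkγ : (γ : Matrix (Fin n) (Fin n) F).map (algebraMap F (AlgebraicClosure F)) *
      (k : Matrix (Fin n) (Fin n) (AlgebraicClosure F)) =
      (k : Matrix (Fin n) (Fin n) (AlgebraicClosure F)) *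
        Matrix.diagonal fun i => Algebra.norm (AlgebraicClosure F) (t i) := by
    rw [← hk, ← Units.val_mul, mul_assoc, mul_inv_cancel_left]
    rfl
  let _ : Algebra E (AlgebraicClosure F) := (e : E →+* AlgebraicClosure F).toAlgebra
  have hfin : (normElement θ δ : Matrix (Fin n) (Fin n) E).map (algebraMap E (AlgebraicClosure F)) *
      ((G * k⁻¹ : GL (Fin n) (AlgebraicClosure F)) : Matrix (Fin n) (Fin n) (AlgebraicClosure F)) =
      ((G * k⁻¹ : GL (Fin n) (AlgebraicClosure F)) : Matrix (Fin n) (Fin n) (AlgebraicClosure F)) *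
      (inclGL F E γ : Matrix (Fin n) (Fin n) E).map (algebraMap E (AlgebraicClosure F)) := by
    have h1 : (inclGL F E γ : Matrix (Fin n) (Fin n) E).map (algebraMap E (AlgebraicClosure F)) =
        (γ : Matrix (Fin n) (Fin n) F).map (algebraMap F (AlgebraicClosure F)) := by
      ext i j
      exact e.commutes _
    have h2 : (γ : Matrix (Fin n) (Fin n) F).map (algebraMap F (AlgebraicClosure F)) =
        (k : Matrix (Fin n) (Fin n) (AlgebraicClosure F)) *
        (Matrix.diagonal fun i => Algebra.norm (AlgebraicClosure F) (t i)) *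
        ((k⁻¹ : GL (Fin n) (AlgebraicClosure F)) :
          Matrix (Fin n) (Fin n) (AlgebraicClosure F)) := by
      rw [← hkγ, mul_assoc, Units.mul_inv, mul_one]
    rw [h1, h2, Units.val_mul, ← mul_assoc]
    change (normElement θ δ : Matrix (Fin n) (Fin n) E).map e * _ * _ = _
    rw [hG]
    simp only [mul_assoc]
    rw [← mul_assoc ((k⁻¹ : GL (Fin n) (AlgebraicClosure F)) :
      Matrix (Fin n) (Fin n) (AlgebraicClosure F)), Units.inv_mul, one_mul]
  obtain ⟨Y, hY⟩ := exists_similar_of_similar_extension _ hfin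
  refine ⟨Y, ?_⟩
  rw [mul_assoc, inv_mul_eq_iff_eq_mul]
  exact Units.ext hY

/-- If `c` is diagonalizable over the algebraic closure, then `c ^ d` is a norm of `c`. -/
theorem isNormOf_inclGL [FiniteDimensional F E] [PerfectField F] (θ : E ≃ₐ[F] E)
    {c : GL (Fin n) F}
    (hc : Module.End.IsSemisimple (Matrix.toLin' (c : Matrix (Fin n) (Fin n) F))) :
    IsNormOf θ (c ^ Module.finrank F E) (inclGL F E c) := by
  obtain ⟨h, s, hs⟩ := exists_diagonalization hc
  let ι : AlgebraicClosure F →+* AlgebraicClosure F ⊗[F] E := algebraMap _ _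
  have h3 : ((h⁻¹ * Matrix.GeneralLinearGroup.map (algebraMap F (AlgebraicClosure F)) c * h :
      GL (Fin n) (AlgebraicClosure F)) : Matrix (Fin n) (Fin n) _) = Matrix.diagonal s := by
    rw [mul_assoc, Units.val_mul, Units.val_mul]
    change _ * ((c : Matrix (Fin n) (Fin n) F).map (algebraMap F (AlgebraicClosure F)) * _) = _
    rw [hs, ← mul_assoc, Units.inv_mul, one_mul]
  refine ⟨fun i => ι (s i), ⟨Matrix.GeneralLinearGroup.map ι h, ?_⟩, h, ?_⟩
  · have h1 : galGLBar θ (Matrix.GeneralLinearGroup.map ι h) =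
        Matrix.GeneralLinearGroup.map ι h := by
      ext i j
      exact (barAut θ).commutes _
    have h2 : Matrix.GeneralLinearGroup.map
          ((Algebra.TensorProduct.includeRight : E →ₐ[F] AlgebraicClosure F ⊗[F] E) :
            E →+* AlgebraicClosure F ⊗[F] E) (inclGL F E c) = Matrix.GeneralLinearGroup.map ι
          (Matrix.GeneralLinearGroup.map (algebraMap F (AlgebraicClosure F)) c) := by
      ext i j
      change Algebra.TensorProduct.includeRight (algebraMap F E (c i j)) =
        algebraMap (AlgebraicClosure F) (AlgebraicClosure F ⊗[F] E)
          (algebraMap F (AlgebraicClosure F) (c i j))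
      rw [AlgHom.commutes, ← IsScalarTower.algebraMap_apply]
    rw [h1, h2, ← map_inv, ← map_mul, ← map_mul]
    change (((h⁻¹ * Matrix.GeneralLinearGroup.map (algebraMap F (AlgebraicClosure F)) c * h :
        GL (Fin n) (AlgebraicClosure F)) : Matrix (Fin n) (Fin n) _)).map ι = _
    rw [h3, Matrix.diagonal_map (map_zero _)]
  · have h4 : h⁻¹ * Matrix.GeneralLinearGroup.map (algebraMap F (AlgebraicClosure F))
        (c ^ Module.finrank F E) * h =
        (h⁻¹ * Matrix.GeneralLinearGroup.map (algebraMap F (AlgebraicClosure F)) c * h) ^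
          Module.finrank F E := by
      rw [map_pow]
      simpa using (conj_pow (a := h⁻¹)
        (b := Matrix.GeneralLinearGroup.map (algebraMap F (AlgebraicClosure F)) c)
        (i := Module.finrank F E)).symm
    rw [h4, Units.val_pow_eq_pow_val, h3, Matrix.diagonal_pow]
    congr 1
    funext i
    rw [Algebra.norm_algebraMap, Module.finrank_baseChange]
    rfl

end NormTensor

section Semisimple

variable {n : ℕ} {F : Type*} [NontriviallyNormedField F] [CompleteSpace F]

/-- A topologically unipotent element with a semisimple `d`-th power, `p ∤ d`, is semisimple, being
a limit of polynomials in this power. -/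
theorem isSemisimple_of_pow [PerfectField F] {p d : ℕ} (hp0 : 0 < p) (hpd : p.Coprime d)
    (hd : 0 < d) {c : GL (Fin n) F} (hc : IsTopologicallyUnipotent p c)
    (h : Module.End.IsSemisimple
      (Matrix.toLin' ((c ^ d : GL (Fin n) F) : Matrix (Fin n) (Fin n) F))) :
    Module.End.IsSemisimple (Matrix.toLin' (c : Matrix (Fin n) (Fin n) F)) := by
  have key : ∀ {e : ℕ} (_ : p.Coprime e) (_ : 0 < e) {g : GL (Fin n) F}
      (_ : IsTopologicallyUnipotent p g) (_ : Module.End.IsSemisimple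
        (Matrix.toLin' ((g ^ e : GL (Fin n) F) : Matrix (Fin n) (Fin n) F))),
      Module.End.IsSemisimple
        (Matrix.toLin' ((g⁻¹ : GL (Fin n) F) : Matrix (Fin n) (Fin n) F)) := by
    intro e hpe he g hg hge
    let S : Submodule F (Matrix (Fin n) (Fin n) F) := Subalgebra.toSubmodule
      (Algebra.adjoin F {((g ^ e : GL (Fin n) F) : Matrix (Fin n) (Fin n) F)})
    have hC : IsClosed {y : GL (Fin n) F | (y : Matrix (Fin n) (Fin n) F) ∈ S} :=
      (Submodule.closed_of_finiteDimensional S).preimage Units.continuous_val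
    have h1 : ((g⁻¹ : GL (Fin n) F) : Matrix (Fin n) (Fin n) F) ∈ S := by
      refine hg.inv_mem_of_isClosed hp0 hpe he hC fun a => ?_
      have h2 := Subalgebra.pow_mem (Algebra.adjoin F
        {((g ^ e : GL (Fin n) F) : Matrix (Fin n) (Fin n) F)})
        (Algebra.self_mem_adjoin_singleton F _) a
      simpa [S] using h2
    refine hge.of_mem_adjoin_singleton ?_
    let f : Matrix (Fin n) (Fin n) F →ₐ[F] Module.End F (Fin n → F) :=
      (Matrix.toLinAlgEquiv' : Matrix (Fin n) (Fin n) F ≃ₐ[F] _).toAlgHom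
    have h3 : f ((g⁻¹ : GL (Fin n) F) : Matrix (Fin n) (Fin n) F) ∈ (Algebra.adjoin F
        {((g ^ e : GL (Fin n) F) : Matrix (Fin n) (Fin n) F)}).map f :=
      Subalgebra.mem_map.2 ⟨_, h1, rfl⟩
    rw [AlgHom.map_adjoin_singleton] at h3
    exact h3
  have h1 := key (Nat.coprime_one_right p) one_pos (g := c⁻¹)
    (by simpa [IsTopologicallyUnipotent] using hc.inv) (by rw [pow_one]; exact key hpd hd hc h)
  simpa using h1

end Semisimple

/-! ### Finiteness of double cosets -/

section SeparableSection

open Polynomial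

variable {K : Type*} [Field K] {n : ℕ}

/-- The noncommutative divided difference `∑ k, P_k ∑ j < k, X ^ j Z Y ^ (k - 1 - j)`
of a polynomial `P`. -/
noncomputable def dividedDifference (P : K[X]) (X Z Y : Matrix (Fin n) (Fin n) K) :
    Matrix (Fin n) (Fin n) K :=
  P.sum fun k a => a • ∑ j ∈ Finset.range k, X ^ j * Z * Y ^ (k - 1 - j)

theorem mul_dividedDifference_sub (P : K[X]) (X Z Y : Matrix (Fin n) (Fin n) K) :
    X * dividedDifference P X Z Y - dividedDifference P X Z Y * Y =
      aeval X P * Z - Z * aeval Y P := by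
  have key : ∀ k : ℕ, X * (∑ j ∈ Finset.range k, X ^ j * Z * Y ^ (k - 1 - j)) -
      (∑ j ∈ Finset.range k, X ^ j * Z * Y ^ (k - 1 - j)) * Y = X ^ k * Z - Z * Y ^ k := by
    intro k
    rw [Finset.mul_sum, Finset.sum_mul, ← Finset.sum_sub_distrib]
    have h := Finset.sum_range_sub (fun j => X ^ j * Z * Y ^ (k - j)) k
    simp only [Nat.sub_self, pow_zero, mul_one, one_mul, Nat.sub_zero] at h
    rw [← h]
    refine Finset.sum_congr rfl fun j hj => ?_
    have hjk : k - j = (k - 1 - j) + 1 := by have := Finset.mem_range.1 hj; omega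
    have hjk' : k - (j + 1) = k - 1 - j := by omega
    rw [hjk, hjk', pow_succ', pow_succ]
    simp only [mul_assoc]
  have hsum : ∀ f : ℕ → Matrix (Fin n) (Fin n) K, ∑ k ∈ P.support, P.coeff k • f k =
      ∑ k ∈ Finset.range (P.natDegree + 1), P.coeff k • f k := by
    intro f
    refine Finset.sum_subset (fun k hk => ?_) fun k _ hk => ?_
    · exact Finset.mem_range.2 (Nat.lt_succ_of_le (le_natDegree_of_mem_supp k hk))
    · rw [notMem_support_iff.1 hk, zero_smul]
  rw [dividedDifference, Polynomial.sum_def, hsum, aeval_eq_sum_range, aeval_eq_sum_range,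
    Finset.mul_sum, Finset.sum_mul, Finset.sum_mul, Finset.mul_sum, ← Finset.sum_sub_distrib,
    ← Finset.sum_sub_distrib]
  refine Finset.sum_congr rfl fun k _ => ?_
  rw [Matrix.mul_smul, Matrix.smul_mul, Matrix.mul_smul, Matrix.smul_mul, ← smul_sub, ← smul_sub,
    key]

theorem dividedDifference_self (P : K[X]) (Y : Matrix (Fin n) (Fin n) K) :
    dividedDifference P Y 1 Y = aeval Y (derivative P) := by
  rw [dividedDifference, derivative_apply, Polynomial.sum_def, Polynomial.sum_def, map_sum]
  refine Finset.sum_congr rfl fun k _ => ?_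
  have : ∀ j ∈ Finset.range k, Y ^ j * 1 * Y ^ (k - 1 - j) = Y ^ (k - 1) := by
    intro j hj
    rw [mul_one, ← pow_add]
    congr 1
    have := Finset.mem_range.1 hj
    omega
  rw [Finset.sum_congr rfl this]
  simp [Algebra.algebraMap_eq_smul_one, ← nsmul_eq_mul]

theorem trace_mul_dividedDifference (P : K[X]) {X Y : Matrix (Fin n) (Fin n) K}
    (h : Commute X Y) (Z : Matrix (Fin n) (Fin n) K) :
    (X * dividedDifference P Y Z Y).trace = (X * aeval Y (derivative P) * Z).trace := by
  rw [← dividedDifference_self, dividedDifference, dividedDifference, Polynomial.sum_def,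
    Polynomial.sum_def, Finset.mul_sum, Finset.mul_sum, Finset.sum_mul, Matrix.trace_sum,
    Matrix.trace_sum]
  refine Finset.sum_congr rfl fun k _ => ?_
  rw [Matrix.mul_smul, Matrix.mul_smul, Matrix.smul_mul, Matrix.trace_smul, Matrix.trace_smul]
  congr 1
  rw [Finset.mul_sum, Finset.mul_sum, Finset.sum_mul, Matrix.trace_sum, Matrix.trace_sum]
  refine Finset.sum_congr rfl fun j _ => ?_
  rw [← mul_assoc, Matrix.trace_mul_comm, mul_one]
  congr 1
  rw [← mul_assoc, ← mul_assoc, ← mul_assoc, (h.pow_right (k - 1 - j)).eq.symm, mul_assoc X,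
    ← pow_add, add_comm, pow_add, ← mul_assoc]

theorem commute_aeval {X Y : Matrix (Fin n) (Fin n) K} (h : Commute X Y) (b : K[X]) :
    Commute X (aeval Y b) := by
  rw [aeval_eq_sum_range]
  exact Commute.sum_right _ _ _ fun k _ => (h.pow_right k).smul_right _

/-- The trace form is nondegenerate on the centralizer of a matrix killed by a separable
polynomial `P`: the projection `Z ↦ ∑ aᵢ Z bᵢ` to the centralizer that is defined by the
separability idempotent `∑ aᵢ ⊗ bᵢ` of `K[X] / (P)` is adjoint to the inclusion. -/
theorem eq_zero_of_trace_mul_eq_zero {P : K[X]} (hP : P.Separable)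
    {Y : Matrix (Fin n) (Fin n) K} (hY : aeval Y P = 0) {X : Matrix (Fin n) (Fin n) K}
    (hX : Commute X Y) (h : ∀ Z, Commute Z Y → (X * Z).trace = 0) : X = 0 := by
  obtain ⟨a, b, hab⟩ := hP
  have hb : aeval Y b * aeval Y (derivative P) = 1 := by
    have := congrArg (aeval Y) hab
    simpa [hY] using this
  refine Matrix.ext_iff_trace_mul_right.2 fun Z => ?_
  rw [zero_mul, Matrix.trace_zero]
  have h1 : Commute (dividedDifference P Y (Z * aeval Y b) Y) Y := by
    have := mul_dividedDifference_sub P Y (Z * aeval Y b) Y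
    rw [hY, zero_mul, mul_zero, sub_zero, sub_eq_zero] at this
    exact this.symm
  rw [← h _ h1, trace_mul_dividedDifference P hX, ← mul_assoc, Matrix.trace_mul_comm _ (aeval Y b),
    ← mul_assoc, ← mul_assoc, ← (commute_aeval hX b).eq, mul_assoc X, hb, mul_one]

end SeparableSection

section FiniteDoubleCosets

open Polynomial
open scoped Matrix.Norms.Elementwise

variable {n : ℕ} {K : Type*} [NormedField K]

theorem mem_twistedCentralizer_refl {γ g : GL (Fin n) K} :
    g ∈ twistedCentralizer (galGL (AlgEquiv.refl : K ≃ₐ[K] K)) γ ↔ γ * g = g * γ := by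
  change g⁻¹ * γ * g = γ ↔ _
  rw [mul_assoc, inv_mul_eq_iff_eq_mul]

theorem continuous_dividedDifference (P : K[X]) (Z Y : Matrix (Fin n) (Fin n) K) :
    Continuous fun X : Matrix (Fin n) (Fin n) K => dividedDifference P X Z Y := by
  have h1 : ∀ j k : ℕ, Continuous fun X : Matrix (Fin n) (Fin n) K => X ^ j * Z * Y ^ (k - 1 - j) :=
    fun j k => (((continuous_pow (M := Matrix (Fin n) (Fin n) K) j).matrix_mul
      continuous_const).matrix_mul continuous_const)
  simp only [dividedDifference, Polynomial.sum_def]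
  exact continuous_finsetSum _ fun k _ =>
    (continuous_finsetSum _ fun j _ => h1 j k).const_smul (P.coeff k)

variable [IsUltrametricDist K]

/-- Zeros of a separable polynomial `P` in `M_n(K)` that are close to `Y` are conjugate to `Y` under
an element close to `1`: if `b` is the inverse of `P'` modulo `P`, then the matrix
`dividedDifference P Y' 1 Y * b(Y)` intertwines `Y` and `Y'`, and it is `1` for `Y' = Y`. -/
theorem eventually_exists_conj {P : K[X]} (hP : P.Separable) {Y : Matrix (Fin n) (Fin n) K}
    (hY : aeval Y P = 0) {r : ℝ} (hr : r ∈ Set.Ioo (0 : ℝ) 1) :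
    ∀ᶠ Y' in 𝓝 Y, aeval Y' P = 0 → ∃ s ∈ congruenceSubgroup n K hr,
      Y' * (s : Matrix (Fin n) (Fin n) K) = (s : Matrix (Fin n) (Fin n) K) * Y := by
  obtain ⟨a, b, hab⟩ := hP
  have hb : aeval Y (derivative P) * aeval Y b = 1 := by
    have := congrArg (aeval Y) hab
    rw [← map_mul, mul_comm]
    simpa [hY] using this
  let f : Matrix (Fin n) (Fin n) K → Matrix (Fin n) (Fin n) K :=
    fun Y' => dividedDifference P Y' 1 Y * aeval Y b
  have hf : Continuous f := (continuous_dividedDifference P 1 Y).matrix_mul continuous_const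
  have hfY : f Y = 1 := by simp only [f]; rw [dividedDifference_self, hb]
  have hev : ∀ᶠ Y' in 𝓝 Y, ‖f Y' - 1‖ < r := by
    have hc : Continuous fun Y' => ‖f Y' - 1‖ := (hf.sub continuous_const).norm
    exact hc.continuousAt.eventually_lt continuousAt_const (by simp [hfY, hr.1])
  filter_upwards [hev] with Y' hY' hPY'
  obtain ⟨s, hs⟩ := isUnit_of_norm_sub_one_lt (hY'.trans hr.2)
  refine ⟨s, by rw [mem_congruenceSubgroup, hs]; exact hY'.le, ?_⟩
  rw [hs]
  have h1 := mul_dividedDifference_sub P Y' 1 Y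
  rw [hPY', hY, zero_mul, mul_zero, sub_zero, sub_eq_zero] at h1
  simp only [f]
  rw [← mul_assoc, h1, mul_assoc, mul_assoc, (commute_aeval (Commute.refl Y) b).eq]

/-- If `γ` is semisimple, then the set of all `h` with `h⁻¹ γ h` in the open compact subgroup `C`
is a finite union of double cosets `H_γ h C`. -/
theorem finite_doubleCosets [ProperSpace K] [PerfectField K] {γ : GL (Fin n) K}
    (hγ : Module.End.IsSemisimple (Matrix.toLin' (γ : Matrix (Fin n) (Fin n) K)))
    {r : ℝ} (hr : r ∈ Set.Ioo (0 : ℝ) 1) :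
    ((DoubleCoset.mk (twistedCentralizer (galGL (AlgEquiv.refl : K ≃ₐ[K] K)) γ)
      (congruenceSubgroup n K hr)) ''
        {h | h⁻¹ * γ * h ∈ congruenceSubgroup n K hr}).Finite := by
  classical
  set P := minpoly K (Matrix.toLin' (γ : Matrix (Fin n) (Fin n) K))
  have hP : P.Separable := PerfectField.separable_iff_squarefree.2 hγ.minpoly_squarefree
  have h0 : aeval (γ : Matrix (Fin n) (Fin n) K) P = 0 := by
    have h1 : aeval (Matrix.toLin' (γ : Matrix (Fin n) (Fin n) K)) P = 0 := minpoly.aeval _ _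
    have h2 := aeval_algHom_apply
      (Matrix.toLinAlgEquiv' : Matrix (Fin n) (Fin n) K ≃ₐ[K] _) (γ : Matrix (Fin n) (Fin n) K) P
    exact (map_eq_zero_iff _ (Matrix.toLinAlgEquiv' (R := K) (n := Fin n)).injective).1
      (h2.symm.trans h1)
  have hconj : ∀ h : GL (Fin n) K,
      aeval ((h⁻¹ * γ * h : GL (Fin n) K) : Matrix (Fin n) (Fin n) K) P = 0 := by
    intro h
    have h1 : ∀ M : Matrix (Fin n) (Fin n) K, aeval (((h⁻¹ : GL (Fin n) K) :
        Matrix (Fin n) (Fin n) K) * M * (h : Matrix (Fin n) (Fin n) K)) P =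
        ((h⁻¹ : GL (Fin n) K) : Matrix (Fin n) (Fin n) K) * aeval M P *
          (h : Matrix (Fin n) (Fin n) K) := by
      intro M
      rw [aeval_eq_sum_range, aeval_eq_sum_range, Finset.mul_sum, Finset.sum_mul]
      refine Finset.sum_congr rfl fun k _ => ?_
      rw [Units.conj_pow', Matrix.mul_smul, Matrix.smul_mul]
    rw [Units.val_mul, Units.val_mul, h1, h0, mul_zero, zero_mul]
  have hloc : ∀ y ∈ (congruenceSubgroup n K hr : Set (GL (Fin n) K)), ∃ U ∈ 𝓝 y,
      ∀ h h' : GL (Fin n) K, h⁻¹ * γ * h ∈ U → h'⁻¹ * γ * h' ∈ U →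
        DoubleCoset.mk (twistedCentralizer (galGL (AlgEquiv.refl : K ≃ₐ[K] K)) γ)
          (congruenceSubgroup n K hr) h =
        DoubleCoset.mk (twistedCentralizer (galGL (AlgEquiv.refl : K ≃ₐ[K] K)) γ)
          (congruenceSubgroup n K hr) h' := by
    intro y _
    by_cases hy : aeval (y : Matrix (Fin n) (Fin n) K) P = 0
    · refine ⟨_, Units.continuous_val.continuousAt.preimage_mem_nhds
        (eventually_exists_conj hP hy hr), fun h h' hh hh' => ?_⟩
      obtain ⟨s, hs, hse⟩ := hh (hconj h)
      obtain ⟨s', hs', hse'⟩ := hh' (hconj h')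
      have e1 : h⁻¹ * γ * h * s = s * y := Units.ext hse
      have e2 : h'⁻¹ * γ * h' * s' = s' * y := Units.ext hse'
      refine (DoubleCoset.eq _ _ _ _).2 ⟨h' * s' * s⁻¹ * h⁻¹, ?_, s * s'⁻¹,
        Subgroup.mul_mem _ hs (Subgroup.inv_mem _ hs'), by group⟩
      rw [mem_twistedCentralizer_refl]
      have e3 : γ * h * s = h * s * y := by
        rw [mul_assoc h, ← e1]; group
      have e4 : γ * h' * s' = h' * s' * y := by
        rw [mul_assoc h', ← e2]; group
      have e5 : s⁻¹ * h⁻¹ * γ = y * s⁻¹ * h⁻¹ := by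
        have : γ = h * s * y * s⁻¹ * h⁻¹ := by rw [← e3]; group
        rw [this]; group
      calc γ * (h' * s' * s⁻¹ * h⁻¹) = (γ * h' * s') * s⁻¹ * h⁻¹ := by group
        _ = h' * s' * (y * s⁻¹ * h⁻¹) := by rw [e4]; group
        _ = _ := by rw [← e5]; group
    · have hc : Continuous fun g : GL (Fin n) K => aeval (g : Matrix (Fin n) (Fin n) K) P := by
        have h1 : ∀ k : ℕ,
            Continuous fun g : GL (Fin n) K => (g : Matrix (Fin n) (Fin n) K) ^ k := fun k =>
          (continuous_pow (M := Matrix (Fin n) (Fin n) K) k).comp Units.continuous_val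
        simp only [aeval_eq_sum_range]
        exact continuous_finsetSum _ fun k _ => (h1 k).const_smul (P.coeff k)
      refine ⟨{g | aeval (g : Matrix (Fin n) (Fin n) K) P ≠ 0},
        (isOpen_ne_fun hc continuous_const).mem_nhds hy, fun h h' hh => absurd (hconj h) hh⟩
  choose! U hU hUe using hloc
  obtain ⟨t, ht, htc⟩ := (isCompact_congruenceSubgroup (n := n) (L := K) hr).elim_nhds_subcover U hU
  have hsub : (DoubleCoset.mk (twistedCentralizer (galGL (AlgEquiv.refl : K ≃ₐ[K] K)) γ)
      (congruenceSubgroup n K hr)) '' {h | h⁻¹ * γ * h ∈ congruenceSubgroup n K hr} ⊆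
      ⋃ y ∈ t, (DoubleCoset.mk (twistedCentralizer (galGL (AlgEquiv.refl : K ≃ₐ[K] K)) γ)
      (congruenceSubgroup n K hr)) '' {h | h⁻¹ * γ * h ∈ U y} := by
    rintro _ ⟨h, hh, rfl⟩
    obtain ⟨y, hy, hyU⟩ := Set.mem_iUnion₂.1 (htc hh)
    exact Set.mem_iUnion₂.2 ⟨y, hy, h, hyU, rfl⟩
  refine Set.Finite.subset (t.finite_toSet.biUnion fun y hy => Set.Subsingleton.finite ?_) hsub
  rintro _ ⟨h, hh, rfl⟩ _ ⟨h', hh', rfl⟩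
  exact hUe y (ht y hy) h h' hh hh'

end FiniteDoubleCosets

/-! ### Characters of the general linear group and indices of open subgroups -/

section TransposeInvariance

variable {K : Type*} [Field K] {N : ℕ} {H : Type*} [CommGroup H]

theorem map_transvection_eq_one (h2 : (2 : K) ≠ 0) (χ : GL (Fin N) K →* H) {i j : Fin N}
    (hij : i ≠ j) (c : K) {g : GL (Fin N) K}
    (hg : (g : Matrix (Fin N) (Fin N) K) = Matrix.transvection i j c) : χ g = 1 := by
  let v : Fin N → K := Function.update 1 i 2
  have hv : (Matrix.diagonal v).det ≠ 0 := by
    rw [Matrix.det_diagonal]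
    refine Finset.prod_ne_zero_iff.2 fun k _ => ?_
    by_cases hk : k = i
    · subst hk; simpa [v] using h2
    · simp [v, hk]
  obtain ⟨D, hD⟩ := (Matrix.isUnit_iff_isUnit_det _).2 (isUnit_iff_ne_zero.2 hv)
  -- conjugation by `D` doubles the parameter, so that `D g D⁻¹ = g ^ 2`
  have e : D * g = g * g * D := by
    apply Units.ext
    rw [Units.val_mul, Units.val_mul, Units.val_mul, hD, hg,
      Matrix.transvection_mul_transvection_same i j hij]
    ext a b
    rw [Matrix.diagonal_mul, Matrix.mul_diagonal]
    simp only [Matrix.transvection, Matrix.add_apply, Matrix.one_apply, Matrix.single_apply]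
    by_cases hb : i = a ∧ j = b
    · obtain ⟨rfl, rfl⟩ := hb
      simp [v, hij, hij.symm]
      ring
    · rw [if_neg hb, if_neg hb]
      by_cases hab : a = b
      · subst hab; simp
      · simp [hab]
  have e2 := congrArg χ e
  rw [map_mul, map_mul, map_mul, mul_comm] at e2
  have e3 := mul_right_cancel e2
  exact mul_eq_left.1 e3.symm

/-- A homomorphism from `GL_N(K)` to a commutative group does not distinguish a matrix from its
transpose. -/
theorem map_transpose_eq (h2 : (2 : K) ≠ 0) (χ : GL (Fin N) K →* H) {g g' : GL (Fin N) K}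
    (h : (g' : Matrix (Fin N) (Fin N) K) = (g : Matrix (Fin N) (Fin N) K).transpose) :
    χ g' = χ g := by
  suffices ∀ M : Matrix (Fin N) (Fin N) K, M.det ≠ 0 → ∀ g g' : GL (Fin N) K,
      (g : Matrix (Fin N) (Fin N) K) = M → (g' : Matrix (Fin N) (Fin N) K) = M.transpose →
      χ g' = χ g from
    this g ((Matrix.isUnit_iff_isUnit_det _).1 g.isUnit).ne_zero g g' rfl h
  intro M hM
  refine Matrix.diagonal_transvection_induction_of_det_ne_zero (fun M => ∀ g g' : GL (Fin N) K,
      (g : Matrix (Fin N) (Fin N) K) = M → (g' : Matrix (Fin N) (Fin N) K) = M.transpose →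
      χ g' = χ g) M hM ?_ ?_ ?_
  · intro D _ g g' hg hg'
    rw [Matrix.diagonal_transpose, ← hg] at hg'
    rw [Units.ext hg']
  · intro t g g' hg hg'
    rw [map_transvection_eq_one h2 χ t.hij t.c hg,
      map_transvection_eq_one h2 χ t.hij.symm t.c (g := g')]
    rw [hg', Matrix.TransvectionStruct.toMatrix, Matrix.transvection, Matrix.transvection,
      Matrix.transpose_add, Matrix.transpose_one, Matrix.transpose_single]
  · intro A B hA hB ihA ihB g g' hg hg'
    obtain ⟨a, ha⟩ := (Matrix.isUnit_iff_isUnit_det _).2 (isUnit_iff_ne_zero.2 hA)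
    obtain ⟨b, hb⟩ := (Matrix.isUnit_iff_isUnit_det _).2 (isUnit_iff_ne_zero.2 hB)
    obtain ⟨a', ha'⟩ := (Matrix.isUnit_iff_isUnit_det A.transpose).2
      (by rw [Matrix.det_transpose]; exact isUnit_iff_ne_zero.2 hA)
    obtain ⟨b', hb'⟩ := (Matrix.isUnit_iff_isUnit_det B.transpose).2
      (by rw [Matrix.det_transpose]; exact isUnit_iff_ne_zero.2 hB)
    have e1 : g = a * b := Units.ext (by rw [hg, Units.val_mul, ha, hb])
    have e2 : g' = b' * a' := Units.ext (by
      rw [hg', Units.val_mul, ha', hb', Matrix.transpose_mul])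
    rw [e1, e2, map_mul, map_mul, ihA a a' ha ha', ihB b b' hb hb', mul_comm]

/-- A homomorphism to a commutative group maps the isometries of a nondegenerate bilinear form to
elements of order at most two. -/
theorem sq_map_eq_one_of_isometry (h2 : (2 : K) ≠ 0) (χ : GL (Fin N) K →* H)
    {T B : GL (Fin N) K} (h : (T : Matrix (Fin N) (Fin N) K).transpose *
      (B : Matrix (Fin N) (Fin N) K) * (T : Matrix (Fin N) (Fin N) K) = B) : χ T ^ 2 = 1 := by
  obtain ⟨T', hT'⟩ := (Matrix.isUnit_iff_isUnit_det (T : Matrix (Fin N) (Fin N) K).transpose).2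
    (by rw [Matrix.det_transpose]; exact (Matrix.isUnit_iff_isUnit_det _).1 T.isUnit)
  have e : T' * B * T = B := Units.ext (by rw [Units.val_mul, Units.val_mul, hT', h])
  have e2 := congrArg χ e
  rw [map_mul, map_mul, map_transpose_eq h2 χ hT', mul_assoc, mul_comm, mul_assoc] at e2
  have e3 := mul_eq_left.1 e2
  rw [sq, e3]

end TransposeInvariance

section UnimodularAux

variable {S : Type*} [Group S] [TopologicalSpace S] [IsTopologicalGroup S] [MeasurableSpace S]
  [BorelSpace S]

/-- The measure of a compact open subgroup `U` is the measure of an open subgroup `W`, times the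
index of `W` in `U`, for a measure that is invariant under the translations by `U`. -/
theorem measure_eq_relIndex_mul {U W : Subgroup S} (hUc : IsCompact (U : Set S))
    (hW : IsOpen (W : Set S)) (hWU : W ≤ U) (m : Measure S)
    (hm : ∀ u ∈ U, m ((fun x => u * x) '' (W : Set S)) = m W) :
    ∃ i : ℕ, i ≠ 0 ∧ W.relIndex U = i ∧ m U = i * m W := by
  have : CompactSpace U := isCompact_iff_compactSpace.1 hUc
  have hfin : Finite (U ⧸ W.subgroupOf U) :=
    Subgroup.quotient_finite_of_isOpen _ (hW.preimage continuous_subtype_val)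
  have : Fintype (U ⧸ W.subgroupOf U) := Fintype.ofFinite _
  have : (W.subgroupOf U).FiniteIndex := Subgroup.finiteIndex_of_finite_quotient
  refine ⟨W.relIndex U, Subgroup.FiniteIndex.index_ne_zero (H := W.subgroupOf U), rfl, ?_⟩
  let f : U ⧸ W.subgroupOf U → Set S := fun q => (fun x => (q.out : S) * x) '' (W : Set S)
  have hUf : (U : Set S) = ⋃ q, f q := by
    ext x
    simp only [Set.mem_iUnion, f, Set.mem_image, SetLike.mem_coe]
    constructor
    · intro hx
      refine ⟨QuotientGroup.mk (⟨x, hx⟩ : U), _, ?_, mul_inv_cancel_left _ x⟩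
      have := QuotientGroup.eq.1 (QuotientGroup.out_eq'
        (QuotientGroup.mk (⟨x, hx⟩ : U) : U ⧸ W.subgroupOf U))
      simpa [Subgroup.mem_subgroupOf] using this
    · rintro ⟨q, w, hw, rfl⟩
      exact U.mul_mem q.out.2 (hWU hw)
  have hdisj : Pairwise (Function.onFun Disjoint f) := by
    intro q q' hqq'
    rw [Function.onFun, Set.disjoint_left]
    rintro x ⟨w, hw, rfl⟩ ⟨w', hw', hww'⟩
    apply hqq'
    rw [← q.out_eq', ← q'.out_eq']
    refine QuotientGroup.eq.2 ?_
    rw [Subgroup.mem_subgroupOf]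
    have : ((q.out⁻¹ * q'.out : U) : S) = w * w'⁻¹ := by
      rw [eq_mul_inv_iff_mul_eq]
      simp only [Subgroup.coe_mul, Subgroup.coe_inv, mul_assoc]
      rw [inv_mul_eq_iff_eq_mul]
      exact hww'
    rw [this]
    exact W.mul_mem hw (W.inv_mem hw')
  have hmeas : ∀ q, MeasurableSet (f q) := fun q =>
    ((Homeomorph.mulLeft (q.out : S)).isOpenMap _ hW).measurableSet
  rw [hUf, measure_iUnion hdisj hmeas]
  simp only [f, hm _ (Subtype.mem _), tsum_fintype, Finset.sum_const, Finset.card_univ,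
    nsmul_eq_mul]
  rw [Subgroup.relIndex, Subgroup.index, Nat.card_eq_fintype_card]

end UnimodularAux

/-! ### Unimodularity of centralizers -/

section Unimodular

open scoped Matrix.Norms.Elementwise Pointwise NNReal

variable {n : ℕ} {K : Type*} [NontriviallyNormedField K]

theorem isEmbedding_coe_generalLinearGroup :
    IsEmbedding (Units.val : GL (Fin n) K → Matrix (Fin n) (Fin n) K) := by
  refine Units.isEmbedding_val_mk' (f := fun A => A⁻¹) ?_ fun u => (Matrix.coe_units_inv u).symm
  have h1 : ContinuousOn (fun A : Matrix (Fin n) (Fin n) K => A.det⁻¹ • A.adjugate)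
      {A | IsUnit A} := by
    have hdet : Continuous fun A : Matrix (Fin n) (Fin n) K => A.det := continuous_id.matrix_det
    have hadj : Continuous fun A : Matrix (Fin n) (Fin n) K => A.adjugate :=
      continuous_id.matrix_adjugate
    exact (hdet.continuousOn.inv₀ fun A hA =>
      ((Matrix.isUnit_iff_isUnit_det A).1 hA).ne_zero).smul hadj.continuousOn
  refine h1.congr fun A _ => ?_
  simp only [Matrix.inv_def, Ring.inverse_eq_inv']

theorem mem_lieCentralizer_refl {γ : GL (Fin n) K} {X : Matrix (Fin n) (Fin n) K} :
    X ∈ lieCentralizer (AlgEquiv.refl : K ≃ₐ[K] K) γ ↔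
      (γ : Matrix (Fin n) (Fin n) K) * X = X * (γ : Matrix (Fin n) (Fin n) K) := by
  change (γ : Matrix (Fin n) (Fin n) K) * (X * ((γ⁻¹ : GL (Fin n) K) : Matrix (Fin n) (Fin n) K)) -
    X = 0 ↔ _
  rw [sub_eq_zero, ← mul_assoc]
  exact Units.mul_inv_eq_iff_eq_mul γ

variable (γ : GL (Fin n) K)

/-- The centralizer of `γ` in `GL_n(K)`, embedded in the centralizer in `M_n(K)`. -/
noncomputable def centralizerToLie (s : twistedCentralizer (galGL (AlgEquiv.refl : K ≃ₐ[K] K)) γ) :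
    lieCentralizer (AlgEquiv.refl : K ≃ₐ[K] K) γ :=
  ⟨((s : GL (Fin n) K) : Matrix (Fin n) (Fin n) K), mem_lieCentralizer_refl.2
    (congrArg Units.val (mem_twistedCentralizer_refl.1 s.2))⟩

theorem isOpenEmbedding_centralizerToLie : IsOpenEmbedding (centralizerToLie γ) := by
  refine ⟨?_, ?_⟩
  · have h1 : IsEmbedding (fun s : twistedCentralizer (galGL (AlgEquiv.refl : K ≃ₐ[K] K)) γ =>
        ((s : GL (Fin n) K) : Matrix (Fin n) (Fin n) K)) :=
      isEmbedding_coe_generalLinearGroup.comp IsEmbedding.subtypeVal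
    have hc : Continuous (centralizerToLie γ) := h1.continuous.subtype_mk _
    exact IsEmbedding.of_comp hc continuous_subtype_val h1
  · have h1 : Set.range (centralizerToLie γ) =
        {X : lieCentralizer (AlgEquiv.refl : K ≃ₐ[K] K) γ |
          (X : Matrix (Fin n) (Fin n) K).det ≠ 0} := by
      ext X
      constructor
      · rintro ⟨s, rfl⟩
        exact ((Matrix.isUnit_iff_isUnit_det _).1 (s : GL (Fin n) K).isUnit).ne_zero
      · intro hX
        obtain ⟨g, hg⟩ := (Matrix.isUnit_iff_isUnit_det _).2 (isUnit_iff_ne_zero.2 hX)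
        refine ⟨⟨g, mem_twistedCentralizer_refl.2 (Units.ext ?_)⟩, Subtype.ext hg⟩
        rw [Units.val_mul, Units.val_mul, hg]
        exact mem_lieCentralizer_refl.1 X.2
    rw [h1]
    exact isOpen_ne_fun (continuous_subtype_val.matrix_det) continuous_const

/-- Left multiplication by an element of the centralizer. -/
noncomputable def centralizerMulLeft : twistedCentralizer (galGL (AlgEquiv.refl : K ≃ₐ[K] K)) γ →*
    Module.End K (lieCentralizer (AlgEquiv.refl : K ≃ₐ[K] K) γ) where
  toFun s := (LinearMap.mulLeft K ((s : GL (Fin n) K) : Matrix (Fin n) (Fin n) K)).restrict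
    fun X hX => by
      have hs := mem_lieCentralizer_refl.1 (centralizerToLie γ s).2
      rw [mem_lieCentralizer_refl] at hX ⊢
      change _ * (_ * X) = _ * X * _
      rw [mul_assoc, ← hX, ← mul_assoc, ← mul_assoc]
      congr 1
  map_one' := by ext X : 2; exact one_mul _
  map_mul' s t := by ext X : 2; exact mul_assoc _ _ _

/-- Conjugation by an element of the centralizer. -/
noncomputable def centralizerConj : twistedCentralizer (galGL (AlgEquiv.refl : K ≃ₐ[K] K)) γ →*
    Module.End K (lieCentralizer (AlgEquiv.refl : K ≃ₐ[K] K) γ) where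
  toFun s := (LinearMap.mulLeft K ((s : GL (Fin n) K) : Matrix (Fin n) (Fin n) K) ∘ₗ
      LinearMap.mulRight K (((s : GL (Fin n) K)⁻¹ : GL (Fin n) K) :
        Matrix (Fin n) (Fin n) K)).restrict
    fun X hX => by
      have hs : γ * (s : GL (Fin n) K) = s * γ := mem_twistedCentralizer_refl.1 s.2
      have hs1 := congrArg Units.val hs
      have hs2 := congrArg Units.val (show γ * (s : GL (Fin n) K)⁻¹ = (s : GL (Fin n) K)⁻¹ * γ by
        rw [eq_inv_mul_iff_mul_eq, ← mul_assoc, ← hs, mul_inv_cancel_right])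
      simp only [Units.val_mul] at hs1 hs2
      rw [mem_lieCentralizer_refl] at hX ⊢
      change _ * (_ * (X * _)) = _ * (X * _) * _
      rw [← mul_assoc, hs1, mul_assoc, ← mul_assoc _ X, hX, mul_assoc X, hs2]
      simp only [mul_assoc]
  map_one' := by ext X : 2; simp
  map_mul' s t := by
    ext X : 2
    simp [mul_assoc]

theorem coe_centralizerConj (s : twistedCentralizer (galGL (AlgEquiv.refl : K ≃ₐ[K] K)) γ)
    (X : lieCentralizer (AlgEquiv.refl : K ≃ₐ[K] K) γ) :
    (centralizerConj γ s X : Matrix (Fin n) (Fin n) K) =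
      ((s : GL (Fin n) K) : Matrix (Fin n) (Fin n) K) * (X *
        (((s : GL (Fin n) K)⁻¹ : GL (Fin n) K) : Matrix (Fin n) (Fin n) K)) := rfl

variable {γ}

/-- The conjugation action of the centralizer of a semisimple `γ` on its Lie algebra preserves the
trace form, and hence every character of the linear automorphisms with values in a torsion-free
group is trivial on it. -/
theorem sq_map_centralizerConj_eq_one (h2 : (2 : K) ≠ 0) [PerfectField K]
    (hγ : Module.End.IsSemisimple (Matrix.toLin' (γ : Matrix (Fin n) (Fin n) K)))
    {H : Type*} [CommGroup H]
    (χ : (Module.End K (lieCentralizer (AlgEquiv.refl : K ≃ₐ[K] K) γ))ˣ →* H)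
    (s : twistedCentralizer (galGL (AlgEquiv.refl : K ≃ₐ[K] K)) γ) :
    χ ((centralizerConj γ).toHomUnits s) ^ 2 = 1 := by
  set P := minpoly K (Matrix.toLin' (γ : Matrix (Fin n) (Fin n) K))
  have hP : P.Separable := PerfectField.separable_iff_squarefree.2 hγ.minpoly_squarefree
  have h0 : Polynomial.aeval (γ : Matrix (Fin n) (Fin n) K) P = 0 := by
    have h1 : Polynomial.aeval (Matrix.toLin' (γ : Matrix (Fin n) (Fin n) K)) P = 0 :=
      minpoly.aeval _ _
    have h2 := Polynomial.aeval_algHom_apply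
      (Matrix.toLinAlgEquiv' : Matrix (Fin n) (Fin n) K ≃ₐ[K] _) (γ : Matrix (Fin n) (Fin n) K) P
    exact (map_eq_zero_iff _ (Matrix.toLinAlgEquiv' (R := K) (n := Fin n)).injective).1
      (h2.symm.trans h1)
  let A := lieCentralizer (AlgEquiv.refl : K ≃ₐ[K] K) γ
  let c := Module.finBasis K A
  let B : Matrix (Fin (Module.finrank K A)) (Fin (Module.finrank K A)) K :=
    Matrix.of fun i j =>
      ((c i : Matrix (Fin n) (Fin n) K) * (c j : Matrix (Fin n) (Fin n) K)).trace
  have hB : IsUnit B := by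
    rw [← Matrix.vecMul_injective_iff_isUnit]
    refine (injective_iff_map_eq_zero (Matrix.vecMulLinear B)).2 fun v hv => ?_
    have hX : (∑ i, v i • c i : A) = 0 := by
      refine Subtype.ext ?_
      refine eq_zero_of_trace_mul_eq_zero hP h0
        (mem_lieCentralizer_refl.1 (∑ i, v i • c i : A).2).symm fun Z hZ => ?_
      have hZ' : Z ∈ A := mem_lieCentralizer_refl.2 hZ.eq.symm
      rw [show Z = ((∑ j, c.repr ⟨Z, hZ'⟩ j • c j : A) : Matrix (Fin n) (Fin n) K) by
        rw [c.sum_repr]]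
      simp only [Submodule.coe_sum, Submodule.coe_smul, Finset.mul_sum, Matrix.trace_sum,
        Matrix.mul_smul, Matrix.trace_smul, Finset.sum_mul, Matrix.smul_mul]
      refine Finset.sum_eq_zero fun j _ => ?_
      have := congrFun hv j
      simp only [Matrix.vecMulLinear_apply, Matrix.vecMul, dotProduct, B, Matrix.of_apply,
        Pi.zero_apply] at this
      simp only [smul_eq_mul]
      rw [← Finset.mul_sum, this, mul_zero]
    exact funext fun i => Fintype.linearIndependent_iff.1 c.linearIndependent v hX i
  obtain ⟨B', hB'⟩ := hB
  let e : GL (Fin (Module.finrank K A)) K ≃* (Module.End K A)ˣ :=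
    Units.mapEquiv (LinearMap.toMatrixAlgEquiv c).symm.toMulEquiv
  have h1 := sq_map_eq_one_of_isometry h2 (χ.comp e.toMonoidHom)
    (T := e.symm ((centralizerConj γ).toHomUnits s)) (B := B') ?_
  · simpa using h1
  · have hT : ((e.symm ((centralizerConj γ).toHomUnits s) :
        GL (Fin (Module.finrank K A)) K) : Matrix _ _ K) =
        LinearMap.toMatrix c c (centralizerConj γ s) := rfl
    rw [hT, hB']
    have hcol : ∀ j, ∑ k, LinearMap.toMatrix c c (centralizerConj γ s) k j •
        (c k : Matrix (Fin n) (Fin n) K) =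
          (centralizerConj γ s (c j) : Matrix (Fin n) (Fin n) K) := by
      intro j
      have := congrArg A.subtype (c.sum_repr (centralizerConj γ s (c j)))
      rw [map_sum] at this
      simp only [LinearMap.toMatrix_apply]
      exact this
    ext i j
    have e1 : (((centralizerConj γ s (c i)) : Matrix (Fin n) (Fin n) K) *
        (centralizerConj γ s (c j) : Matrix (Fin n) (Fin n) K)).trace = B i j := by
      have e2 : ((centralizerConj γ s (c i)) : Matrix (Fin n) (Fin n) K) *
          (centralizerConj γ s (c j) : Matrix (Fin n) (Fin n) K) =
          ((s : GL (Fin n) K) : Matrix (Fin n) (Fin n) K) *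
          (((c i : Matrix (Fin n) (Fin n) K) * (c j : Matrix (Fin n) (Fin n) K)) *
            (((s : GL (Fin n) K)⁻¹ : GL (Fin n) K) : Matrix (Fin n) (Fin n) K)) := by
        rw [coe_centralizerConj, coe_centralizerConj]
        simp only [mul_assoc]
        rw [Units.inv_mul_cancel_left]
      rw [e2, Matrix.trace_mul_comm, mul_assoc, Units.inv_mul, mul_one]
      rfl
    rw [← e1, ← hcol, ← hcol]
    simp only [Matrix.mul_apply, Matrix.transpose_apply, Finset.sum_mul, Finset.mul_sum,
      Matrix.trace_sum, Matrix.smul_mul, Matrix.mul_smul, Matrix.trace_smul, smul_eq_mul]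
    refine Finset.sum_congr rfl fun k _ => Finset.sum_congr rfl fun l _ => ?_
    simp only [B, Matrix.of_apply]
    ring

/-- The centralizer of a semisimple element of `GL_n(K)` is unimodular. -/
theorem measure_preimage_mul_right [IsUltrametricDist K] [ProperSpace K] (h2 : (2 : K) ≠ 0)
    [PerfectField K]
    (hγ : Module.End.IsSemisimple (Matrix.toLin' (γ : Matrix (Fin n) (Fin n) K)))
    [MeasurableSpace (GL (Fin n) K)] [BorelSpace (GL (Fin n) K)]
    (μ : Measure (twistedCentralizer (galGL (AlgEquiv.refl : K ≃ₐ[K] K)) γ)) [μ.IsHaarMeasure]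
    (s : twistedCentralizer (galGL (AlgEquiv.refl : K ≃ₐ[K] K)) γ)
    {Z : Set (twistedCentralizer (galGL (AlgEquiv.refl : K ≃ₐ[K] K)) γ)} (hZ : IsOpen Z) :
    μ ((fun x => x * s) ⁻¹' Z) = μ Z := by
  classical
  let S := twistedCentralizer (galGL (AlgEquiv.refl : K ≃ₐ[K] K)) γ
  let A := lieCentralizer (AlgEquiv.refl : K ≃ₐ[K] K) γ
  have hr : (1 / 2 : ℝ) ∈ Set.Ioo (0 : ℝ) 1 := by constructor <;> norm_num
  have hSc : IsClosed (S : Set (GL (Fin n) K)) := by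
    have : (S : Set (GL (Fin n) K)) = {g | γ * g = g * γ} := by
      ext g; exact mem_twistedCentralizer_refl
    rw [this]
    exact isClosed_eq (continuous_const.mul continuous_id) (continuous_id.mul continuous_const)
  let U : Subgroup S := (congruenceSubgroup n K hr).subgroupOf S
  have hUo : IsOpen (U : Set S) :=
    (isOpen_congruenceSubgroup hr).preimage continuous_subtype_val
  have hUc : IsCompact (U : Set S) :=
    hSc.isClosedEmbedding_subtypeVal.isCompact_preimage (isCompact_congruenceSubgroup hr)
  have : LocallyCompactSpace S :=
    hUc.locallyCompactSpace_of_mem_nhds_of_group (hUo.mem_nhds U.one_mem)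
  have hUpos : IsOpen (U : Set S) ∧ (U : Set S).Nonempty := ⟨hUo, 1, U.one_mem⟩
  let φ : S ≃* S := MulAut.conj s
  have hφc : Continuous φ := (continuous_const.mul continuous_id).mul continuous_const
  have hφsc : Continuous φ.symm := (continuous_const.mul continuous_id).mul continuous_const
  -- `W` and its conjugate `φ(W)` are open subgroups of `U`
  let W : Subgroup S := U ⊓ U.comap φ.toMonoidHom
  let W' : Subgroup S := W.map φ.toMonoidHom
  have hWo : IsOpen (W : Set S) := hUo.inter (hUo.preimage hφc)
  have hW'W : (W' : Set S) = φ '' (W : Set S) := rfl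
  have hW'o : IsOpen (W' : Set S) := by
    rw [hW'W]
    exact (Homeomorph.mk φ.toEquiv hφc hφsc).isOpenMap _ hWo
  have hWU : W ≤ U := inf_le_left
  have hW'U : W' ≤ U := by
    rintro _ ⟨x, hx, rfl⟩
    exact hx.2
  -- compare with the additive Haar measure of the Lie algebra
  let _ : MeasurableSpace A := borel A
  have : BorelSpace A := ⟨rfl⟩
  have : LocallyCompactSpace (Matrix (Fin n) (Fin n) K) :=
    inferInstanceAs (LocallyCompactSpace (Fin n → Fin n → K))
  have : LocallyCompactSpace A :=
    (Submodule.closed_of_finiteDimensional A).isClosedEmbedding_subtypeVal.locallyCompactSpace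
  have : ContinuousConstSMul (Module.End K A)ˣ A :=
    ⟨fun u => LinearMap.continuous_of_finiteDimensional (u : Module.End K A)⟩
  let χ : (Module.End K A)ˣ →* ℝ≥0 := distribHaarChar A
  let α : Measure A := Measure.addHaar
  have hj := isOpenEmbedding_centralizerToLie γ
  let ν : Measure S := α.comap (centralizerToLie γ)
  have hν : ∀ Z : Set S, IsOpen Z → ν Z = α (centralizerToLie γ '' Z) := fun Z hZ =>
    hj.measurableEmbedding.comap_apply α Z
  have hνU : ν U ≠ 0 ∧ ν U ≠ ⊤ := by
    rw [hν _ hUo]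
    exact ⟨((hj.isOpenMap _ hUo).measure_pos α (hUpos.2.image _)).ne',
      (hUc.image hj.continuous).measure_lt_top.ne⟩
  have hL : ∀ (u : S) (Z : Set S), IsOpen Z → ν ((fun x => u * x) '' Z) =
      χ ((centralizerMulLeft γ).toHomUnits u) * ν Z := by
    intro u Z hZ
    have hZ' : IsOpen ((fun x => u * x) '' Z) := (Homeomorph.mulLeft u).isOpenMap _ hZ
    rw [hν Z hZ, hν _ hZ']
    refine (congrArg α ?_).trans
      (distribHaarChar_mul α ((centralizerMulLeft γ).toHomUnits u) (centralizerToLie γ '' Z)).symm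
    rw [Set.image_image, ← Set.image_smul, Set.image_image]
    rfl
  have hLU : ∀ u ∈ U, χ ((centralizerMulLeft γ).toHomUnits u) = 1 := by
    intro u hu
    have h1 := hL u U hUo
    have h2 : (fun x => u * x) '' (U : Set S) = U := by
      ext x
      constructor
      · rintro ⟨y, hy, rfl⟩
        exact U.mul_mem hu hy
      · intro hx
        exact ⟨u⁻¹ * x, U.mul_mem (U.inv_mem hu) hx, mul_inv_cancel_left _ _⟩
    rw [h2] at h1
    have h3 : (1 : ENNReal) * ν U = χ ((centralizerMulLeft γ).toHomUnits u) * ν U := by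
      rw [one_mul]; exact h1
    have h4 := (ENNReal.mul_left_inj hνU.1 hνU.2).1 h3
    exact_mod_cast h4.symm
  have hνinv : ∀ V : Subgroup S, IsOpen (V : Set S) → ∀ u ∈ U,
      ν ((fun x => u * x) '' (V : Set S)) = ν V := by
    intro V hV u hu
    rw [hL u V hV, hLU u hu, ENNReal.coe_one, one_mul]
  have hμinv : ∀ V : Subgroup S, ∀ u ∈ U, μ ((fun x => u * x) '' (V : Set S)) = μ V := by
    intro V u _
    rw [Set.image_mul_left, measure_preimage_mul]
  have hχ : χ ((centralizerConj γ).toHomUnits s) = 1 := by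
    have h1 := sq_map_centralizerConj_eq_one h2 hγ χ.toHomUnits s
    have h3 : χ ((centralizerConj γ).toHomUnits s) ^ 2 = 1 := by
      have := congrArg Units.val h1
      simpa using this
    exact (pow_eq_one_iff_of_nonneg zero_le two_ne_zero).1 h3
  have hνW : ν W' = ν W := by
    rw [hν _ hWo, hν _ hW'o, hW'W]
    have h1 := distribHaarChar_mul α ((centralizerConj γ).toHomUnits s) (centralizerToLie γ '' W)
    rw [show distribHaarChar A ((centralizerConj γ).toHomUnits s) = 1 from hχ, ENNReal.coe_one,
      one_mul] at h1
    rw [h1]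
    congr 1
    rw [Set.image_image, ← Set.image_smul, Set.image_image]
    refine Set.image_congr fun x _ => Subtype.ext ?_
    exact mul_assoc _ _ _
  obtain ⟨i, hi, hiW, hνi⟩ := measure_eq_relIndex_mul hUc hWo hWU ν (hνinv W hWo)
  obtain ⟨i', hi', hiW', hνi'⟩ := measure_eq_relIndex_mul hUc hW'o hW'U ν (hνinv W' hW'o)
  obtain ⟨k, _, hkW, hμi⟩ := measure_eq_relIndex_mul hUc hWo hWU μ (hμinv W)
  obtain ⟨k', _, hkW', hμi'⟩ := measure_eq_relIndex_mul hUc hW'o hW'U μ (hμinv W')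
  have hki : k = i := by exact_mod_cast hkW.symm.trans hiW
  have hki' : k' = i' := by exact_mod_cast hkW'.symm.trans hiW'
  subst hki hki'
  have hνW0 : ν W ≠ 0 := fun h => hνU.1 (by rw [hνi, h, mul_zero])
  have hνWtop : ν W ≠ ⊤ := ne_top_of_le_ne_top hνU.2 (measure_mono hWU)
  have hii : (k : ENNReal) = k' := by
    rw [hνi', hνW] at hνi
    exact ((ENNReal.mul_left_inj hνW0 hνWtop).1 hνi).symm
  have hμW : μ W' = μ W := by
    rw [hμi', ← hii] at hμi
    exact (ENNReal.mul_right_inj (by exact_mod_cast hi) (ENNReal.natCast_ne_top k)).1 hμi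
  have hW1 : (Measure.map (fun x => x * s) μ) W = μ W := by
    rw [Measure.map_apply (measurable_mul_const s) hWo.measurableSet, ← hμW, hW'W,
      ← measure_preimage_mul μ s (φ '' (W : Set S))]
    congr 1
    ext x
    constructor
    · intro hx
      exact ⟨x * s, hx, by simp [φ, mul_assoc]⟩
    · rintro ⟨y, hy, hyx⟩
      have : x * s = y := by
        have h1 : s * y * s⁻¹ = s * x := hyx
        rw [mul_assoc, mul_right_inj] at h1
        rw [← h1, inv_mul_cancel_right]
      exact Set.mem_preimage.2 (this ▸ hy)
  have huniq := fun Y hY =>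
    Measure.measure_isHaarMeasure_eq_smul_of_isOpen (Measure.map (fun x => x * s) μ) μ (s := Y) hY
  have hμW0 : μ W ≠ 0 := (hWo.measure_pos μ ⟨1, W.one_mem⟩).ne'
  have hμWtop : μ W ≠ ⊤ := ne_top_of_le_ne_top hUc.measure_lt_top.ne (measure_mono hWU)
  have hc := huniq W hWo
  rw [hW1] at hc
  have hc1 : Measure.haarScalarFactor (Measure.map (fun x => x * s) μ) μ = 1 := by
    have h3 : (1 : ENNReal) * μ W =
        Measure.haarScalarFactor (Measure.map (fun x => x * s) μ) μ * μ W := by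
      rw [one_mul]; exact hc
    exact_mod_cast ((ENNReal.mul_left_inj hμW0 hμWtop).1 h3).symm
  have := huniq Z hZ
  rw [hc1, one_smul, Measure.map_apply (measurable_mul_const s) hZ.measurableSet] at this
  exact this

end Unimodular

/-! ### Integration over quotients -/

section QuotientMeasure

variable {G : Type*} [Group G] [TopologicalSpace G] [IsTopologicalGroup G] {S : Subgroup G}

theorem isOpen_conj_preimage {C : Subgroup G} (hC : IsOpen (C : Set G)) (h : G) :
    IsOpen {s : S | h⁻¹ * (s : G) * h ∈ C} :=
  hC.preimage ((continuous_const.mul continuous_subtype_val).mul continuous_const)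

theorem isCompact_conj_preimage (hS : IsClosed (S : Set G)) {C : Subgroup G}
    (hC : IsCompact (C : Set G)) (h : G) : IsCompact {s : S | h⁻¹ * (s : G) * h ∈ C} := by
  have h1 : IsCompact ((fun g : G => h⁻¹ * g * h) ⁻¹' C) := by
    let e : G ≃ₜ G := (Homeomorph.mulLeft h⁻¹).trans (Homeomorph.mulRight h)
    exact e.isClosedEmbedding.isCompact_preimage hC
  exact hS.isClosedEmbedding_subtypeVal.isCompact_preimage h1

variable [MeasurableSpace G] [BorelSpace G]

/-- By Weil's formula, the image of the coset `h C` of an open compact subgroup `C` in `S \ G` has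
the volume `vol(C) / vol(S ∩ h C h⁻¹)`.  The formula is applied to the indicator function of `h C`,
whose average over `S` is an invariant function because `S` is unimodular. -/
theorem IsQuotientMeasure.measure_image_coset {dg : Measure G} [dg.IsMulLeftInvariant]
    {ds : Measure S}
    (hright : ∀ (s : S) (Z : Set S), IsOpen Z → ds ((fun x => x * s) ⁻¹' Z) = ds Z)
    {ν : Measure (Quotient (QuotientGroup.rightRel S))} (hν : IsQuotientMeasure S dg ds ν)
    {C : Subgroup G} (hC : IsOpen (C : Set G)) (h : G) :
    MeasurableSet ((Quotient.mk (QuotientGroup.rightRel S)) '' {g | h⁻¹ * g ∈ C}) ∧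
    ds {s : S | h⁻¹ * (s : G) * h ∈ C} *
      ν ((Quotient.mk (QuotientGroup.rightRel S)) '' {g | h⁻¹ * g ∈ C}) = dg C := by
  classical
  set D := (Quotient.mk (QuotientGroup.rightRel S)) '' {g | h⁻¹ * g ∈ C}
  have hcoset : IsOpen {g : G | h⁻¹ * g ∈ C} := hC.preimage (continuous_const_mul h⁻¹)
  have hmem : ∀ g : G, Quotient.mk (QuotientGroup.rightRel S) g ∈ D ↔
      ∃ s : S, h⁻¹ * ((s : G) * g) ∈ C := by
    intro g
    constructor
    · rintro ⟨g', hg', he⟩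
      have h1 : g * g'⁻¹ ∈ S := QuotientGroup.rightRel_apply.1 (Quotient.exact he)
      refine ⟨⟨(g * g'⁻¹)⁻¹, S.inv_mem h1⟩, ?_⟩
      have e : (g * g'⁻¹)⁻¹ * g = g' := by group
      change h⁻¹ * ((g * g'⁻¹)⁻¹ * g) ∈ C
      rw [e]
      exact hg'
    · rintro ⟨s, hs⟩
      refine ⟨s * g, hs, Quotient.sound (QuotientGroup.rightRel_apply.2 ?_)⟩
      rw [mul_inv_rev, mul_inv_cancel_left]
      exact S.inv_mem s.2
  have hD : MeasurableSet D := by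
    refine measurableSet_quotient.2 ?_
    have : (Quotient.mk'' ⁻¹' D : Set G) = ⋃ s : S, {g : G | h⁻¹ * ((s : G) * g) ∈ C} := by
      ext g
      rw [Set.mem_iUnion]
      exact hmem g
    rw [this]
    exact (isOpen_iUnion fun s : S =>
      hcoset.preimage (continuous_const_mul (s : G))).measurableSet
  refine ⟨hD, ?_⟩
  have key := hν ({g | h⁻¹ * g ∈ C}.indicator 1)
    (D.indicator fun _ => ds {s : S | h⁻¹ * (s : G) * h ∈ C})
    (measurable_one.indicator hcoset.measurableSet) ?_
  · rw [lintegral_indicator_one hcoset.measurableSet, lintegral_indicator_const hD] at key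
    rw [← key, ← measure_preimage_mul dg h⁻¹ C]
    rfl
  · intro g
    have hcg : IsOpen {s : S | h⁻¹ * ((s : G) * g) ∈ C} :=
      hcoset.preimage (continuous_subtype_val.mul continuous_const)
    have e1 : ∫⁻ s : S, ({g | h⁻¹ * g ∈ C} : Set G).indicator 1 ((s : G) * g) ∂ds =
        ds {s : S | h⁻¹ * ((s : G) * g) ∈ C} := by
      rw [← lintegral_indicator_one hcg.measurableSet]
      rfl
    rw [e1]
    by_cases hg : Quotient.mk (QuotientGroup.rightRel S) g ∈ D
    · rw [Set.indicator_of_mem hg]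
      obtain ⟨t, ht⟩ := (hmem g).1 hg
      -- `g = t⁻¹ h c` with `c` in `C`
      rw [← hright t⁻¹ _ (isOpen_conj_preimage hC h)]
      congr 1
      ext s
      simp only [Set.mem_preimage, Set.mem_ofPred_eq]
      have e2 : h⁻¹ * ((s : G) * g) = h⁻¹ * ((s * t⁻¹ : S) : G) * h * (h⁻¹ * ((t : G) * g)) := by
        simp only [Subgroup.coe_mul, Subgroup.coe_inv]
        group
      rw [e2, C.mul_mem_cancel_right ht]
    · rw [Set.indicator_of_notMem hg, eq_comm]
      have : {s : S | h⁻¹ * ((s : G) * g) ∈ C} = ∅ := by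
        ext s
        simp only [Set.mem_ofPred_eq, Set.mem_empty_iff_false, iff_false]
        exact fun hs => hg ((hmem g).2 ⟨s, hs⟩)
      rw [this, measure_empty]

/-- The integral over `S \ G` of the function `vol(C)⁻¹` on a finite disjoint union of double cosets
`S hᵢ C` is the sum of the numbers `vol(S ∩ hᵢ C hᵢ⁻¹)⁻¹`. -/
theorem IsQuotientMeasure.integral_doubleCosets (hS : IsClosed (S : Set G)) {dg : Measure G}
    [dg.IsHaarMeasure] {ds : Measure S} [ds.IsHaarMeasure]
    (hright : ∀ (s : S) (Z : Set S), IsOpen Z → ds ((fun x => x * s) ⁻¹' Z) = ds Z)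
    {ν : Measure (Quotient (QuotientGroup.rightRel S))} (hν : IsQuotientMeasure S dg ds ν)
    {C : Subgroup G} (hC : IsOpen (C : Set G)) (hCc : IsCompact (C : Set G))
    {ι : Type*} (T : Finset ι) (h : ι → G)
    (hdisj : ∀ i ∈ T, ∀ j ∈ T, ∀ s ∈ S, ∀ k ∈ C, h i = s * h j * k → i = j)
    {f : Quotient (QuotientGroup.rightRel S) → ℝ}
    (hf1 : ∀ i ∈ T, ∀ s ∈ S, ∀ k ∈ C, f (Quotient.mk _ (s * h i * k)) = (dg.real C)⁻¹)
    (hf0 : ∀ g, f (Quotient.mk _ g) ≠ 0 → ∃ i ∈ T, ∃ s ∈ S, ∃ k ∈ C, g = s * h i * k) :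
    Integrable f ν ∧
      ∫ q, f q ∂ν = ∑ i ∈ T, (ds.real {s : S | (h i)⁻¹ * (s : G) * h i ∈ C})⁻¹ := by
  classical
  let D : ι → Set (Quotient (QuotientGroup.rightRel S)) := fun i =>
    (Quotient.mk (QuotientGroup.rightRel S)) '' {g | (h i)⁻¹ * g ∈ C}
  have hpos : ∀ i, ds {s : S | (h i)⁻¹ * (s : G) * h i ∈ C} ≠ 0 := fun i =>
    ((isOpen_conj_preimage hC (h i)).measure_pos ds ⟨1, by simp [C.one_mem]⟩).ne'
  have htop : ∀ i, ds {s : S | (h i)⁻¹ * (s : G) * h i ∈ C} ≠ ⊤ := fun i =>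
    (isCompact_conj_preimage hS hCc (h i)).measure_lt_top.ne
  have hmeas : ∀ i, MeasurableSet (D i) := fun i => (hν.measure_image_coset hright hC (h i)).1
  have hvol : ∀ i, ds {s : S | (h i)⁻¹ * (s : G) * h i ∈ C} * ν (D i) = dg C := fun i =>
    (hν.measure_image_coset hright hC (h i)).2
  have hCpos : dg C ≠ 0 := (hC.measure_pos dg ⟨1, C.one_mem⟩).ne'
  have hCtop : dg C ≠ ⊤ := hCc.measure_lt_top.ne
  have hCreal : dg.real C ≠ 0 := (ENNReal.toReal_pos hCpos hCtop).ne'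
  have hDtop : ∀ i, ν (D i) ≠ ⊤ := by
    intro i hi
    have := hvol i
    rw [hi, ENNReal.mul_top (hpos i)] at this
    exact hCtop this.symm
  have hDmem : ∀ i g, Quotient.mk (QuotientGroup.rightRel S) g ∈ D i ↔
      ∃ s ∈ S, ∃ k ∈ C, g = s * h i * k := by
    intro i g
    constructor
    · rintro ⟨g', hg', he⟩
      have h1 : g * g'⁻¹ ∈ S := QuotientGroup.rightRel_apply.1 (Quotient.exact he)
      exact ⟨_, h1, _, hg', by group⟩
    · rintro ⟨s, hs, k, hk, rfl⟩
      refine ⟨h i * k, by simpa using hk, Quotient.sound (QuotientGroup.rightRel_apply.2 ?_)⟩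
      have : s * h i * k * (h i * k)⁻¹ = s := by group
      rw [this]
      exact hs
  have hfe : f = fun q => ∑ i ∈ T, (D i).indicator (fun _ => (dg.real C)⁻¹) q := by
    funext q
    induction q using Quotient.inductionOn with
    | h g =>
      by_cases hg : ∃ i ∈ T, Quotient.mk (QuotientGroup.rightRel S) g ∈ D i
      · obtain ⟨i, hiT, hi⟩ := hg
        obtain ⟨s, hs, k, hk, rfl⟩ := (hDmem i g).1 hi
        rw [hf1 i hiT s hs k hk, Finset.sum_eq_single_of_mem i hiT, Set.indicator_of_mem hi]
        intro j hj hji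
        refine Set.indicator_of_notMem (fun hmem => hji ?_) _
        obtain ⟨s', hs', k', hk', he⟩ := (hDmem j _).1 hmem
        refine (hdisj i hiT j hj (s⁻¹ * s') (S.mul_mem (S.inv_mem hs) hs') (k' * k⁻¹)
          (C.mul_mem hk' (C.inv_mem hk)) ?_).symm
        have : h i = s⁻¹ * (s * h i * k) * k⁻¹ := by group
        rw [this, he]
        group
      · have h0 : f (Quotient.mk (QuotientGroup.rightRel S) g) = 0 := by
          by_contra hne
          obtain ⟨i, hi, hex⟩ := hf0 g hne
          exact hg ⟨i, hi, (hDmem i g).2 hex⟩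
        rw [h0, eq_comm]
        exact Finset.sum_eq_zero fun i hi =>
          Set.indicator_of_notMem (fun hmem => hg ⟨i, hi, hmem⟩) _
  have hint : ∀ i ∈ T, Integrable ((D i).indicator fun _ => (dg.real C)⁻¹) ν := fun i _ =>
    (integrable_indicator_iff (hmeas i)).2 (integrableOn_const (hDtop i))
  rw [hfe]
  refine ⟨integrable_finsetSum _ hint, ?_⟩
  rw [integral_finsetSum _ hint]
  refine Finset.sum_congr rfl fun i _ => ?_
  rw [integral_indicator_const _ (hmeas i), smul_eq_mul]
  have h1 : ds.real {s : S | (h i)⁻¹ * (s : G) * h i ∈ C} * ν.real (D i) = dg.real C := by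
    rw [Measure.real, Measure.real, ← ENNReal.toReal_mul, hvol i, Measure.real]
  have h2 : ds.real {s : S | (h i)⁻¹ * (s : G) * h i ∈ C} ≠ 0 :=
    (ENNReal.toReal_pos (hpos i) (htop i)).ne'
  rw [← h1] at hCreal ⊢
  have h3 : ν.real (D i) ≠ 0 := right_ne_zero_of_mul hCreal
  field_simp

end QuotientMeasure

/-! ### Twisted centralizers of elements with a topologically unipotent root -/

section Transfer

open scoped Matrix.Norms.Elementwise

variable {n : ℕ}

/-- `θ` generates the Galois group of an extension `E / F` whose degree is prime to `p`, the residue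
characteristic; it is isometric. -/
structure IsTameGenerator {F E : Type*} [NormedField F] [NormedField E] [NormedAlgebra F E]
    (p : ℕ) (θ : E ≃ₐ[F] E) : Prop where
  mem_zpowers : ∀ σ : E ≃ₐ[F] E, σ ∈ Subgroup.zpowers θ
  orderOf_eq : orderOf θ = Module.finrank F E
  mem_range : ∀ x, θ x = x → x ∈ Set.range (algebraMap F E)
  norm_map : ∀ x, ‖θ x‖ = ‖x‖
  finrank_pos : 0 < Module.finrank F E
  pos : 0 < p
  coprime : p.Coprime (Module.finrank F E)
  norm_lt_one : ‖(p : E)‖ < 1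
  norm_finrank : ‖(Module.finrank F E : E)‖ = 1

/-- `γ` is the `[E : F]`-th power of a topologically unipotent `c`, and `x ⋊ 1` conjugates `δ ⋊ θ`
to `c ⋊ θ`. -/
structure IsTwistedRoot {F E : Type*} [NormedField F] [NormedField E] [NormedAlgebra F E]
    (p : ℕ) (θ : E ≃ₐ[F] E) (γ c : GL (Fin n) F) (δ x : GL (Fin n) E) : Prop where
  pow_eq : c ^ Module.finrank F E = γ
  unipotent : IsTopologicallyUnipotent p c
  conj_eq : x⁻¹ * δ * galGL θ x = inclGL F E c

theorem IsTameGenerator.pow_eq_one {F E : Type*} [NormedField F] [NormedField E] [NormedAlgebra F E]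
    {p : ℕ} {θ : E ≃ₐ[F] E} (hθ : IsTameGenerator p θ) : θ ^ Module.finrank F E = 1 := by
  rw [← hθ.orderOf_eq, pow_orderOf_eq_one]

variable {F E : Type*} [NontriviallyNormedField F] [NormedField E] [NormedAlgebra F E]

theorem IsTopologicallyUnipotent.inclGL {p : ℕ} {c : GL (Fin n) F}
    (hc : IsTopologicallyUnipotent p c) : IsTopologicallyUnipotent p (inclGL F E c) := by
  have := (continuous_inclGL (F := F) (E := E) (n := n)).tendsto 1
  rw [map_one] at this
  refine (this.comp hc).congr fun k => ?_
  exact map_pow (TwistedOrbital.inclGL F E) c _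

theorem isEmbedding_inclGL : IsEmbedding (inclGL F E : GL (Fin n) F →* GL (Fin n) E) := by
  have h1 : Isometry fun A : Matrix (Fin n) (Fin n) F => A.map (algebraMap F E) := by
    refine Isometry.of_dist_eq fun A B => ?_
    rw [dist_eq_norm, dist_eq_norm, ← Matrix.map_sub _ (map_sub (algebraMap F E))]
    exact Matrix.norm_map_eq _ _ fun a => norm_algebraMap' E a
  exact IsEmbedding.of_comp continuous_inclGL Units.continuous_val
    (h1.isEmbedding.comp isEmbedding_coe_generalLinearGroup)

theorem mem_lieCentralizer {θ : E ≃ₐ[F] E} {δ : GL (Fin n) E} {X : Matrix (Fin n) (Fin n) E} :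
    X ∈ lieCentralizer θ δ ↔
      (δ : Matrix (Fin n) (Fin n) E) * X.map θ = X * (δ : Matrix (Fin n) (Fin n) E) := by
  change (δ : Matrix (Fin n) (Fin n) E) * (X.map θ * ((δ⁻¹ : GL (Fin n) E) :
    Matrix (Fin n) (Fin n) E)) - X = 0 ↔ _
  rw [sub_eq_zero, ← mul_assoc]
  exact Units.mul_inv_eq_iff_eq_mul δ

theorem mem_twistedCentralizer {θ : E ≃ₐ[F] E} {δ g : GL (Fin n) E} :
    g ∈ twistedCentralizer (galGL θ) δ ↔ δ * galGL θ g = g * δ := by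
  change g⁻¹ * δ * galGL θ g = δ ↔ _
  rw [mul_assoc, inv_mul_eq_iff_eq_mul]

/-- The matrices which commute with `c ^ d` already commute with `c`, if `c` is topologically
`p`-unipotent and `p ∤ d`. -/
theorem IsTopologicallyUnipotent.mul_eq_mul_iff {p d : ℕ} {c : GL (Fin n) F}
    (hc : IsTopologicallyUnipotent p c) (hp0 : 0 < p) (hpd : p.Coprime d) (hd : 0 < d)
    {X : Matrix (Fin n) (Fin n) F} :
    ((c ^ d : GL (Fin n) F) : Matrix (Fin n) (Fin n) F) * X =
        X * ((c ^ d : GL (Fin n) F) : Matrix (Fin n) (Fin n) F) ↔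
      (c : Matrix (Fin n) (Fin n) F) * X = X * (c : Matrix (Fin n) (Fin n) F) := by
  constructor
  · intro h
    have hC : IsClosed {g : GL (Fin n) F | (g : Matrix (Fin n) (Fin n) F) * X =
        X * (g : Matrix (Fin n) (Fin n) F)} :=
      isClosed_eq (Units.continuous_val.mul continuous_const)
        (continuous_const.mul Units.continuous_val)
    have h1 : ((c⁻¹ : GL (Fin n) F) : Matrix (Fin n) (Fin n) F) * X =
        X * ((c⁻¹ : GL (Fin n) F) : Matrix (Fin n) (Fin n) F) := by
      refine hc.inv_mem_of_isClosed hp0 hpd hd hC fun a => ?_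
      have h2 : Commute ((c ^ d : GL (Fin n) F) : Matrix (Fin n) (Fin n) F) X := h
      have := (h2.pow_left a).eq
      rw [← Units.val_pow_eq_pow_val] at this
      exact this
    have h3 : SemiconjBy X ((c⁻¹ : GL (Fin n) F) : Matrix (Fin n) (Fin n) F)
      ((c⁻¹ : GL (Fin n) F) : Matrix (Fin n) (Fin n) F) := h1.symm
    have h4 := h3.units_inv_right
    rw [inv_inv] at h4
    exact h4.eq.symm
  · intro h
    have h2 : Commute (c : Matrix (Fin n) (Fin n) F) X := h
    rw [Units.val_pow_eq_pow_val]
    exact (h2.pow_left d).eq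

variable {p : ℕ} {θ : E ≃ₐ[F] E} {γ c : GL (Fin n) F} {δ x : GL (Fin n) E}

theorem map_map_algebraMap (θ : E ≃ₐ[F] E) (X : Matrix (Fin n) (Fin n) F) :
    (X.map (algebraMap F E)).map θ = X.map (algebraMap F E) := by
  ext i j
  exact θ.commutes _

namespace IsTwistedRoot

theorem eq_conj (h : IsTwistedRoot p θ γ c δ x) : δ = x * inclGL F E c * (galGL θ x)⁻¹ := by
  rw [← h.conj_eq]
  group

theorem mul_eq_mul_iff (h : IsTwistedRoot p θ γ c δ x) (hθ : IsTameGenerator p θ)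
    {X : Matrix (Fin n) (Fin n) F} :
    (γ : Matrix (Fin n) (Fin n) F) * X = X * (γ : Matrix (Fin n) (Fin n) F) ↔
      (c : Matrix (Fin n) (Fin n) F) * X = X * (c : Matrix (Fin n) (Fin n) F) := by
  rw [← h.pow_eq]
  exact h.unipotent.mul_eq_mul_iff hθ.pos hθ.coprime hθ.finrank_pos

/-- Conjugation by `x⁻¹` carries the twisted centralizer algebra of `δ` to the `X` with
`c θ(X) = X c`. -/
theorem conj_mem_lieCentralizer_iff (h : IsTwistedRoot p θ γ c δ x)
    {X : Matrix (Fin n) (Fin n) E} :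
    (x : Matrix (Fin n) (Fin n) E) * X * ((x⁻¹ : GL (Fin n) E) : Matrix (Fin n) (Fin n) E) ∈
        lieCentralizer θ δ ↔
      (inclGL F E c : Matrix (Fin n) (Fin n) E) * X.map θ =
        X * (inclGL F E c : Matrix (Fin n) (Fin n) E) := by
  have e : ((galGL θ x : GL (Fin n) E) : Matrix (Fin n) (Fin n) E) =
      (x : Matrix (Fin n) (Fin n) E).map θ := rfl
  have e' : (((galGL θ x)⁻¹ : GL (Fin n) E) : Matrix (Fin n) (Fin n) E) =
      ((x⁻¹ : GL (Fin n) E) : Matrix (Fin n) (Fin n) E).map θ := by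
    rw [← map_inv]; rfl
  have hmap : ((x : Matrix (Fin n) (Fin n) E) * X *
      ((x⁻¹ : GL (Fin n) E) : Matrix (Fin n) (Fin n) E)).map θ =
      ((galGL θ x : GL (Fin n) E) : Matrix (Fin n) (Fin n) E) * X.map θ *
        (((galGL θ x)⁻¹ : GL (Fin n) E) : Matrix (Fin n) (Fin n) E) := by
    rw [e, e', Matrix.map_mul (f := θ), Matrix.map_mul (f := θ)]
  rw [mem_lieCentralizer, hmap, h.eq_conj]
  simp only [Units.val_mul, mul_assoc, Units.inv_mul_cancel_left]
  rw [Units.mul_right_inj]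
  simp only [← mul_assoc]
  rw [Units.mul_left_inj]

theorem conj_mem_lieCentralizer (h : IsTwistedRoot p θ γ c δ x) (hθ : IsTameGenerator p θ)
    {X : Matrix (Fin n) (Fin n) F}
    (hX : (γ : Matrix (Fin n) (Fin n) F) * X = X * (γ : Matrix (Fin n) (Fin n) F)) :
    (x : Matrix (Fin n) (Fin n) E) * X.map (algebraMap F E) *
      ((x⁻¹ : GL (Fin n) E) : Matrix (Fin n) (Fin n) E) ∈ lieCentralizer θ δ := by
  rw [h.conj_mem_lieCentralizer_iff, map_map_algebraMap]
  have := congrArg (fun A => A.map (algebraMap F E)) ((h.mul_eq_mul_iff hθ).1 hX)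
  simp only [Matrix.map_mul] at this
  exact this

theorem exists_of_mem_lieCentralizer [IsUltrametricDist E] (h : IsTwistedRoot p θ γ c δ x)
    (hθ : IsTameGenerator p θ) {Y : Matrix (Fin n) (Fin n) E} (hY : Y ∈ lieCentralizer θ δ) :
    ∃ X : Matrix (Fin n) (Fin n) F,
      (γ : Matrix (Fin n) (Fin n) F) * X = X * (γ : Matrix (Fin n) (Fin n) F) ∧
      Y = (x : Matrix (Fin n) (Fin n) E) * X.map (algebraMap F E) *
        ((x⁻¹ : GL (Fin n) E) : Matrix (Fin n) (Fin n) E) := by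
  set X' := ((x⁻¹ : GL (Fin n) E) : Matrix (Fin n) (Fin n) E) * Y *
    (x : Matrix (Fin n) (Fin n) E) with hX'
  have hYX : Y = (x : Matrix (Fin n) (Fin n) E) * X' *
      ((x⁻¹ : GL (Fin n) E) : Matrix (Fin n) (Fin n) E) := by
    rw [hX']
    simp only [mul_assoc, Units.mul_inv, mul_one, Units.mul_inv_cancel_left]
  rw [hYX, h.conj_mem_lieCentralizer_iff] at hY
  have hfix := map_eq_of_intertwines hθ.pow_eq_one hθ.pos hθ.coprime hθ.finrank_pos
    h.unipotent.inclGL h.unipotent.inclGL (galGL_inclGL θ c) (galGL_inclGL θ c) hY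
  obtain ⟨X, hX⟩ := exists_map_algebraMap_eq hθ.mem_range hfix
  refine ⟨X, (h.mul_eq_mul_iff hθ).2 ?_, by rw [hX]; exact hYX⟩
  refine Matrix.map_injective (algebraMap F E).injective ?_
  rw [hfix] at hY
  simp only [Matrix.map_mul]
  rw [hX]
  exact hY

/-- Conjugation by `x` is an isomorphism between the Lie algebras of the centralizer of `γ` and of
the twisted centralizer of `δ`. -/
noncomputable def lieEquiv [IsUltrametricDist E] (h : IsTwistedRoot p θ γ c δ x)
    (hθ : IsTameGenerator p θ) :
    lieCentralizer (AlgEquiv.refl : F ≃ₐ[F] F) γ ≃ₗ[F] lieCentralizer θ δ :=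
  LinearEquiv.ofBijective
    { toFun := fun X => ⟨(x : Matrix (Fin n) (Fin n) E) *
          (X : Matrix (Fin n) (Fin n) F).map (algebraMap F E) *
          ((x⁻¹ : GL (Fin n) E) : Matrix (Fin n) (Fin n) E),
        h.conj_mem_lieCentralizer hθ (mem_lieCentralizer_refl.1 X.2)⟩
      map_add' := fun X Y => by
        ext1
        simp [Matrix.map_add, mul_add, add_mul]
      map_smul' := fun a X => by
        ext1
        have e : ((a • X : lieCentralizer (AlgEquiv.refl : F ≃ₐ[F] F) γ) :
            Matrix (Fin n) (Fin n) F).map (algebraMap F E) =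
            a • (X : Matrix (Fin n) (Fin n) F).map (algebraMap F E) := by
          ext i j
          change algebraMap F E (a * _) = a • algebraMap F E _
          rw [map_mul, Algebra.smul_def]
        simp only [RingHom.id_apply, Submodule.coe_smul]
        rw [← Submodule.coe_smul, e, Matrix.mul_smul, Matrix.smul_mul] }
    (by
      constructor
      · intro X Y hXY
        have h1 := congrArg Subtype.val hXY
        simp only [LinearMap.coe_mk, AddHom.coe_mk] at h1
        rw [Units.mul_left_inj, Units.mul_right_inj] at h1
        exact Subtype.ext (Matrix.map_injective (algebraMap F E).injective h1)
      · intro Y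
        obtain ⟨X, hX, hY⟩ := h.exists_of_mem_lieCentralizer hθ Y.2
        exact ⟨⟨X, mem_lieCentralizer_refl.2 hX⟩, Subtype.ext hY.symm⟩)

theorem coe_lieEquiv [IsUltrametricDist E] (h : IsTwistedRoot p θ γ c δ x)
    (hθ : IsTameGenerator p θ) (X : lieCentralizer (AlgEquiv.refl : F ≃ₐ[F] F) γ) :
    (h.lieEquiv hθ X : Matrix (Fin n) (Fin n) E) = (x : Matrix (Fin n) (Fin n) E) *
      (X : Matrix (Fin n) (Fin n) F).map (algebraMap F E) *
      ((x⁻¹ : GL (Fin n) E) : Matrix (Fin n) (Fin n) E) := rfl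

theorem mem_twistedCentralizer_iff [IsUltrametricDist E] (h : IsTwistedRoot p θ γ c δ x)
    (hθ : IsTameGenerator p θ) {s : GL (Fin n) E} : s ∈ twistedCentralizer (galGL θ) δ ↔
      ∃ t ∈ twistedCentralizer (galGL (AlgEquiv.refl : F ≃ₐ[F] F)) γ,
        s = x * inclGL F E t * x⁻¹ := by
  have hunits : ∀ s : GL (Fin n) E, s ∈ twistedCentralizer (galGL θ) δ ↔
      (s : Matrix (Fin n) (Fin n) E) ∈ lieCentralizer θ δ := by
    intro s
    rw [mem_twistedCentralizer, mem_lieCentralizer, Units.ext_iff]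
    rfl
  constructor
  · intro hs
    obtain ⟨X, hX, hsX⟩ := h.exists_of_mem_lieCentralizer hθ ((hunits s).1 hs)
    have hfix : galGL θ (x⁻¹ * s * x) = x⁻¹ * s * x := by
      refine Units.ext ?_
      have e : ((x⁻¹ * s * x : GL (Fin n) E) : Matrix (Fin n) (Fin n) E) =
          X.map (algebraMap F E) := by
        rw [Units.val_mul, Units.val_mul, hsX]
        simp only [mul_assoc, Units.inv_mul, mul_one, Units.inv_mul_cancel_left]
      rw [coe_galGL, e, map_map_algebraMap]
    obtain ⟨t, ht⟩ := exists_inclGL_eq hθ.mem_range hfix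
    have hst : s = x * inclGL F E t * x⁻¹ := by rw [ht]; group
    refine ⟨t, mem_twistedCentralizer_refl.2 (Units.ext ?_), hst⟩
    have h1 := (hunits s).1 hs
    rw [hst, Units.val_mul, Units.val_mul, h.conj_mem_lieCentralizer_iff] at h1
    refine (h.mul_eq_mul_iff hθ).2 (Matrix.map_injective (algebraMap F E).injective ?_)
    have h2 : ((inclGL F E t : GL (Fin n) E) : Matrix (Fin n) (Fin n) E) =
      (t : Matrix (Fin n) (Fin n) F).map (algebraMap F E) := rfl
    rw [h2, map_map_algebraMap] at h1
    simp only [Matrix.map_mul]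
    exact h1
  · rintro ⟨t, ht, rfl⟩
    rw [hunits, Units.val_mul, Units.val_mul]
    exact h.conj_mem_lieCentralizer hθ (congrArg Units.val (mem_twistedCentralizer_refl.1 ht))

/-- Conjugation by `x` is an isomorphism between the centralizer of `γ` and the twisted centralizer
of `δ`. -/
noncomputable def centralizerEquiv [IsUltrametricDist E] (h : IsTwistedRoot p θ γ c δ x)
    (hθ : IsTameGenerator p θ) :
    twistedCentralizer (galGL (AlgEquiv.refl : F ≃ₐ[F] F)) γ ≃* twistedCentralizer (galGL θ) δ :=
  MulEquiv.ofBijective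
    (MonoidHom.mk' (fun t => ⟨x * inclGL F E t * x⁻¹,
        (h.mem_twistedCentralizer_iff hθ).2 ⟨t, t.2, rfl⟩⟩) fun s t => by
      ext1
      simp only [Subgroup.coe_mul, map_mul]
      group)
    (by
      constructor
      · intro s t hst
        have h1 : x * inclGL F E s * x⁻¹ = x * inclGL F E t * x⁻¹ := congrArg Subtype.val hst
        exact Subtype.ext (inclGL_injective (mul_left_cancel (mul_right_cancel h1)))
      · intro s
        obtain ⟨t, ht, hs⟩ := (h.mem_twistedCentralizer_iff hθ).1 s.2
        exact ⟨⟨t, ht⟩, Subtype.ext hs.symm⟩)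

theorem coe_centralizerEquiv [IsUltrametricDist E] (h : IsTwistedRoot p θ γ c δ x)
    (hθ : IsTameGenerator p θ)
    (t : twistedCentralizer (galGL (AlgEquiv.refl : F ≃ₐ[F] F)) γ) :
    (h.centralizerEquiv hθ t : GL (Fin n) E) = x * inclGL F E t * x⁻¹ := rfl

theorem continuous_centralizerEquiv [IsUltrametricDist E] (h : IsTwistedRoot p θ γ c δ x)
    (hθ : IsTameGenerator p θ) : Continuous (h.centralizerEquiv hθ) :=
  ((continuous_const.mul (continuous_inclGL.comp continuous_subtype_val)).mul
    continuous_const).subtype_mk _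

theorem continuous_centralizerEquiv_symm [IsUltrametricDist E] (h : IsTwistedRoot p θ γ c δ x)
    (hθ : IsTameGenerator p θ) : Continuous (h.centralizerEquiv hθ).symm := by
  rw [IsEmbedding.subtypeVal.continuous_iff, (isEmbedding_inclGL (E := E)).continuous_iff]
  have : (fun s => inclGL F E (((h.centralizerEquiv hθ).symm s :
      twistedCentralizer (galGL (AlgEquiv.refl : F ≃ₐ[F] F)) γ) : GL (Fin n) F)) =
      fun s : twistedCentralizer (galGL θ) δ => x⁻¹ * (s : GL (Fin n) E) * x := by
    funext s
    obtain ⟨t, rfl⟩ := (h.centralizerEquiv hθ).surjective s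
    rw [MulEquiv.symm_apply_apply, coe_centralizerEquiv]
    group
  refine Eq.mpr (congrArg Continuous this) ?_
  exact (continuous_const.mul continuous_subtype_val).mul continuous_const

end IsTwistedRoot

end Transfer

/-! ### Compatible measures -/

namespace IsTwistedRoot

open scoped Matrix.Norms.Elementwise

variable {n : ℕ} {F E : Type*} [NontriviallyNormedField F] [NormedField E] [NormedAlgebra F E]
  [IsUltrametricDist E] [IsUltrametricDist F] [ProperSpace F]
  [MeasurableSpace (GL (Fin n) F)] [BorelSpace (GL (Fin n) F)]
  [MeasurableSpace (GL (Fin n) E)] [BorelSpace (GL (Fin n) E)]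
  {p : ℕ} {θ : E ≃ₐ[F] E} {γ c : GL (Fin n) F} {δ x : GL (Fin n) E}

/-- Compatible measures correspond to each other under conjugation by `x`. By uniqueness of the Haar
measure this has to be checked for one open set of finite nonzero volume only, and the definition of
compatibility provides it for the small boxes in coordinates that correspond under `x`. -/
theorem measure_eq_of_compatible (h : IsTwistedRoot p θ γ c δ x) (hθ : IsTameGenerator p θ)
    {dhγ : Measure (twistedCentralizer (galGL (AlgEquiv.refl : F ≃ₐ[F] F)) γ)} [dhγ.IsHaarMeasure]
    {dgδ : Measure (twistedCentralizer (galGL θ) δ)} [dgδ.IsHaarMeasure]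
    (hcomp : CompatibleMeasures θ γ δ dhγ dgδ)
    {Z : Set (twistedCentralizer (galGL θ) δ)} (hZ : IsOpen Z) :
    dgδ Z = dhγ (h.centralizerEquiv hθ ⁻¹' Z) := by
  classical
  let S := twistedCentralizer (galGL (AlgEquiv.refl : F ≃ₐ[F] F)) γ
  let A := lieCentralizer (AlgEquiv.refl : F ≃ₐ[F] F) γ
  let ψ := h.centralizerEquiv hθ
  have hr : (1 / 2 : ℝ) ∈ Set.Ioo (0 : ℝ) 1 := by constructor <;> norm_num
  have hSc : IsClosed (S : Set (GL (Fin n) F)) := by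
    have : (S : Set (GL (Fin n) F)) = {g | γ * g = g * γ} := by
      ext g; exact mem_twistedCentralizer_refl
    rw [this]
    exact isClosed_eq (continuous_const.mul continuous_id) (continuous_id.mul continuous_const)
  let U : Subgroup S := (congruenceSubgroup n F hr).subgroupOf S
  have hUo : IsOpen (U : Set S) :=
    (isOpen_congruenceSubgroup hr).preimage continuous_subtype_val
  have hUc : IsCompact (U : Set S) :=
    hSc.isClosedEmbedding_subtypeVal.isCompact_preimage (isCompact_congruenceSubgroup hr)
  have : LocallyCompactSpace S :=
    hUc.locallyCompactSpace_of_mem_nhds_of_group (hUo.mem_nhds U.one_mem)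
  have hψ : Continuous ψ := h.continuous_centralizerEquiv hθ
  have hψs : Continuous ψ.symm := h.continuous_centralizerEquiv_symm hθ
  let μ : Measure S := dgδ.map ψ.symm
  have : μ.IsHaarMeasure := ψ.symm.isHaarMeasure_map dgδ hψs hψ
  have hμ : ∀ Y : Set S, IsOpen Y → μ Y = dgδ (ψ.symm ⁻¹' Y) := fun Y hY =>
    Measure.map_apply hψs.measurable hY.measurableSet
  -- corresponding bases of the Lie algebras
  let b := Module.finBasis F A
  let a := b.map (h.lieEquiv hθ)
  have hnorm : x⁻¹ * normElement θ δ * x = inclGL F E γ := by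
    rw [← normElement_conj hθ.pow_eq_one, h.conj_eq, normElement_inclGL, h.pow_eq]
  have hbox := hcomp x hnorm _ b a 1 (fun j => by
    rw [Finset.sum_eq_single_of_mem j (Finset.mem_univ _)
      fun i _ hij => by rw [Matrix.one_apply_ne hij, zero_smul], Matrix.one_apply_eq, one_smul,
      Module.Basis.map_apply, coe_lieEquiv]
    simp only [mul_assoc, Units.inv_mul, mul_one, Units.inv_mul_cancel_left]) Matrix.det_one
  let box : ℝ → Set S := unitBox F _ (fun i => (b i : Matrix (Fin n) (Fin n) F))
  have hboxψ : ∀ ε, unitBox F _ (fun i => (a i : Matrix (Fin n) (Fin n) E)) ε =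
      ψ.symm ⁻¹' (box ε) := by
    intro ε
    ext s
    obtain ⟨t, rfl⟩ := ψ.surjective s
    rw [Set.mem_preimage, MulEquiv.symm_apply_apply]
    refine exists_congr fun u => and_congr_right fun _ => ?_
    have e1 : ((ψ t : GL (Fin n) E) : Matrix (Fin n) (Fin n) E) =
        (x : Matrix (Fin n) (Fin n) E) *
          ((t : GL (Fin n) F) : Matrix (Fin n) (Fin n) F).map (algebraMap F E) *
          ((x⁻¹ : GL (Fin n) E) : Matrix (Fin n) (Fin n) E) := rfl
    have e2 : (1 : Matrix (Fin n) (Fin n) E) + ∑ i, u i • (a i : Matrix (Fin n) (Fin n) E) =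
        (x : Matrix (Fin n) (Fin n) E) *
          ((1 : Matrix (Fin n) (Fin n) F) + ∑ i, u i • (b i : Matrix (Fin n) (Fin n) F)).map
            (algebraMap F E) *
          ((x⁻¹ : GL (Fin n) E) : Matrix (Fin n) (Fin n) E) := by
      have e3 : ∑ i, u i • (a i : Matrix (Fin n) (Fin n) E) =
          ((h.lieEquiv hθ (∑ i, u i • b i) : lieCentralizer θ δ) : Matrix (Fin n) (Fin n) E) := by
        simp only [map_sum, map_smul, Submodule.coe_sum, Submodule.coe_smul, a,
          Module.Basis.map_apply]
      rw [e3, coe_lieEquiv, Matrix.map_add _ (map_add (algebraMap F E)), mul_add, add_mul]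
      congr 1
      · rw [Matrix.map_one _ (map_zero _) (map_one _), mul_one, Units.mul_inv]
      · simp only [Submodule.coe_sum, Submodule.coe_smul]
    rw [e1, e2, Units.mul_left_inj, Units.mul_right_inj]
    exact (Matrix.map_injective (algebraMap F E).injective).eq_iff
  -- closed balls of nonzero radius are open in the ultrametric field `F`
  have hboxo : ∀ ε ≠ 0, IsOpen (box ε) := by
    intro ε hε
    have h1 : Continuous fun s : S => centralizerToLie γ s - centralizerToLie γ 1 :=
      (isOpenEmbedding_centralizerToLie γ).continuous.sub continuous_const
    have h2 : Continuous fun s : S => b.equivFun (centralizerToLie γ s - centralizerToLie γ 1) :=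
      (LinearMap.continuous_of_finiteDimensional b.equivFun.toLinearMap).comp h1
    have h3 : IsOpen {v : Fin (Module.finrank F A) → F | ∀ i, ‖v i‖ ≤ ε} := by
      have : {v : Fin (Module.finrank F A) → F | ∀ i, ‖v i‖ ≤ ε} =
          ⋂ i, (fun v => v i) ⁻¹' Metric.closedBall 0 ε := by
        ext v
        simp
      rw [this]
      exact isOpen_iInter_of_finite fun i =>
        (IsUltrametricDist.isOpen_closedBall (0 : F) hε).preimage (continuous_apply i)
    convert h3.preimage h2 using 1
    ext s
    constructor
    · rintro ⟨u, hu, hs⟩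
      have : b.equivFun (centralizerToLie γ s - centralizerToLie γ 1) = u := by
        rw [← LinearEquiv.eq_symm_apply, b.equivFun_symm_apply]
        refine Subtype.ext ?_
        simp only [Submodule.coe_sum, Submodule.coe_smul, Submodule.coe_sub]
        exact sub_eq_of_eq_add' hs
      rw [Set.mem_preimage, this]
      exact hu
    · intro hs
      refine ⟨_, hs, ?_⟩
      have := congrArg Subtype.val
        (b.sum_equivFun (centralizerToLie γ s - centralizerToLie γ 1))
      simp only [Submodule.coe_sum, Submodule.coe_smul, Submodule.coe_sub] at this
      rw [this]
      exact (add_sub_cancel _ _).symm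
  have hboxU : ∀ᶠ ε in 𝓝[>] (0 : ℝ), box ε ⊆ U := by
    have h1 : Tendsto (fun ε : ℝ => ε * ∑ i, ‖(b i : Matrix (Fin n) (Fin n) F)‖) (𝓝[>] 0)
        (𝓝 0) := by
      have : Tendsto (fun ε : ℝ => ε * ∑ i, ‖(b i : Matrix (Fin n) (Fin n) F)‖) (𝓝 0)
          (𝓝 (0 * ∑ i, ‖(b i : Matrix (Fin n) (Fin n) F)‖)) := tendsto_id.mul_const _
      rw [zero_mul] at this
      exact this.mono_left nhdsWithin_le_nhds
    filter_upwards [h1.eventually (gt_mem_nhds (show (0 : ℝ) < 1 / 2 by norm_num))] with ε hε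
    rintro s ⟨u, hu, hs⟩
    refine Subgroup.mem_subgroupOf.2 ((mem_congruenceSubgroup hr).2 ?_)
    rw [hs, add_sub_cancel_left]
    refine (norm_sum_le _ _).trans (le_trans ?_ hε.le)
    rw [Finset.mul_sum]
    refine Finset.sum_le_sum fun i _ => ?_
    rw [norm_smul]
    exact mul_le_mul_of_nonneg_right (hu i) (norm_nonneg _)
  -- the box is open and lies in the compact `U`, hence has finite nonzero volume
  obtain ⟨ε, hε1, hε2, hε0⟩ := (hbox.and (hboxU.and self_mem_nhdsWithin)).exists
  have hε0' : 0 < ε := hε0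
  have hopen := hboxo ε hε0'.ne'
  have hpos : dhγ (box ε) ≠ 0 := by
    refine (hopen.measure_pos dhγ ⟨1, 0, fun i => ?_, ?_⟩).ne'
    · simpa using hε0'.le
    · simp
  have htop : dhγ (box ε) ≠ ⊤ := ne_top_of_le_ne_top hUc.measure_lt_top.ne (measure_mono hε2)
  have hμbox : μ (box ε) = dhγ (box ε) := by
    rw [hμ _ hopen, ← hboxψ]
    exact hε1.symm
  have huniq := fun Y hY => Measure.measure_isHaarMeasure_eq_smul_of_isOpen μ dhγ (s := Y) hY
  have hc1 : Measure.haarScalarFactor μ dhγ = 1 := by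
    have h3 : (1 : ENNReal) * dhγ (box ε) = Measure.haarScalarFactor μ dhγ * dhγ (box ε) := by
      rw [one_mul]
      exact hμbox.symm.trans (huniq _ hopen)
    exact_mod_cast ((ENNReal.mul_left_inj hpos htop).1 h3).symm
  have hfin := huniq (ψ ⁻¹' Z) (hZ.preimage hψ)
  rw [hc1, one_smul, hμ _ (hZ.preimage hψ)] at hfin
  rw [← hfin]
  congr 1
  ext s
  simp

/-- If the centralizer of `γ` is unimodular, so is the twisted centralizer of `δ`. -/
theorem measure_preimage_mul_right (h : IsTwistedRoot p θ γ c δ x) (hθ : IsTameGenerator p θ)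
    (h2 : (2 : F) ≠ 0) [PerfectField F]
    (hγ : Module.End.IsSemisimple (Matrix.toLin' (γ : Matrix (Fin n) (Fin n) F)))
    {dhγ : Measure (twistedCentralizer (galGL (AlgEquiv.refl : F ≃ₐ[F] F)) γ)} [dhγ.IsHaarMeasure]
    {dgδ : Measure (twistedCentralizer (galGL θ) δ)} [dgδ.IsHaarMeasure]
    (hcomp : CompatibleMeasures θ γ δ dhγ dgδ) (s : twistedCentralizer (galGL θ) δ)
    {Z : Set (twistedCentralizer (galGL θ) δ)} (hZ : IsOpen Z) :
    dgδ ((fun y => y * s) ⁻¹' Z) = dgδ Z := by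
  rw [h.measure_eq_of_compatible hθ hcomp hZ,
    h.measure_eq_of_compatible hθ hcomp (hZ.preimage (continuous_mul_const s)),
    ← TwistedOrbital.measure_preimage_mul_right h2 hγ dhγ ((h.centralizerEquiv hθ).symm s)
      (hZ.preimage (h.continuous_centralizerEquiv hθ))]
  congr 1
  ext t
  simp

end IsTwistedRoot

/-! ### Determinants and normalizing factors -/

section Determinant

open scoped Matrix.Norms.Elementwise

/-- The determinant of `N` on `V / ker N` is the determinant of any endomorphism `N'` which `N`
induces through a surjective linear map with the same kernel as `N`. -/
theorem det_mapQ_ker_eq {F V V' : Type*} [Field F] [AddCommGroup V] [Module F V]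
    [AddCommGroup V'] [Module F V'] {N : V →ₗ[F] V} {N' : V' →ₗ[F] V'} {q : V →ₗ[F] V'}
    (hq : Function.Surjective q) (hN : ∀ v, q (N v) = N' (q v))
    (hker : ∀ v, q v = 0 ↔ N v = 0)
    (h : LinearMap.ker N ≤ (LinearMap.ker N).comap N) :
    LinearMap.det ((LinearMap.ker N).mapQ (LinearMap.ker N) N h) = LinearMap.det N' := by
  have hk : LinearMap.ker q = LinearMap.ker N := by
    ext v
    exact hker v
  let e : (V ⧸ LinearMap.ker N) ≃ₗ[F] V' :=
    (Submodule.quotEquivOfEq _ _ hk.symm).trans (q.quotKerEquivOfSurjective hq)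
  rw [← LinearMap.det_conj _ e]
  congr 1
  ext v
  obtain ⟨w, rfl⟩ := hq v
  have he : ∀ w, e (Submodule.Quotient.mk w) = q w := fun w => rfl
  have : e.symm (q w) = Submodule.Quotient.mk w := by
    rw [LinearEquiv.symm_apply_eq, he]
  simp only [LinearMap.comp_apply, LinearEquiv.coe_coe, this]
  exact hN w

/-- The determinant of an isometry has absolute value one, because the powers of the isometry and of
its inverse are bounded. -/
theorem norm_det_eq_one_of_norm_map {F V : Type*} [NontriviallyNormedField F] [CompleteSpace F]
    [NormedAddCommGroup V] [NormedSpace F V] [FiniteDimensional F V] {B : V →ₗ[F] V}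
    (hB : ∀ v, ‖B v‖ = ‖v‖) : ‖LinearMap.det B‖ = 1 := by
  classical
  have hinj : Function.Injective B := (injective_iff_map_eq_zero B).2 fun v hv => by
    rw [← norm_eq_zero, ← hB, hv, norm_zero]
  have key : ∀ B : V →ₗ[F] V, (∀ v, ‖B v‖ = ‖v‖) → ‖LinearMap.det B‖ ≤ 1 := by
    intro B hB
    let b := Module.finBasis F V
    have hpow : ∀ (k : ℕ) v, ‖(B ^ k) v‖ = ‖v‖ := by
      intro k
      induction k with
      | zero => intro v; rfl
      | succ k ih => intro v; rw [pow_succ, Module.End.mul_apply, ih, hB]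
    let φ : V →L[F] (Fin (Module.finrank F V) → F) :=
      LinearMap.toContinuousLinearMap b.equivFun.toLinearMap
    have hbd : ∀ k i j, NormedField.toAbsoluteValue F (LinearMap.toMatrix b b (B ^ k) i j) ≤
        ‖φ‖ * ∑ j, ‖b j‖ := by
      intro k i j
      rw [LinearMap.toMatrix_apply]
      refine (norm_le_pi_norm (φ ((B ^ k) (b j))) i).trans ((φ.le_opNorm _).trans ?_)
      rw [hpow]
      exact mul_le_mul_of_nonneg_left (Finset.single_le_sum (f := fun j => ‖b j‖)
        (fun _ _ => norm_nonneg _) (Finset.mem_univ j)) (norm_nonneg _)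
    by_contra! hlt
    obtain ⟨k, hk⟩ := pow_unbounded_of_one_lt
      ((Fintype.card (Fin (Module.finrank F V))).factorial •
        (‖φ‖ * ∑ j, ‖b j‖) ^ Fintype.card (Fin (Module.finrank F V))) hlt
    have h1 := Matrix.det_le (hbd k)
    rw [LinearMap.det_toMatrix, map_pow, map_pow] at h1
    exact absurd hk (not_lt.2 h1)
  let e : V ≃ₗ[F] V := LinearEquiv.ofInjectiveEndo B hinj
  have h1 := key B hB
  have h2 := key e.symm.toLinearMap fun v => by
    have : B (e.symm v) = v := e.apply_symm_apply v
    rw [← hB]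
    exact congrArg norm this
  have h3 : LinearMap.det e.symm.toLinearMap * LinearMap.det B = 1 := by
    rw [← LinearMap.det_comp]
    have : e.symm.toLinearMap ∘ₗ B = LinearMap.id := by
      ext v
      exact e.symm_apply_apply v
    rw [this, LinearMap.det_id]
  have h4 := congrArg norm h3
  rw [norm_mul, norm_one] at h4
  nlinarith [norm_nonneg (LinearMap.det B), norm_nonneg (LinearMap.det e.symm.toLinearMap)]

end Determinant

section NormalizingFactor

open scoped Matrix.Norms.Elementwise

variable {n : ℕ}

section Conjugation

variable {F L : Type*} [NormedField F] [NormedField L] [NormedAlgebra F L]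

theorem twistedAd_apply (σ : L ≃ₐ[F] L) (x : GL (Fin n) L) (X : Matrix (Fin n) (Fin n) L) :
    twistedAd σ x X = (x : Matrix (Fin n) (Fin n) L) *
      (X.map σ * ((x⁻¹ : GL (Fin n) L) : Matrix (Fin n) (Fin n) L)) := rfl

/-- The normalizing factor only depends on the twisted conjugacy class. -/
theorem normalizingFactor_conj (σ : L ≃ₐ[F] L) (x y : GL (Fin n) L) :
    normalizingFactor σ (x * y * (galGL σ x)⁻¹) = normalizingFactor σ y := by
  let N := twistedAd σ (x * y * (galGL σ x)⁻¹) - 1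
  let e : Matrix (Fin n) (Fin n) L →ₗ[F] Matrix (Fin n) (Fin n) L :=
    LinearMap.mulLeft F (x : Matrix (Fin n) (Fin n) L) ∘ₗ
      LinearMap.mulRight F ((x⁻¹ : GL (Fin n) L) : Matrix (Fin n) (Fin n) L)
  have he : ∀ X, e X = (x : Matrix (Fin n) (Fin n) L) * (X *
      ((x⁻¹ : GL (Fin n) L) : Matrix (Fin n) (Fin n) L)) := fun _ => rfl
  have hinj : ∀ X, e X = 0 ↔ X = 0 := by
    intro X
    rw [he, Units.mul_right_eq_zero, Units.mul_left_eq_zero]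
  have hsurj : Function.Surjective e := by
    intro X
    refine ⟨((x⁻¹ : GL (Fin n) L) : Matrix (Fin n) (Fin n) L) * X *
      (x : Matrix (Fin n) (Fin n) L), ?_⟩
    rw [he, mul_assoc, mul_assoc, Units.mul_inv, mul_one, Units.mul_inv_cancel_left]
  have hNe : ∀ X, N (e X) = e ((twistedAd σ y - 1) X) := by
    intro X
    have e1 : (e X).map σ = ((galGL σ x : GL (Fin n) L) : Matrix (Fin n) (Fin n) L) * (X.map σ *
        (((galGL σ x)⁻¹ : GL (Fin n) L) : Matrix (Fin n) (Fin n) L)) := by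
      have h1 : ((galGL σ x : GL (Fin n) L) : Matrix (Fin n) (Fin n) L) =
        (x : Matrix (Fin n) (Fin n) L).map σ := rfl
      have h2 : (((galGL σ x)⁻¹ : GL (Fin n) L) : Matrix (Fin n) (Fin n) L) =
          ((x⁻¹ : GL (Fin n) L) : Matrix (Fin n) (Fin n) L).map σ := by
        rw [← map_inv]; rfl
      rw [h1, h2, he, Matrix.map_mul (f := σ), Matrix.map_mul (f := σ)]
    simp only [N, LinearMap.sub_apply, Module.End.one_apply, map_sub]
    congr 1
    rw [twistedAd_apply, e1, twistedAd_apply, he]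
    simp only [mul_inv_rev, inv_inv, Units.val_mul, mul_assoc, Units.inv_mul_cancel_left]
  refine congrArg (fun a : F => ‖a‖) ?_
  refine (det_mapQ_ker_eq (q := (LinearMap.ker N).mkQ ∘ₗ e)
    ((Submodule.mkQ_surjective _).comp hsurj) (fun X => ?_) (fun X => ?_) _).symm
  · change (LinearMap.ker N).mkQ (e ((twistedAd σ y - 1) X)) = (LinearMap.ker N).mkQ (N (e X))
    rw [hNe]
  · rw [LinearMap.comp_apply, Submodule.mkQ_apply, Submodule.Quotient.mk_eq_zero,
      LinearMap.mem_ker, hNe, hinj]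

end Conjugation

end NormalizingFactor

/-! ### Comparison of the normalizing factors -/

section DescentOfNormalizingFactor

open scoped Matrix.Norms.Elementwise

variable {n : ℕ}

section Estimates

variable {L : Type*} [NormedField L] [IsUltrametricDist L]

theorem matrix_norm_add_eq_left {A B : Matrix (Fin n) (Fin n) L} (h : ‖B‖ < ‖A‖) :
    ‖A + B‖ = ‖A‖ := by
  refine le_antisymm ((matrix_norm_add_le_max A B).trans (max_le le_rfl h.le)) ?_
  have h1 := matrix_norm_sub_le_max (A + B) B
  rw [add_sub_cancel_right] at h1
  exact (le_max_iff.1 h1).resolve_right (not_le.2 h)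

variable {r : ℝ} {hr : r ∈ Set.Ioo (0 : ℝ) 1}

theorem norm_conj_sub_le {u : GL (Fin n) L} (hu : u ∈ congruenceSubgroup n L hr)
    (X : Matrix (Fin n) (Fin n) L) :
    ‖(u : Matrix (Fin n) (Fin n) L) * (X * ((u⁻¹ : GL (Fin n) L) : Matrix (Fin n) (Fin n) L)) - X‖ ≤
      r * ‖X‖ := by
  have hu' := (mem_congruenceSubgroup hr).1 ((congruenceSubgroup n L hr).inv_mem hu)
  have h1 := norm_le_one_of_norm_sub_one_le hr.2.le hu'
  have e : (u : Matrix (Fin n) (Fin n) L) *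
      (X * ((u⁻¹ : GL (Fin n) L) : Matrix (Fin n) (Fin n) L)) - X = ((u : Matrix (Fin n) (Fin n) L) - 1) *
        (X * ((u⁻¹ : GL (Fin n) L) : Matrix (Fin n) (Fin n) L)) +
        X * (((u⁻¹ : GL (Fin n) L) : Matrix (Fin n) (Fin n) L) - 1) := by noncomm_ring
  rw [e]
  refine (matrix_norm_add_le_max _ _).trans (max_le ?_ ?_)
  · refine (matrix_norm_mul_le _ _).trans (mul_le_mul hu ?_ (norm_nonneg _) hr.1.le)
    exact (matrix_norm_mul_le _ _).trans (mul_le_of_le_one_right (norm_nonneg _) h1)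
  · refine (matrix_norm_mul_le _ _).trans ?_
    rw [mul_comm]
    exact mul_le_mul_of_nonneg_right hu' (norm_nonneg _)

end Estimates

variable {F E : Type*} [NontriviallyNormedField F] [NormedField E] [NormedAlgebra F E]

theorem inclGL_mem_congruenceSubgroup_iff [IsUltrametricDist E] [IsUltrametricDist F]
    {r : ℝ} {hr : r ∈ Set.Ioo (0 : ℝ) 1} {u : GL (Fin n) F} :
    inclGL F E u ∈ congruenceSubgroup n E hr ↔ u ∈ congruenceSubgroup n F hr := by
  rw [mem_congruenceSubgroup, mem_congruenceSubgroup]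
  have e : ((inclGL F E u : GL (Fin n) E) : Matrix (Fin n) (Fin n) E) - 1 =
      ((u : Matrix (Fin n) (Fin n) F) - 1).map (algebraMap F E) := by
    rw [Matrix.map_sub _ (map_sub (algebraMap F E)),
      Matrix.map_one _ (map_zero _) (map_one _)]
    rfl
  rw [e, Matrix.norm_map_eq _ _ fun a => norm_algebraMap' E a]

variable [FiniteDimensional F E] [IsGalois F E] [IsUltrametricDist E]

/-- On matrices with entries of trace zero, `θ - 1` is an isometry: there
`d X` is the sum of the `X - σ(X)` with `σ` in the Galois group, and `θ(X) - X` is the largest of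
these. -/
theorem norm_map_sub_self_eq {p : ℕ} {θ : E ≃ₐ[F] E} (hθ : IsTameGenerator p θ)
    {X : Matrix (Fin n) (Fin n) E}
    (hX : X.map (Algebra.trace F E) = 0) : ‖X.map θ - X‖ = ‖X‖ := by
  refine le_antisymm ?_ ?_
  · refine (matrix_norm_sub_le_max _ _).trans (max_le ?_ le_rfl)
    rw [isometry_map hθ.norm_map]
  · have hpow : ∀ i : ℕ, ‖X.map (θ ^ i : E ≃ₐ[F] E) - X‖ ≤ ‖X.map θ - X‖ := by
      intro i
      induction i with
      | zero =>
        rw [show X.map (θ ^ 0 : E ≃ₐ[F] E) = X from rfl, sub_self, norm_zero]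
        exact norm_nonneg _
      | succ i ih =>
        have e : X.map (θ ^ (i + 1) : E ≃ₐ[F] E) - X =
            (X.map (θ ^ i : E ≃ₐ[F] E) - X).map θ + (X.map θ - X) := by
          rw [Matrix.map_sub _ (map_sub θ), pow_succ']
          exact (sub_add_sub_cancel _ _ _).symm
        rw [e]
        refine (matrix_norm_add_le_max _ _).trans (max_le ?_ le_rfl)
        rw [isometry_map hθ.norm_map]
        exact ih
    have hsum : (Module.finrank F E : E) • X = ∑ σ : E ≃ₐ[F] E, (X - X.map σ) := by
      rw [Finset.sum_sub_distrib, Finset.sum_const, Finset.card_univ, ← Nat.card_eq_fintype_card,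
        IsGalois.card_aut_eq_finrank]
      have : ∑ σ : E ≃ₐ[F] E, X.map σ = 0 := by
        ext i j
        rw [Matrix.sum_apply, Matrix.zero_apply]
        simp only [Matrix.map_apply]
        rw [← trace_eq_sum_automorphisms (K := F)]
        have := congrFun (congrFun hX i) j
        rw [Matrix.map_apply, Matrix.zero_apply] at this
        rw [this, map_zero]
      rw [this, sub_zero, Nat.cast_smul_eq_nsmul]
    have h1 : ‖(Module.finrank F E : E) • X‖ ≤ ‖X.map θ - X‖ := by
      rw [hsum]
      refine matrix_norm_sum_le _ _ (norm_nonneg _) fun σ _ => ?_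
      obtain ⟨i, rfl⟩ := mem_powers_iff_mem_zpowers.2 (hθ.mem_zpowers σ)
      rw [norm_sub_rev]
      exact hpow i
    rwa [norm_smul, hθ.norm_finrank, one_mul] at h1

variable [CompleteSpace F] [IsUltrametricDist F] {r : ℝ} {hr : r ∈ Set.Ioo (0 : ℝ) 1}

/-- The determinant of `Ad(u ⋊ θ) - 1` on `M_n(E) / ker` equals, up to units, the determinant of
`Ad(u) - 1` on `M_n(F) / ker`, since `Ad(u ⋊ θ) - 1` is an isometry on the complement of `M_n(F)`
of the matrices whose entries have trace zero. -/
theorem normalizingFactor_inclGL {p : ℕ} {θ : E ≃ₐ[F] E} (hθ : IsTameGenerator p θ)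
    {u : GL (Fin n) F} (hu : u ∈ congruenceSubgroup n F hr) (hup : IsTopologicallyUnipotent p u) :
    normalizingFactor θ (inclGL F E u) = normalizingFactor (AlgEquiv.refl : F ≃ₐ[F] F) u := by
  set d := Module.finrank F E
  have hdF : (d : F) ≠ 0 := by
    intro h
    have hdE := hθ.norm_finrank
    rw [← map_natCast (algebraMap F E), h, map_zero, norm_zero] at hdE
    exact zero_ne_one hdE
  let A := twistedAd (AlgEquiv.refl : F ≃ₐ[F] F) u
  let T := twistedAd θ (inclGL F E u)
  let W := LinearMap.ker (A - 1)
  let tr : Matrix (Fin n) (Fin n) E →ₗ[F] Matrix (Fin n) (Fin n) F :=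
    (Algebra.trace F E).mapMatrix
  let ι : Matrix (Fin n) (Fin n) F →ₗ[F] Matrix (Fin n) (Fin n) E :=
    (Algebra.linearMap F E).mapMatrix
  have htr : ∀ X, tr X = X.map (Algebra.trace F E) := fun _ => rfl
  have hι : ∀ Y, ι Y = Y.map (algebraMap F E) := fun _ => rfl
  have htrι : ∀ Y, tr (ι Y) = (d : F) • Y := by
    intro Y
    ext i j
    change Algebra.trace F E (algebraMap F E (Y i j)) = (d : F) * Y i j
    rw [Algebra.trace_algebraMap, nsmul_eq_mul]
  have hTι : ∀ Y, T (ι Y) = ι (A Y) := by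
    intro Y
    rw [hι, hι, twistedAd_apply, twistedAd_apply, map_map_algebraMap, Matrix.map_mul,
      Matrix.map_mul]
    rfl
  have htrT : ∀ X, tr (T X) = A (tr X) := by
    intro X
    have hl : ∀ (B : Matrix (Fin n) (Fin n) F) (X : Matrix (Fin n) (Fin n) E),
        tr (B.map (algebraMap F E) * X) = B * tr X := by
      intro B X
      ext i j
      change Algebra.trace F E (∑ k, algebraMap F E (B i k) * X k j) =
        ∑ k, B i k * Algebra.trace F E (X k j)
      simp only [map_sum, ← Algebra.smul_def, map_smul, smul_eq_mul]
    have hrt : ∀ (B : Matrix (Fin n) (Fin n) F) (X : Matrix (Fin n) (Fin n) E),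
        tr (X * B.map (algebraMap F E)) = tr X * B := by
      intro B X
      ext i j
      change Algebra.trace F E (∑ k, X i k * algebraMap F E (B k j)) =
        ∑ k, Algebra.trace F E (X i k) * B k j
      refine (map_sum _ _ _).trans (Finset.sum_congr rfl fun k _ => ?_)
      rw [mul_comm, ← Algebra.smul_def, map_smul, smul_eq_mul, mul_comm]
    have hθX : tr (X.map θ) = tr X := by
      ext i j
      exact Algebra.trace_eq_of_algEquiv θ (X i j)
    have h1 := hl (u : Matrix (Fin n) (Fin n) F) (X.map θ *
      ((u⁻¹ : GL (Fin n) F) : Matrix (Fin n) (Fin n) F).map (algebraMap F E))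
    rw [hrt, hθX] at h1
    exact h1
  let M₀ := LinearMap.ker tr
  have hM₀ : ∀ X ∈ M₀, (T - 1) X ∈ M₀ := by
    intro X hX
    rw [LinearMap.mem_ker] at hX ⊢
    rw [LinearMap.sub_apply, map_sub, htrT, hX, Module.End.one_apply, hX, map_zero, sub_zero]
  let N₀ : M₀ →ₗ[F] M₀ := (T - 1).restrict hM₀
  have hN₀ : ‖LinearMap.det N₀‖ = 1 := by
    refine norm_det_eq_one_of_norm_map fun X => ?_
    change ‖(T - 1) (X : Matrix (Fin n) (Fin n) E)‖ = ‖(X : Matrix (Fin n) (Fin n) E)‖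
    rcases eq_or_ne (X : Matrix (Fin n) (Fin n) E) 0 with h0 | h0
    · rw [h0, map_zero]
    · have h1 := norm_map_sub_self_eq hθ (X := (X : Matrix (Fin n) (Fin n) E)) X.2
      have h2 := norm_conj_sub_le ((inclGL_mem_congruenceSubgroup_iff (E := E)).2 hu)
        ((X : Matrix (Fin n) (Fin n) E).map θ)
      have e : (T - 1) (X : Matrix (Fin n) (Fin n) E) =
          ((X : Matrix (Fin n) (Fin n) E).map θ - (X : Matrix (Fin n) (Fin n) E)) +
          ((inclGL F E u : Matrix (Fin n) (Fin n) E) * ((X : Matrix (Fin n) (Fin n) E).map θ *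
            (((inclGL F E u)⁻¹ : GL (Fin n) E) : Matrix (Fin n) (Fin n) E)) -
            (X : Matrix (Fin n) (Fin n) E).map θ) := by
        rw [LinearMap.sub_apply, twistedAd_apply, Module.End.one_apply]
        abel
      rw [e, matrix_norm_add_eq_left, h1]
      refine h2.trans_lt ?_
      rw [isometry_map hθ.norm_map, h1]
      exact mul_lt_of_lt_one_left (norm_pos_iff.2 h0) hr.2
  have hWle : W ≤ W.comap (A - 1) := fun Y hY => by
    rw [Submodule.mem_comap, LinearMap.mem_ker.1 hY]
    exact W.zero_mem
  -- `X ↦ (tr X, d X - tr X)`, the decomposition of `M_n(E)` into `M_n(F)` and `M₀`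
  let q : Matrix (Fin n) (Fin n) E →ₗ[F] (Matrix (Fin n) (Fin n) F ⧸ W) × M₀ :=
    (W.mkQ ∘ₗ tr).prod (((d : F) • LinearMap.id - ι ∘ₗ tr).codRestrict M₀ fun X => by
      rw [LinearMap.mem_ker, LinearMap.sub_apply, map_sub, LinearMap.comp_apply, htrι,
        LinearMap.smul_apply, map_smul, LinearMap.id_apply, sub_self])
  have hq1 : ∀ X, (q X).1 = W.mkQ (tr X) := fun _ => rfl
  have hq2 : ∀ X, ((q X).2 : Matrix (Fin n) (Fin n) E) = (d : F) • X - ι (tr X) := fun _ => rfl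
  have hdet : LinearMap.det ((LinearMap.ker (T - 1)).mapQ (LinearMap.ker (T - 1)) (T - 1)
      (fun X hX => by
        rw [Submodule.mem_comap, LinearMap.mem_ker.1 hX]
        exact Submodule.zero_mem _)) = LinearMap.det ((W.mapQ W (A - 1) hWle).prodMap N₀) := by
    refine det_mapQ_ker_eq (q := q) ?_ ?_ ?_ _
    · rintro ⟨Y, Z⟩
      obtain ⟨Y, rfl⟩ := W.mkQ_surjective Y
      have hZ : tr (Z : Matrix (Fin n) (Fin n) E) = 0 := Z.2
      have ht : tr ((d : F)⁻¹ • (ι Y + Z)) = Y := by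
        rw [map_smul, map_add, hZ, add_zero, htrι, inv_smul_smul₀ hdF]
      refine ⟨(d : F)⁻¹ • (ι Y + Z), Prod.ext ?_ (Subtype.ext ?_)⟩
      · rw [hq1, ht]
      · rw [hq2, ht, smul_inv_smul₀ hdF, add_sub_cancel_left]
    · intro X
      refine Prod.ext ?_ (Subtype.ext ?_)
      · change W.mkQ (tr ((T - 1) X)) = W.mkQ ((A - 1) (tr X))
        rw [LinearMap.sub_apply, map_sub, htrT]
        rfl
      · change (d : F) • (T - 1) X - ι (tr ((T - 1) X)) = (T - 1) ((d : F) • X - ι (tr X))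
        simp only [LinearMap.sub_apply, Module.End.one_apply, map_sub, map_smul, htrT, hTι]
    · intro X
      constructor
      · intro h
        have h1 : tr X ∈ W := (Submodule.Quotient.mk_eq_zero W).1 (congrArg Prod.fst h)
        have h2 : (d : F) • X - ι (tr X) = 0 := congrArg Subtype.val (congrArg Prod.snd h)
        have h3 : (d : F) • (T - 1) X = 0 := by
          rw [← map_smul, sub_eq_zero.1 h2, LinearMap.sub_apply, hTι, Module.End.one_apply,
            ← map_sub]
          have : A (tr X) - tr X = 0 := h1
          rw [this, map_zero]
        exact (smul_eq_zero.1 h3).resolve_left hdF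
      · intro h
        have h1 : X ∈ lieCentralizer θ (inclGL F E u) := h
        rw [mem_lieCentralizer] at h1
        have hfix := map_eq_of_intertwines hθ.pow_eq_one hθ.pos hθ.coprime hθ.finrank_pos
          hup.inclGL hup.inclGL (galGL_inclGL θ u) (galGL_inclGL θ u) h1
        obtain ⟨Y, hY⟩ := exists_map_algebraMap_eq hθ.mem_range hfix
        have hXY : X = ι Y := hY.symm
        refine Prod.ext ?_ (Subtype.ext ?_)
        · refine (Submodule.Quotient.mk_eq_zero W).2 (LinearMap.mem_ker.2 ?_)
          rw [LinearMap.sub_apply, ← htrT]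
          have : T X - X = 0 := h
          rw [sub_eq_zero.1 this, Module.End.one_apply, sub_self]
        · change (d : F) • X - ι (tr X) = 0
          rw [hXY, htrι, map_smul, sub_self]
  calc normalizingFactor θ (inclGL F E u) =
        ‖LinearMap.det ((W.mapQ W (A - 1) hWle).prodMap N₀)‖ := congrArg norm hdet
    _ = ‖LinearMap.det (W.mapQ W (A - 1) hWle)‖ := by
      rw [LinearMap.det_prodMap, norm_mul, hN₀, mul_one]
    _ = normalizingFactor (AlgEquiv.refl : F ≃ₐ[F] F) u := rfl


end DescentOfNormalizingFactor

section Power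

open scoped Matrix.Norms.Elementwise

variable {n : ℕ} {F : Type*} [NontriviallyNormedField F]

theorem twistedAd_refl_pow (u : GL (Fin n) F) (i : ℕ) :
    twistedAd (AlgEquiv.refl : F ≃ₐ[F] F) (u ^ i) =
      twistedAd (AlgEquiv.refl : F ≃ₐ[F] F) u ^ i := by
  induction i with
  | zero =>
    refine LinearMap.ext fun X => ?_
    rw [pow_zero, pow_zero, twistedAd_apply, inv_one, Units.val_one, one_mul, mul_one]
    rfl
  | succ i ih =>
    rw [pow_succ', pow_succ', ← ih]
    refine LinearMap.ext fun X => ?_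
    rw [Module.End.mul_apply, twistedAd_apply, twistedAd_apply, twistedAd_apply, mul_inv_rev,
      Units.val_mul, Units.val_mul]
    simp only [AlgEquiv.coe_refl, Matrix.map_id, mul_assoc]

/-- `Ad(u) ^ d - 1` is the product of `Ad(u) - 1` and the isometry `∑ Ad(u) ^ i`, which is congruent
to the multiplication by the unit `d`. -/
theorem normalizingFactor_pow [CompleteSpace F] [IsUltrametricDist F]
    {r : ℝ} {hr : r ∈ Set.Ioo (0 : ℝ) 1} {p d : ℕ} (hp0 : 0 < p) (hpd : p.Coprime d) (hd : 0 < d)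
    (hdF : ‖(d : F)‖ = 1) {u : GL (Fin n) F}
    (hu : u ∈ congruenceSubgroup n F hr) (hup : IsTopologicallyUnipotent p u) :
    normalizingFactor (AlgEquiv.refl : F ≃ₐ[F] F) (u ^ d) =
      normalizingFactor (AlgEquiv.refl : F ≃ₐ[F] F) u := by
  let A := twistedAd (AlgEquiv.refl : F ≃ₐ[F] F) u
  let N := twistedAd (AlgEquiv.refl : F ≃ₐ[F] F) (u ^ d) - 1
  let W := LinearMap.ker (A - 1)
  let Φ : Matrix (Fin n) (Fin n) F →ₗ[F] Matrix (Fin n) (Fin n) F := ∑ i ∈ Finset.range d, A ^ i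
  have hNΦ : N = (A - 1) * Φ := by
    simp only [N, twistedAd_refl_pow]
    exact (mul_geom_sum A d).symm
  have hker : LinearMap.ker N = W := by
    ext X
    exact mem_lieCentralizer_refl.trans
      ((hup.mul_eq_mul_iff hp0 hpd hd).trans mem_lieCentralizer_refl.symm)
  have hAW : ∀ X ∈ W, A X = X := fun X hX => sub_eq_zero.1 hX
  have hΦW : ∀ X ∈ W, Φ X = (d : F) • X := by
    intro X hX
    have : ∀ i, (A ^ i) X = X := by
      intro i
      induction i with
      | zero => rfl
      | succ i ih => rw [pow_succ, Module.End.mul_apply, hAW X hX, ih]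
    rw [LinearMap.sum_apply, Finset.sum_congr rfl fun i _ => this i, Finset.sum_const,
      Finset.card_range, Nat.cast_smul_eq_nsmul]
  have hWle : W ≤ W.comap (A - 1) := fun Y hY => by
    rw [Submodule.mem_comap, LinearMap.mem_ker.1 hY]
    exact W.zero_mem
  have hWΦ : W ≤ W.comap Φ := fun Y hY => by
    rw [Submodule.mem_comap, hΦW Y hY]
    exact W.smul_mem _ hY
  have hΦ : ‖LinearMap.det Φ‖ = 1 := by
    refine norm_det_eq_one_of_norm_map fun X => ?_
    rcases eq_or_ne X 0 with rfl | h0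
    · rw [map_zero]
    have e : Φ X = (d : F) • X + ∑ i ∈ Finset.range d, ((A ^ i) X - X) := by
      rw [Finset.sum_sub_distrib, Finset.sum_const, Finset.card_range, LinearMap.sum_apply,
        Nat.cast_smul_eq_nsmul]
      abel
    have h1 : ‖(d : F) • X‖ = ‖X‖ := by rw [norm_smul, hdF, one_mul]
    rw [e, matrix_norm_add_eq_left, h1]
    rw [h1]
    refine (matrix_norm_sum_le _ _ (mul_nonneg hr.1.le (norm_nonneg X)) fun i _ => ?_).trans_lt
      (mul_lt_of_lt_one_left (norm_pos_iff.2 h0) hr.2)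
    have := norm_conj_sub_le ((congruenceSubgroup n F hr).pow_mem hu i) X
    rw [← twistedAd_refl_pow]
    exact this
  have hΦr : ‖LinearMap.det (Φ.restrict (p := W) (q := W) hWΦ)‖ = 1 := by
    have : Φ.restrict (p := W) (q := W) hWΦ = (d : F) • LinearMap.id := by
      ext1 X
      exact Subtype.ext (hΦW X X.2)
    rw [this, LinearMap.det_smul, LinearMap.det_id, mul_one, norm_pow, hdF, one_pow]
  have hΦq : ‖LinearMap.det (W.mapQ W Φ hWΦ)‖ = 1 := by
    have := congrArg norm (LinearMap.det_eq_det_mul_det W Φ hWΦ)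
    rwa [norm_mul, hΦ, hΦr, one_mul, eq_comm] at this
  have hdet : LinearMap.det ((LinearMap.ker N).mapQ (LinearMap.ker N) N
      (fun X hX => by
        rw [Submodule.mem_comap, LinearMap.mem_ker.1 hX]
        exact Submodule.zero_mem _)) =
      LinearMap.det (W.mapQ W (A - 1) hWle ∘ₗ W.mapQ W Φ hWΦ) := by
    refine det_mapQ_ker_eq (q := W.mkQ) W.mkQ_surjective (fun X => ?_) (fun X => ?_) _
    · rw [hNΦ]
      rfl
    · rw [Submodule.mkQ_apply, Submodule.Quotient.mk_eq_zero, ← hker, LinearMap.mem_ker]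
  calc normalizingFactor (AlgEquiv.refl : F ≃ₐ[F] F) (u ^ d) =
        ‖LinearMap.det (W.mapQ W (A - 1) hWle ∘ₗ W.mapQ W Φ hWΦ)‖ := congrArg norm hdet
    _ = ‖LinearMap.det (W.mapQ W (A - 1) hWle)‖ := by
      rw [LinearMap.det_comp, norm_mul, hΦq, mul_one]
    _ = normalizingFactor (AlgEquiv.refl : F ≃ₐ[F] F) u := rfl

end Power

/-! ### Orbit functions of congruence subgroups -/

section OrbitFunction

variable {G : Type*} [Group G] {τ : G →* G} {δ : G}

theorem conj_mem_iff {C : Subgroup G} (hτ : ∀ k ∈ C, τ k ∈ C) {s g k : G}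
    (hs : s ∈ twistedCentralizer τ δ) (hk : k ∈ C) :
    (s * g * k)⁻¹ * δ * τ (s * g * k) ∈ C ↔ g⁻¹ * δ * τ g ∈ C := by
  have hs' : s⁻¹ * δ * τ s = δ := hs
  have e : (s * g * k)⁻¹ * δ * τ (s * g * k) = k⁻¹ * (g⁻¹ * δ * τ g) * τ k := by
    conv_rhs => rw [← hs']
    simp only [map_mul]
    group
  rw [e, C.mul_mem_cancel_right (hτ k hk), C.mul_mem_cancel_left (C.inv_mem hk)]

variable [MeasurableSpace G]

theorem orbitFunction_mk (μ : Measure G) (C : Subgroup G) (g : G) :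
    orbitFunction τ δ (normalizedIndicator μ C) (Quotient.mk _ g) =
      (C : Set G).indicator (fun _ => (μ.real C)⁻¹) (g⁻¹ * δ * τ g) := rfl

theorem orbitFunction_eq_zero {μ : Measure G} {C : Subgroup G}
    (h : ∀ g, g⁻¹ * δ * τ g ∉ C) : orbitFunction τ δ (normalizedIndicator μ C) = 0 := by
  funext q
  induction q using Quotient.inductionOn with
  | h g =>
    rw [orbitFunction_mk, Set.indicator_of_notMem (h g)]
    rfl

variable [TopologicalSpace G] [IsTopologicalGroup G] [BorelSpace G]

/-- The orbital integral of the normalized indicator function of an open compact subgroup `C`, as a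
sum over the double cosets `S hᵢ C` of the `g` with `g⁻¹ δ τ(g) ∈ C`. -/
theorem integral_orbitFunction {dg : Measure G} [dg.IsHaarMeasure]
    {ds : Measure (twistedCentralizer τ δ)} [ds.IsHaarMeasure]
    (hS : IsClosed (twistedCentralizer τ δ : Set G))
    (hright : ∀ (s : twistedCentralizer τ δ) (Z : Set (twistedCentralizer τ δ)), IsOpen Z →
      ds ((fun x => x * s) ⁻¹' Z) = ds Z)
    {ν : Measure (Quotient (QuotientGroup.rightRel (twistedCentralizer τ δ)))}
    (hν : IsQuotientMeasure _ dg ds ν)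
    {C : Subgroup G} (hC : IsOpen (C : Set G)) (hCc : IsCompact (C : Set G))
    (hτ : ∀ k ∈ C, τ k ∈ C) {ι : Type*} (T : Finset ι) (h : ι → G)
    (hdisj : ∀ i ∈ T, ∀ j ∈ T, ∀ s ∈ twistedCentralizer τ δ, ∀ k ∈ C, h i = s * h j * k → i = j)
    (hmem : ∀ i ∈ T, (h i)⁻¹ * δ * τ (h i) ∈ C)
    (hcov : ∀ g, g⁻¹ * δ * τ g ∈ C →
      ∃ i ∈ T, ∃ s ∈ twistedCentralizer τ δ, ∃ k ∈ C, g = s * h i * k) :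
    Integrable (orbitFunction τ δ (normalizedIndicator dg C)) ν ∧
      ∫ q, orbitFunction τ δ (normalizedIndicator dg C) q ∂ν =
        ∑ i ∈ T, (ds.real {s : twistedCentralizer τ δ | (h i)⁻¹ * (s : G) * h i ∈ C})⁻¹ := by
  refine hν.integral_doubleCosets hS hright hC hCc T h hdisj (fun i hi s hs k hk => ?_)
    fun g hg => hcov g ?_
  · rw [orbitFunction_mk, Set.indicator_of_mem]
    exact (conj_mem_iff hτ hs hk).2 (hmem i hi)
  · rw [orbitFunction_mk] at hg
    exact Set.mem_of_indicator_ne_zero hg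

end OrbitFunction

section Comparison

open scoped Matrix.Norms.Elementwise

variable {n : ℕ}

theorem galGL_refl {K : Type*} [NormedField K] (g : GL (Fin n) K) :
    galGL (AlgEquiv.refl : K ≃ₐ[K] K) g = g := rfl

theorem isClosed_twistedCentralizer {F E : Type*} [NormedField F] [NormedField E]
    [NormedAlgebra F E] {σ : E ≃ₐ[F] E} (hσ : Continuous σ) (δ : GL (Fin n) E) :
    IsClosed (twistedCentralizer (galGL σ) δ : Set (GL (Fin n) E)) :=
  isClosed_eq ((continuous_inv.mul continuous_const).mul (continuous_galGL hσ)) continuous_const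

theorem galGL_mem_congruenceSubgroup {F E : Type*} [NormedField F] [NormedField E]
    [NormedAlgebra F E] [IsUltrametricDist E] {θ : E ≃ₐ[F] E} (hiso : ∀ x, ‖θ x‖ = ‖x‖)
    {r : ℝ} {hr : r ∈ Set.Ioo (0 : ℝ) 1} {g : GL (Fin n) E} (hg : g ∈ congruenceSubgroup n E hr) :
    galGL θ g ∈ congruenceSubgroup n E hr := by
  rw [mem_congruenceSubgroup] at hg ⊢
  rw [← isometry_map hiso] at hg
  have e : ((g : Matrix (Fin n) (Fin n) E) - 1).map θ =
      ((galGL θ g : GL (Fin n) E) : Matrix (Fin n) (Fin n) E) - 1 := by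
    rw [Matrix.map_sub _ (map_sub θ), Matrix.map_one _ (map_zero _) (map_one _)]
    rfl
  rwa [e] at hg

variable {F E : Type*} [NontriviallyNormedField F] [NormedField E] [NormedAlgebra F E]
  {p : ℕ} {θ : E ≃ₐ[F] E} {r : ℝ} {hr : r ∈ Set.Ioo (0 : ℝ) 1} {γ : GL (Fin n) F}

theorem IsTameGenerator.norm_lt_one' (hθ : IsTameGenerator p θ) : ‖(p : F)‖ < 1 := by
  rw [← norm_algebraMap' E, map_natCast]
  exact hθ.norm_lt_one

theorem IsTameGenerator.norm_finrank' (hθ : IsTameGenerator p θ) :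
    ‖(Module.finrank F E : F)‖ = 1 := by
  rw [← norm_algebraMap' E, map_natCast]
  exact hθ.norm_finrank

variable [IsUltrametricDist F] [IsUltrametricDist E]

theorem isTopologicallyUnipotent_of_mem {L : Type*} [NormedField L] [IsUltrametricDist L]
    (hp : ‖(p : L)‖ < 1) {g : GL (Fin n) L} (hg : g ∈ congruenceSubgroup n L hr) :
    IsTopologicallyUnipotent p g :=
  tendsto_pow_prime_pow hr hp hg

/-- The normalizing factors of `γ` and of `δ` agree. -/
theorem IsTwistedRoot.normalizingFactor_eq [CompleteSpace F] [FiniteDimensional F E] [IsGalois F E]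
    {c : GL (Fin n) F} {δ x : GL (Fin n) E} (h : IsTwistedRoot p θ γ c δ x) (hθ : IsTameGenerator p θ)
    {h₀ u : GL (Fin n) F}
    (hu : u ∈ congruenceSubgroup n F hr) (hc : c = h₀ * u * h₀⁻¹) :
    normalizingFactor θ δ = normalizingFactor (AlgEquiv.refl : F ≃ₐ[F] F) γ := by
  have hup := isTopologicallyUnipotent_of_mem hθ.norm_lt_one' hu
  have hγ : γ = h₀ * u ^ Module.finrank F E *
      (galGL (AlgEquiv.refl : F ≃ₐ[F] F) h₀)⁻¹ := by
    rw [← h.pow_eq, hc, conj_pow, galGL_refl]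
  have hδ : δ = x * inclGL F E h₀ * inclGL F E u * (galGL θ (x * inclGL F E h₀))⁻¹ := by
    rw [h.eq_conj, hc]
    simp only [map_mul, map_inv, galGL_inclGL]
    group
  rw [hδ, hγ, normalizingFactor_conj, normalizingFactor_conj, normalizingFactor_inclGL hθ hu hup,
    normalizingFactor_pow hθ.pos hθ.coprime hθ.finrank_pos hθ.norm_finrank' hu hup]

variable [ProperSpace E]

/-- Every element of `K_E` is `θ`-conjugate under `K_E` to an element of `K_F`. -/
theorem IsTameGenerator.exists_conj_eq_inclGL (hθ : IsTameGenerator p θ) {g : GL (Fin n) E}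
    (hg : g ∈ congruenceSubgroup n E hr) : ∃ k ∈ congruenceSubgroup n E hr,
      ∃ u ∈ congruenceSubgroup n F hr, k⁻¹ * g * galGL θ k = inclGL F E u := by
  obtain ⟨k, hk, hmem, hfix⟩ := exists_conj_fixed hθ.norm_lt_one hθ.norm_map hθ.pow_eq_one hθ.pos
    hθ.coprime hθ.finrank_pos hθ.norm_finrank hr hg
  obtain ⟨u, hu⟩ := exists_inclGL_eq hθ.mem_range hfix
  refine ⟨k, hk, u, ?_, hu.symm⟩
  rw [← hu] at hmem
  exact inclGL_mem_congruenceSubgroup_iff.1 hmem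

variable [ProperSpace F]

/-- If `γ` is conjugate to an element of `K_F`, then it is the `d`-th power of a topologically
unipotent element. -/
theorem exists_isTopologicallyUnipotent_pow_eq (hp : ‖(p : F)‖ < 1) {d : ℕ} (hp0 : 0 < p)
    (hpd : p.Coprime d) (hd : 0 < d) {h₀ : GL (Fin n) F}
    (h : h₀⁻¹ * γ * h₀ ∈ congruenceSubgroup n F hr) :
    ∃ u ∈ congruenceSubgroup n F hr, (h₀ * u * h₀⁻¹) ^ d = γ := by
  obtain ⟨u, hu, hud⟩ := (isTopologicallyUnipotent_of_mem hp h).exists_pow_eq hp0 hpd hd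
    (isCompact_congruenceSubgroup hr) h
  refine ⟨u, hu, ?_⟩
  rw [conj_pow, hud]
  group

namespace IsTwistedRoot

variable {c : GL (Fin n) F} {δ x : GL (Fin n) E}

/-- The elements of `GL_n(E)` that carry `δ` into `K_E` are the products of `x`, an element
of `GL_n(F)` that carries `γ` into `K_F`, and an element of `K_E`. -/
theorem conj_mem_congruenceSubgroup_iff (h : IsTwistedRoot p θ γ c δ x) (hθ : IsTameGenerator p θ)
    {g : GL (Fin n) E} : g⁻¹ * δ * galGL θ g ∈ congruenceSubgroup n E hr ↔
      ∃ g₀, g₀⁻¹ * γ * g₀ ∈ congruenceSubgroup n F hr ∧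
        ∃ k ∈ congruenceSubgroup n E hr, g = x * inclGL F E g₀ * k := by
  have hδ := h.eq_conj
  constructor
  · intro hg
    obtain ⟨k, hk, u, hu, hku⟩ := hθ.exists_conj_eq_inclGL hg
    have huU := isTopologicallyUnipotent_of_mem hθ.norm_lt_one' hu
    have hY : inclGL F E c * galGL θ (x⁻¹ * g * k) = x⁻¹ * g * k * inclGL F E u := by
      rw [← hku, hδ]
      simp only [map_mul, map_inv]
      group
    have hfix := map_eq_of_intertwines hθ.pow_eq_one hθ.pos hθ.coprime hθ.finrank_pos
      h.unipotent.inclGL huU.inclGL (galGL_inclGL θ c) (galGL_inclGL θ u) (congrArg Units.val hY)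
    obtain ⟨g₀, hg₀⟩ := exists_inclGL_eq hθ.mem_range
      (show galGL θ (x⁻¹ * g * k) = x⁻¹ * g * k from Units.ext hfix)
    refine ⟨g₀, ?_, k⁻¹, (congruenceSubgroup n E hr).inv_mem hk, ?_⟩
    · rw [← hg₀, galGL_inclGL, ← map_mul, ← map_mul] at hY
      have hcu : c * g₀ = g₀ * u := inclGL_injective hY
      have : g₀⁻¹ * γ * g₀ = u ^ Module.finrank F E := by
        have e : u = g₀⁻¹ * c * g₀⁻¹⁻¹ := by rw [inv_inv, mul_assoc, hcu]; group
        rw [e, conj_pow, h.pow_eq, inv_inv]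
      rw [this]
      exact Subgroup.pow_mem _ hu _
    · rw [hg₀]
      group
  · rintro ⟨g₀, hg₀, k, hk, rfl⟩
    have hc : g₀⁻¹ * c * g₀ ∈ congruenceSubgroup n F hr := by
      have hU : IsTopologicallyUnipotent p (g₀⁻¹ * c * g₀) := by
        have := h.unipotent.conj g₀⁻¹
        rwa [inv_inv] at this
      rw [← Subgroup.inv_mem_iff]
      refine hU.inv_mem_of_isClosed hθ.pos hθ.coprime hθ.finrank_pos
        (isCompact_congruenceSubgroup hr).isClosed fun a => Subgroup.pow_mem _ ?_ a
      have e : (g₀⁻¹ * c * g₀) ^ Module.finrank F E = g₀⁻¹ * γ * g₀ := by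
        have := conj_pow (i := Module.finrank F E) (a := g₀⁻¹) (b := c)
        rw [inv_inv] at this
        rw [this, h.pow_eq]
      rw [e]
      exact hg₀
    have e : (x * inclGL F E g₀ * k)⁻¹ * δ * galGL θ (x * inclGL F E g₀ * k) =
        k⁻¹ * inclGL F E (g₀⁻¹ * c * g₀) * galGL θ k := by
      rw [hδ]
      simp only [map_mul, map_inv, galGL_inclGL]
      group
    rw [e]
    exact Subgroup.mul_mem _ (Subgroup.mul_mem _ (Subgroup.inv_mem _ hk)
      (inclGL_mem_congruenceSubgroup_iff.2 hc)) (galGL_mem_congruenceSubgroup hθ.norm_map hk)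

end IsTwistedRoot

end Comparison

/-! ### Matching of the orbital integrals -/

section Norms

variable {n : ℕ} {F E : Type*} [NontriviallyNormedField F] [IsUltrametricDist F]
  [NormedField E] [NormedAlgebra F E] [FiniteDimensional F E] {p : ℕ} {θ : E ≃ₐ[F] E}
  {r : ℝ} {hr : r ∈ Set.Ioo (0 : ℝ) 1} {γ : GL (Fin n) F}

/-- If `γ` is conjugate to an element of `K_F`, then it is a norm. -/
theorem exists_isNormOf [ProperSpace F] [PerfectField F] (hθ : IsTameGenerator p θ)
    (hγ : Module.End.IsSemisimple (Matrix.toLin' (γ : Matrix (Fin n) (Fin n) F)))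
    {h₀ : GL (Fin n) F} (h : h₀⁻¹ * γ * h₀ ∈ congruenceSubgroup n F hr) :
    ∃ δ : GL (Fin n) E, IsNormOf θ γ δ := by
  obtain ⟨u, hu, huγ⟩ := exists_isTopologicallyUnipotent_pow_eq hθ.norm_lt_one' hθ.pos hθ.coprime
    hθ.finrank_pos h
  have hc := (isTopologicallyUnipotent_of_mem hθ.norm_lt_one' hu).conj h₀
  rw [← huγ] at hγ ⊢
  exact ⟨_, isNormOf_inclGL θ (isSemisimple_of_pow hθ.pos hθ.coprime hθ.finrank_pos hc hγ)⟩

/-- If `γ` is a norm of `δ`, and `δ` is `θ`-conjugate to an element of `K_E`, then `γ` is conjugate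
to an element of `K_F`. -/
theorem IsNormOf.exists_conj_mem [IsUltrametricDist E] [ProperSpace E]
    (hθ : IsTameGenerator p θ) {δ : GL (Fin n) E}
    (hδ : IsNormOf θ γ δ) {g : GL (Fin n) E}
    (hg : g⁻¹ * δ * galGL θ g ∈ congruenceSubgroup n E hr) :
    ∃ h₀ : GL (Fin n) F, h₀⁻¹ * γ * h₀ ∈ congruenceSubgroup n F hr := by
  have : Infinite F := NontriviallyNormedField.infinite F
  have : Infinite E := Infinite.of_injective _ (algebraMap F E).injective
  obtain ⟨x₀, hx₀⟩ := hδ.exists_conj_normElement hθ.orderOf_eq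
  obtain ⟨k, hk, u, hu, hku⟩ := hθ.exists_conj_eq_inclGL hg
  have h1 : (g * k)⁻¹ * normElement θ δ * (g * k) = inclGL F E (u ^ Module.finrank F E) := by
    rw [← normElement_inclGL θ, ← hku, ← normElement_conj hθ.pow_eq_one]
    congr 1
    simp only [map_mul]
    group
  have h2 : inclGL F E γ * (x₀⁻¹ * (g * k)) =
      x₀⁻¹ * (g * k) * inclGL F E (u ^ Module.finrank F E) := by
    rw [← hx₀, ← h1]
    group
  obtain ⟨Y, hY⟩ := exists_similar_of_similar_extension (K := F) (x₀⁻¹ * (g * k))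
    (A := (γ : Matrix (Fin n) (Fin n) F))
    (B := ((u ^ Module.finrank F E : GL (Fin n) F) : Matrix (Fin n) (Fin n) F))
    (congrArg Units.val h2)
  refine ⟨Y, ?_⟩
  have hY' : γ * Y = Y * u ^ Module.finrank F E := Units.ext hY
  rw [mul_assoc, hY', inv_mul_cancel_left]
  exact Subgroup.pow_mem _ hu _

end Norms

section OrbitalIntegrals

open scoped Matrix.Norms.Elementwise

variable {n : ℕ} {F : Type*} [NontriviallyNormedField F] [IsUltrametricDist F] [ProperSpace F]
  [PerfectField F] {r : ℝ} {hr : r ∈ Set.Ioo (0 : ℝ) 1} {γ : GL (Fin n) F}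

/-- Representatives `hᵢ` of the finitely many double cosets `S_γ h K_F` with `h⁻¹ γ h` in `K_F`. -/
theorem exists_doubleCoset_representatives
    (hγ : Module.End.IsSemisimple (Matrix.toLin' (γ : Matrix (Fin n) (Fin n) F)))
    (hr : r ∈ Set.Ioo (0 : ℝ) 1) :
    ∃ T : Finset (GL (Fin n) F),
      (∀ h ∈ T, h⁻¹ * γ * h ∈ congruenceSubgroup n F hr) ∧
      (∀ h ∈ T, ∀ h' ∈ T, ∀ s ∈ twistedCentralizer (galGL (AlgEquiv.refl : F ≃ₐ[F] F)) γ,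
        ∀ k ∈ congruenceSubgroup n F hr, h = s * h' * k → h = h') ∧
      (∀ g, g⁻¹ * γ * g ∈ congruenceSubgroup n F hr → ∃ h ∈ T,
        ∃ s ∈ twistedCentralizer (galGL (AlgEquiv.refl : F ≃ₐ[F] F)) γ,
        ∃ k ∈ congruenceSubgroup n F hr, g = s * h * k) := by
  classical
  let S := twistedCentralizer (galGL (AlgEquiv.refl : F ≃ₐ[F] F)) γ
  let K := congruenceSubgroup n F hr
  have hfin := finite_doubleCosets hγ hr
  refine ⟨hfin.toFinset.image Quotient.out, ?_, ?_, ?_⟩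
  · intro h hh
    obtain ⟨q, hq, rfl⟩ := Finset.mem_image.1 hh
    obtain ⟨g, hg, rfl⟩ := (Set.Finite.mem_toFinset _).1 hq
    obtain ⟨s, k, hs, hk, he⟩ := DoubleCoset.mk_out_eq_mul S K g
    change (Quotient.out (DoubleCoset.mk S K g))⁻¹ * γ * Quotient.out (DoubleCoset.mk S K g) ∈ K
    rw [he]
    exact (conj_mem_iff (τ := galGL (AlgEquiv.refl : F ≃ₐ[F] F)) (fun _ h => h) hs hk).2 hg
  · intro h hh h' hh' s hs k hk he
    obtain ⟨q, hq, rfl⟩ := Finset.mem_image.1 hh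
    obtain ⟨q', hq', rfl⟩ := Finset.mem_image.1 hh'
    have h1 := (DoubleCoset.eq S K _ _).2 ⟨s, hs, k, hk, he⟩
    exact congrArg Quotient.out ((DoubleCoset.out_eq' S K q).symm.trans
      (h1.symm.trans (DoubleCoset.out_eq' S K q')))
  · intro g hg
    refine ⟨_, Finset.mem_image_of_mem _ ((Set.Finite.mem_toFinset _).2 ⟨g, hg, rfl⟩), ?_⟩
    obtain ⟨s, hs, k, hk, he⟩ :=
      (DoubleCoset.eq S K _ _).1 (DoubleCoset.out_eq' S K (DoubleCoset.mk S K g))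
    exact ⟨s, hs, k, hk, he⟩

variable [MeasurableSpace (GL (Fin n) F)] [BorelSpace (GL (Fin n) F)]
  {dh : Measure (GL (Fin n) F)} [dh.IsHaarMeasure]
  {dhγ : Measure (twistedCentralizer (galGL (AlgEquiv.refl : F ≃ₐ[F] F)) γ)} [dhγ.IsHaarMeasure]
  {νγ : Measure (Quotient (QuotientGroup.rightRel
      (twistedCentralizer (galGL (AlgEquiv.refl : F ≃ₐ[F] F)) γ)))}

theorem integral_orbitFunction_refl (h2 : (2 : F) ≠ 0)
    (hγ : Module.End.IsSemisimple (Matrix.toLin' (γ : Matrix (Fin n) (Fin n) F)))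
    (hν : IsQuotientMeasure _ dh dhγ νγ) {T : Finset (GL (Fin n) F)}
    (hmem : ∀ h ∈ T, h⁻¹ * γ * h ∈ congruenceSubgroup n F hr)
    (hdisj : ∀ h ∈ T, ∀ h' ∈ T, ∀ s ∈ twistedCentralizer (galGL (AlgEquiv.refl : F ≃ₐ[F] F)) γ,
      ∀ k ∈ congruenceSubgroup n F hr, h = s * h' * k → h = h')
    (hcov : ∀ g, g⁻¹ * γ * g ∈ congruenceSubgroup n F hr → ∃ h ∈ T,
      ∃ s ∈ twistedCentralizer (galGL (AlgEquiv.refl : F ≃ₐ[F] F)) γ,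
      ∃ k ∈ congruenceSubgroup n F hr, g = s * h * k) :
    Integrable (orbitFunction (galGL (AlgEquiv.refl : F ≃ₐ[F] F)) γ
        (normalizedIndicator dh (congruenceSubgroup n F hr))) νγ ∧
      ∫ q, orbitFunction (galGL (AlgEquiv.refl : F ≃ₐ[F] F)) γ
        (normalizedIndicator dh (congruenceSubgroup n F hr)) q ∂νγ =
      ∑ h ∈ T, (dhγ.real {s | h⁻¹ * (s : GL (Fin n) F) * h ∈ congruenceSubgroup n F hr})⁻¹ :=
  integral_orbitFunction (isClosed_twistedCentralizer continuous_id γ)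
    (fun s _ hZ => measure_preimage_mul_right h2 hγ dhγ s hZ) hν (isOpen_congruenceSubgroup hr)
    (isCompact_congruenceSubgroup hr) (fun _ h => h) T id hdisj hmem hcov

variable {E : Type*} [NormedField E] [NormedAlgebra F E] [IsUltrametricDist E] [ProperSpace E]
  [FiniteDimensional F E] {p : ℕ} {θ : E ≃ₐ[F] E}

variable [IsGalois F E] [MeasurableSpace (GL (Fin n) E)] [BorelSpace (GL (Fin n) E)]
  {dg : Measure (GL (Fin n) E)} [dg.IsHaarMeasure] {δ : GL (Fin n) E}
  {dgδ : Measure (twistedCentralizer (galGL θ) δ)} [dgδ.IsHaarMeasure]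
  {νδ : Measure (Quotient (QuotientGroup.rightRel (twistedCentralizer (galGL θ) δ)))}

/-- The matching of orbital integrals. If `γ` is conjugate to an element of `K_F`, then `δ ⋊ θ` is
conjugate to `c ⋊ θ` for a topologically unipotent root `c` of `γ`, and both integrals are the sums
of the same volumes over corresponding double cosets; otherwise both of them vanish. -/
theorem IsNormOf.integral_eq (hθ : IsTameGenerator p θ) (h2 : (2 : F) ≠ 0)
    (hγ : Module.End.IsSemisimple (Matrix.toLin' (γ : Matrix (Fin n) (Fin n) F)))
    (hδ : IsNormOf θ γ δ) (hνγ : IsQuotientMeasure _ dh dhγ νγ)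
    (hcomp : CompatibleMeasures θ γ δ dhγ dgδ) (hνδ : IsQuotientMeasure _ dg dgδ νδ) :
    Integrable (orbitFunction (galGL θ) δ
        (normalizedIndicator dg (congruenceSubgroup n E hr))) νδ ∧
      normalizedOrbitalIntegral (AlgEquiv.refl : F ≃ₐ[F] F) γ
        (normalizedIndicator dh (congruenceSubgroup n F hr)) νγ =
      normalizedOrbitalIntegral θ δ (normalizedIndicator dg (congruenceSubgroup n E hr)) νδ := by
  classical
  have : Infinite F := NontriviallyNormedField.infinite F
  have : Infinite E := Infinite.of_injective _ (algebraMap F E).injective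
  by_cases hex : ∃ h₀ : GL (Fin n) F, h₀⁻¹ * γ * h₀ ∈ congruenceSubgroup n F hr
  · obtain ⟨h₀, hh₀⟩ := hex
    obtain ⟨u, hu, huγ⟩ := exists_isTopologicallyUnipotent_pow_eq hθ.norm_lt_one' hθ.pos hθ.coprime
      hθ.finrank_pos hh₀
    obtain ⟨x₀, hx₀⟩ := hδ.exists_conj_normElement hθ.orderOf_eq
    rw [← huγ] at hx₀
    obtain ⟨x, hx⟩ := exists_twisted_conj hθ.orderOf_eq hx₀
    have h : IsTwistedRoot p θ γ (h₀ * u * h₀⁻¹) δ x :=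
      ⟨huγ, (isTopologicallyUnipotent_of_mem hθ.norm_lt_one' hu).conj h₀, hx⟩
    have hcont : Continuous θ := (AddMonoidHomClass.isometry_of_norm θ hθ.norm_map).continuous
    obtain ⟨T, hmem, hdisj, hcov⟩ := exists_doubleCoset_representatives hγ hr
    have hF := integral_orbitFunction_refl h2 hγ hνγ hmem hdisj hcov
    have hE := integral_orbitFunction (isClosed_twistedCentralizer hcont δ)
      (fun s _ hZ => h.measure_preimage_mul_right hθ h2 hγ hcomp s hZ) hνδ
      (isOpen_congruenceSubgroup hr) (isCompact_congruenceSubgroup hr)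
      (fun _ hk => galGL_mem_congruenceSubgroup hθ.norm_map hk) T (fun i => x * inclGL F E i)
      ?_ ?_ ?_
    · refine ⟨hE.1, ?_⟩
      rw [normalizedOrbitalIntegral, normalizedOrbitalIntegral, hF.2, hE.2,
        h.normalizingFactor_eq hθ hu rfl]
      congr 1
      refine Finset.sum_congr rfl fun i _ => ?_
      rw [Measure.real, Measure.real, h.measure_eq_of_compatible hθ hcomp
        (isOpen_conj_preimage (isOpen_congruenceSubgroup hr) (x * inclGL F E i))]
      congr 3
      ext t
      simp only [Set.mem_preimage, Set.mem_ofPred_eq, h.coe_centralizerEquiv hθ]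
      rw [← inclGL_mem_congruenceSubgroup_iff (E := E)]
      simp only [map_mul, map_inv, mul_inv_rev, mul_assoc, inv_mul_cancel_left]
    -- distinct double cosets for `γ` go to distinct double cosets for `δ`
    · intro i hi j hj s hs k hk he
      obtain ⟨t, ht, rfl⟩ := (h.mem_twistedCentralizer_iff hθ).1 hs
      have hk' : k = inclGL F E ((t * j)⁻¹ * i) := by
        have : inclGL F E i = inclGL F E t * inclGL F E j * k := by
          refine mul_left_cancel (he.trans ?_)
          group
        rw [map_mul, map_inv, this, map_mul]
        group
      refine hdisj i hi j hj t ht ((t * j)⁻¹ * i) ?_ (by group)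
      rw [hk'] at hk
      exact inclGL_mem_congruenceSubgroup_iff.1 hk
    · intro i hi
      exact (h.conj_mem_congruenceSubgroup_iff hθ).2
        ⟨i, hmem i hi, 1, Subgroup.one_mem _, (mul_one _).symm⟩
    · intro g hg
      obtain ⟨g₀, hg₀, k, hk, rfl⟩ := (h.conj_mem_congruenceSubgroup_iff hθ).1 hg
      obtain ⟨i, hi, t, ht, k₀, hk₀, rfl⟩ := hcov g₀ hg₀
      refine ⟨i, hi, _, (h.mem_twistedCentralizer_iff hθ).2 ⟨t, ht, rfl⟩, inclGL F E k₀ * k,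
        Subgroup.mul_mem _ (inclGL_mem_congruenceSubgroup_iff.2 hk₀) hk, ?_⟩
      simp only [map_mul]
      group
  · have h1 : orbitFunction (galGL (AlgEquiv.refl : F ≃ₐ[F] F)) γ
        (normalizedIndicator dh (congruenceSubgroup n F hr)) = 0 :=
      orbitFunction_eq_zero fun g hg => hex ⟨g, hg⟩
    have h3 : orbitFunction (galGL θ) δ
        (normalizedIndicator dg (congruenceSubgroup n E hr)) = 0 :=
      orbitFunction_eq_zero fun g hg => hex (hδ.exists_conj_mem hθ hg)
    rw [normalizedOrbitalIntegral, normalizedOrbitalIntegral, h1, h3]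
    refine ⟨integrable_zero _ _ _, ?_⟩
    simp only [Pi.zero_apply, integral_zero, mul_zero]

end OrbitalIntegrals

/-! ### Local fields -/

section LocalFields

/-- The equality makes it possible to substitute the new instance for the given one everywhere. -/
theorem exists_nontriviallyNormedField_eq {F : Type*} [inst : NormedField F]
    (h : ∃ x : F, x ≠ 0 ∧ ‖x‖ ≠ 1) :
    ∃ inst' : NontriviallyNormedField F, inst'.toNormedField = inst :=
  ⟨NontriviallyNormedField.ofNormNeOne h, rfl⟩

/-- A real number all of whose powers are bounded by a constant is at most one. -/
theorem le_one_of_pow_le {a C : ℝ} (h : ∀ k : ℕ, a ^ k ≤ C) : a ≤ 1 := by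
  by_contra! h1
  obtain ⟨k, hk⟩ := pow_unbounded_of_one_lt C h1
  exact absurd hk (not_lt.2 (h k))

theorem norm_prime_lt_one (p : ℕ) [Fact p.Prime] (F : Type*) [NormedField F]
    [Algebra ℚ_[p] F]
    [ContinuousSMul ℚ_[p] F] : ‖(p : F)‖ < 1 := by
  have h1 : Tendsto (fun k : ℕ => (p : ℚ_[p]) ^ k) atTop (𝓝 0) :=
    tendsto_pow_atTop_nhds_zero_of_norm_lt_one Padic.norm_p_lt_one
  have h2 := ((continuous_algebraMap ℚ_[p] F).tendsto 0).comp h1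
  rw [map_zero] at h2
  have h3 : Tendsto (fun k : ℕ => (p : F) ^ k) atTop (𝓝 0) := by
    refine h2.congr fun k => ?_
    simp
  by_contra! h
  have h4 := (tendsto_zero_iff_norm_tendsto_zero.1 h3)
  have h5 : (1 : ℝ) ≤ 0 := ge_of_tendsto h4 (Eventually.of_forall fun k => by
    rw [norm_pow]
    exact one_le_pow₀ h)
  exact absurd h5 (by norm_num)

/-- The absolute value of `F` is ultrametric, since the image of the compact `ℤ_p` is bounded. -/
theorem isUltrametricDist_of_padic_algebra (p : ℕ) [Fact p.Prime] (F : Type*) [NormedField F]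
    [Algebra ℚ_[p] F] [ContinuousSMul ℚ_[p] F] : IsUltrametricDist F := by
  obtain ⟨C, hC⟩ := ((isCompact_closedBall (0 : ℚ_[p]) 1).image
    (continuous_algebraMap ℚ_[p] F)).isBounded.exists_norm_le
  refine IsUltrametricDist.isUltrametricDist_of_forall_norm_natCast_le_one fun k => ?_
  refine le_one_of_pow_le (C := C) fun i => ?_
  rw [← norm_pow]
  refine hC _ ⟨(k : ℚ_[p]) ^ i, ?_, by simp⟩
  rw [mem_closedBall_zero_iff, norm_pow]
  exact pow_le_one₀ (norm_nonneg _) (IsUltrametricDist.norm_natCast_le_one ℚ_[p] k)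

theorem charZero_of_padic_algebra (p : ℕ) [Fact p.Prime] (F : Type*) [NormedField F]
    [Algebra ℚ_[p] F] : CharZero F :=
  charZero_of_injective_algebraMap (algebraMap ℚ_[p] F).injective

theorem properSpace_of_padic_algebra (p : ℕ) [Fact p.Prime] (F : Type*) [NontriviallyNormedField F]
    [Algebra ℚ_[p] F] [ContinuousSMul ℚ_[p] F] [FiniteDimensional ℚ_[p] F] : ProperSpace F := by
  have e : F ≃L[ℚ_[p]] (Fin (Module.finrank ℚ_[p] F) → ℚ_[p]) :=
    (Module.finBasis ℚ_[p] F).equivFun.toContinuousLinearEquiv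
  have : LocallyCompactSpace F := e.toHomeomorph.isClosedEmbedding.locallyCompactSpace
  exact ProperSpace.of_locallyCompactSpace F

/-- An automorphism of a finite extension of a complete field is an isometry. -/
theorem norm_algEquiv_apply {F E : Type*} [NontriviallyNormedField F] [CompleteSpace F]
    [NormedField E] [NormedAlgebra F E] [FiniteDimensional F E] (θ : E ≃ₐ[F] E) (x : E) :
    ‖θ x‖ = ‖x‖ := by
  have key : ∀ (σ : E ≃ₐ[F] E) (x : E), ‖σ x‖ ≤ ‖x‖ := by
    intro σ x
    rcases eq_or_ne x 0 with rfl | hx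
    · rw [map_zero]
    let φ : E →L[F] E := LinearMap.toContinuousLinearMap σ.toLinearMap
    have h1 : ∀ k : ℕ, (‖σ x‖ / ‖x‖) ^ k ≤ ‖φ‖ := by
      intro k
      rw [div_pow, ← norm_pow, ← norm_pow, ← map_pow]
      exact φ.ratio_le_opNorm (x ^ k)
    exact (div_le_one (norm_pos_iff.2 hx)).1 (le_one_of_pow_le h1)
  refine le_antisymm (key θ x) ?_
  have := key θ.symm (θ x)
  rwa [AlgEquiv.symm_apply_apply] at this

theorem norm_natCast_eq_one {L : Type*} [NormedField L] [IsUltrametricDist L] {p d : ℕ}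
    (hp : ‖(p : L)‖ < 1) (hp0 : 0 < p) (hpd : p.Coprime d) (hd : 0 < d) : ‖(d : L)‖ = 1 := by
  refine le_antisymm (IsUltrametricDist.norm_natCast_le_one L d) ?_
  obtain ⟨q, a, hq, ha⟩ := exists_prime_pow_eq_mul_add_one hp0 hpd hd
  obtain ⟨k, hk⟩ := (hq.eventually_gt_atTop 0).exists
  have e : (1 : L) = (p : L) ^ q k - d * a k := by
    have := congrArg (Nat.cast : ℕ → L) (ha k)
    push_cast at this
    rw [this]
    ring
  by_contra! h
  have h1 : ‖(p : L) ^ q k‖ < 1 := by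
    rw [norm_pow]
    exact pow_lt_one₀ (norm_nonneg _) hp hk.ne'
  have h2 : ‖(d : L) * a k‖ < 1 := by
    rw [norm_mul]
    exact (mul_le_of_le_one_right (norm_nonneg _)
      (IsUltrametricDist.norm_natCast_le_one L _)).trans_lt h
  have h3 := IsUltrametricDist.norm_add_le_max ((p : L) ^ q k) (-(d * a k))
  rw [← sub_eq_add_neg, ← e, norm_one, norm_neg] at h3
  exact absurd h3 (not_le.2 (max_lt h1 h2))

theorem isTameGenerator {F E : Type*} [NontriviallyNormedField F] [CompleteSpace F]
    [NormedField E] [NormedAlgebra F E] [FiniteDimensional F E] [IsGalois F E]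
    [IsUltrametricDist E] {p : ℕ} (hp : p.Prime) (hpF : ‖(p : F)‖ < 1)
    (hpd : ¬ p ∣ Module.finrank F E) {θ : E ≃ₐ[F] E}
    (hθ : ∀ σ : E ≃ₐ[F] E, σ ∈ Subgroup.zpowers θ) : IsTameGenerator p θ := by
  have hpE : ‖(p : E)‖ < 1 := by
    rw [← map_natCast (algebraMap F E), norm_algebraMap']
    exact hpF
  have hcop : p.Coprime (Module.finrank F E) := (Nat.Prime.coprime_iff_not_dvd hp).2 hpd
  refine ⟨hθ, ?_, fun x hx => ?_, norm_algEquiv_apply θ, Module.finrank_pos, hp.pos, hcop, hpE,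
    norm_natCast_eq_one hpE hp.pos hcop Module.finrank_pos⟩
  · rw [orderOf_eq_card_of_forall_mem_zpowers hθ, IsGalois.card_aut_eq_finrank]
  · rw [IsGalois.mem_range_algebraMap_iff_fixed]
    intro σ
    have : Subgroup.zpowers θ ≤ MulAction.stabilizer (E ≃ₐ[F] E) x := by
      rw [Subgroup.zpowers_le]
      exact hx
    exact this (hθ σ)

end LocalFields

section PrincipalCongruence

open scoped Matrix.Norms.Elementwise

variable {n m : ℕ} {L : Type*} [NormedField L] {ϖ : L}

theorem IsUniformizer.norm_pow_mem (hϖ : IsUniformizer ϖ) (hm : 0 < m) :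
    ‖ϖ‖ ^ m ∈ Set.Ioo (0 : ℝ) 1 :=
  ⟨pow_pos (norm_pos_iff.2 hϖ.1) m, pow_lt_one₀ (norm_nonneg _) hϖ.2.1 hm.ne'⟩

theorem principalCongruence_eq [IsUltrametricDist L] (hϖ : IsUniformizer ϖ) (hm : 0 < m) :
    principalCongruence n ϖ m = congruenceSubgroup n L (hϖ.norm_pow_mem hm) := by
  have h0 : ϖ ^ m ≠ 0 := pow_ne_zero m hϖ.1
  ext g
  rw [SetLike.mem_coe, mem_congruenceSubgroup]
  constructor
  · rintro ⟨A, hA, hg⟩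
    rw [hg, add_sub_cancel_left, norm_smul, norm_pow]
    exact mul_le_of_le_one_right (by positivity) ((Matrix.norm_le_iff zero_le_one).2 hA)
  · intro hg
    refine ⟨(ϖ ^ m)⁻¹ • ((g : Matrix (Fin n) (Fin n) L) - 1), fun i j => ?_, ?_⟩
    · refine (norm_entry_le _ i j).trans ?_
      rw [norm_smul, norm_inv, norm_pow]
      exact inv_mul_le_one_of_le₀ hg (by positivity)
    · rw [smul_inv_smul₀ h0, add_sub_cancel]

end PrincipalCongruence

end TwistedOrbital

theorem theorem1p2
    (p : ℕ) [Fact p.Prime] (hp : p ≠ 2)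
    {F E : Type*}
    [NormedField F] [Algebra ℚ_[p] F] [ContinuousSMul ℚ_[p] F] [FiniteDimensional ℚ_[p] F]
    [NormedField E] [NormedAlgebra F E] [FiniteDimensional F E] [IsGalois F E]
    (hpd : ¬ p ∣ Module.finrank F E)
    (θ : E ≃ₐ[F] E) (hθ : ∀ σ : E ≃ₐ[F] E, σ ∈ Subgroup.zpowers θ)
    (n m : ℕ) (hm : 0 < m) (ϖ : E) (hϖ : IsUniformizer ϖ)
    [MeasurableSpace (GL (Fin n) F)] [BorelSpace (GL (Fin n) F)]
    [MeasurableSpace (GL (Fin n) E)] [BorelSpace (GL (Fin n) E)]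
    (dh : Measure (GL (Fin n) F)) [dh.IsHaarMeasure]
    (dg : Measure (GL (Fin n) E)) [dg.IsHaarMeasure]
    (fH : GL (Fin n) F → ℝ)
    (hfH : fH = normalizedIndicator dh (principalCongruenceFixed n F ϖ m))
    (fG : GL (Fin n) E → ℝ)
    (hfG : fG = normalizedIndicator dg (principalCongruence n ϖ m))
    (γ : GL (Fin n) F)
    (hγ : Module.End.IsSemisimple (Matrix.toLin' (γ : Matrix (Fin n) (Fin n) F)))
    (dhγ : Measure (twistedCentralizer (galGL (AlgEquiv.refl : F ≃ₐ[F] F)) γ))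
    [dhγ.IsHaarMeasure]
    (νγ : Measure (Quotient (QuotientGroup.rightRel
      (twistedCentralizer (galGL (AlgEquiv.refl : F ≃ₐ[F] F)) γ))))
    (hνγ : IsQuotientMeasure _ dh dhγ νγ) :
    Integrable (orbitFunction (galGL (AlgEquiv.refl : F ≃ₐ[F] F)) γ fH) νγ ∧
    (∀ δ : GL (Fin n) E, IsNormOf θ γ δ →
      ∀ (dgδ : Measure (twistedCentralizer (galGL θ) δ)) [dgδ.IsHaarMeasure],
        CompatibleMeasures θ γ δ dhγ dgδ →
      ∀ νδ : Measure (Quotient (QuotientGroup.rightRel (twistedCentralizer (galGL θ) δ))),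
        IsQuotientMeasure _ dg dgδ νδ →
          Integrable (orbitFunction (galGL θ) δ fG) νδ ∧
          normalizedOrbitalIntegral (AlgEquiv.refl : F ≃ₐ[F] F) γ fH νγ =
            normalizedOrbitalIntegral θ δ fG νδ) ∧
    ((∀ δ : GL (Fin n) E, ¬ IsNormOf θ γ δ) →
      normalizedOrbitalIntegral (AlgEquiv.refl : F ≃ₐ[F] F) γ fH νγ = 0) := by
  have hpF := norm_prime_lt_one p F
  have hchar := charZero_of_padic_algebra p F
  have hp0 : (p : F) ≠ 0 := Nat.cast_ne_zero.2 (Fact.out : p.Prime).ne_zero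
  have hultF := isUltrametricDist_of_padic_algebra p F
  have hultE : IsUltrametricDist E := IsUltrametricDist.of_normedAlgebra F
  obtain ⟨inst, rfl⟩ := exists_nontriviallyNormedField_eq ⟨(p : F), hp0, hpF.ne⟩
  have hproperF : ProperSpace F := properSpace_of_padic_algebra p F
  have hproperE : ProperSpace E := FiniteDimensional.proper F E
  have h2 : (2 : F) ≠ 0 := two_ne_zero
  have hgen := isTameGenerator Fact.out hpF hpd hθ
  have hr := hϖ.norm_pow_mem hm
  have hKF : principalCongruenceFixed n F ϖ m =
      (congruenceSubgroup n F hr : Set (GL (Fin n) F)) := by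
    ext g
    rw [principalCongruenceFixed, principalCongruence_eq hϖ hm]
    exact inclGL_mem_congruenceSubgroup_iff
  rw [principalCongruence_eq hϖ hm] at hfG
  rw [hKF] at hfH
  subst hfG hfH
  obtain ⟨T, hmem, hdisj, hcov⟩ := exists_doubleCoset_representatives hγ hr
  refine ⟨(integral_orbitFunction_refl h2 hγ hνγ hmem hdisj hcov).1, ?_, ?_⟩
  · intro δ hδ dgδ _ hcomp νδ hνδ
    exact hδ.integral_eq hgen h2 hγ hνγ hcomp hνδ
  · intro hnot
    have hzero : orbitFunction (galGL (AlgEquiv.refl : F ≃ₐ[F] F)) γ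
        (normalizedIndicator dh (congruenceSubgroup n F hr)) = 0 := by
      refine orbitFunction_eq_zero fun g hg => ?_
      obtain ⟨δ, hδ⟩ := exists_isNormOf hgen hγ hg
      exact hnot δ hδ
    rw [normalizedOrbitalIntegral, hzero]
    simp only [Pi.zero_apply, integral_zero, mul_zero]
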